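/- **Setting.** Let $k,K\in\mathbb N$, and let $\mathbf X=(X_1,\dots,X_d)$ be a random vector with law $\mathcal D$, each $X_i$ taking at most $K$ values. Let $\mathcal G_{d,k}$ be the set of DAGs on $[d]$ with in-degree at most $k$. A family is a pair $\langle i,\Pi\rangle$ with $\Pi\subseteq[d]\setminus\{i\}$; write $H(\langle i,\Pi\rangle)=H(X_i\mid \mathbf X_\Pi)$ and let $\mathcal F_{d,k}$ be the set of families with $|\Pi|\le k$. A DAG $G$ is identified with its $d$ families, and its score is $\mathcal S(G)=-\sum_{f\in G}H(f)$; $\mathcal S^*=\max_{G\in\mathcal G_{d,k}}\mathcal S(G)$. Two DAGs are Markov equivalent if they induce the same conditional independence constraints; the classes in $\mathcal G_{d,k}$ are called ECs. For $\gamma>0$ and $V\subseteq[d]$, $\mathcal D$ is *$(\gamma,V)$-stable* if (i) in every $G\in\mathcal G_{d,k}$ with $\mathcal S(G)\ge\mathcal S^*-\gamma$ all parents of nodes of $V$ lie in $V$, and (ii) for the marginal of $\mathcal D$ on $V$, among DAGs over $V$ of in-degree at most $k$, there is a unique optimal EC and every graph outside it has a score smaller by more than $\gamma$. In each draw of an independent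 copy of $\mathbf X$, exactly $k+1$ coordinates, chosen by the algorithm, are observed. Let $\hat H(f)$ be the plug-in estimate of $H(f)$ from all draws in which all variables of $f$ were observed, let $\hat{\mathcal S}(G)=-\sum_{f\in G}\hat H(f)$, let $\hat{\mathcal S}(A)=\max_{G\in A}\hat{\mathcal S}(G)$ for a set $A$ of graphs, and let $$N(\epsilon,\delta)=\Big\lceil\max\Big\{\tfrac{8}{\epsilon^2}\log\tfrac2\delta\,\log^2\!\big(\tfrac{8\log(2/\delta)}{\epsilon^2}\big),\ e^2,\ K,\ \tfrac{(K-1)K^k}{\epsilon}\Big\}\Big\rceil .$$ *Naive algorithm:* observe each $(k+1)$-subset of $[d]$ in $N(\epsilon/(2d),\delta/|\mathcal F_{d,k}|)$ draws; it uses $M_{\rm naive}=\binom d{k+1}N(\epsilon/(2d),\delta/|\mathcal F_{d,k}|)$ draws. *Interactive algorithm:* let $T=\lceil\log_2(2d\epsilon_1/\epsilon)\rceil$. Maintain a set $\mathcal A$ of accepted families and the set $\mathcal V$ of their children, both initially empty; a family is active if it is in $\mathcal F_{d,k}$ and its child is not in $\mathcal V$. For $t=1,2,\dots$ with $\epsilon_t=\epsilon_1/2^{t-1}$,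 as long as $\mathcal V\ne[d]$ and $\epsilon_t>\epsilon/(d-|\mathcal V|)$: draw until every $(k+1)$-subset not contained in $\mathcal V$ has been observed $N(\epsilon_t/2,\delta/(T\cdot|\text{active families}|))$ times in total; then repeat until no family is accepted: pick $\hat G$ maximizing $\hat{\mathcal S}$ among the $G\in\mathcal G_{d,k}$ with $\mathcal A\subseteq G$, let $\hat E$ be its EC, for an EC $E$ let $E^{\mathcal A}=\{G\in E:\mathcal A\subseteq G\}$, and accept some active family $f$ (if there is one) that belongs to some graph of $\hat E^{\mathcal A}$ and to some graph of $E^{\mathcal A}$ for every EC $E$ with $E^{\mathcal A}\neq\emptyset$ and $\hat{\mathcal S}(\hat E^{\mathcal A})-\hat{\mathcal S}(E^{\mathcal A})\le(d-|\mathcal V|)\epsilon_t$. If $\mathcal V\neq[d]$ at the end, draw until every $(k+1)$-subset not contained in $\mathcal V$ has been observed $N(\epsilon_{\rm last}/2,\delta/(T\cdot|\text{active families}|))$ times in total, where $\epsilon_{\rm last}=\epsilon/(d-|\mathcal V|)$. Let $M_{\rm act}$ be the total number of draws. **Theorem.** Fix $k,K,q\in\mathbb N$ and $\gamma,\epsilon_1,C>0$.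 There are a constant $c>0$ and an exponent $a\in\mathbb N$, depending only on these, such that for every $d>q$, every law $\mathcal D$ of $d$ discrete variables with at most $K$ values each, every $V\subseteq[d]$ with $|V|=d-q$ such that $\mathcal D$ is $(\gamma,V)$-stable, every $0<\epsilon\le C d^{-3/2}$ and every $\delta\in(0,1)$: with probability at least $1-\delta$, for every way of resolving ties and free choices in the interactive algorithm, $$M_{\rm naive}\cdot \log^a\!\big(d+2+|\log\epsilon|\big)\ \ge\ c\,d^3\,M_{\rm act}.$$ That is, for $\epsilon=O(d^{-3/2})$ the interactive algorithm improves on the sample complexity of the naive one by a factor of $\widetilde\Omega(d^3)$. -/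

import Mathlib

open MeasureTheory

noncomputable section

namespace BNSL

section Entropy

variable {ι : Type*} [Fintype ι] [DecidableEq ι] {α : ι → Type*} [∀ i, Fintype (α i)]

open Classical in
/-- For a law `p` of a random vector `X` (a probability mass function on the joint values),
`margAt p S x` is the probability that `X` agrees with `x` on the coordinates in `S`. -/
def margAt (p : (∀ i, α i) → ℝ) (S : Finset ι) (x : ∀ i, α i) : ℝ :=
  ∑ y : (∀ i, α i) with ∀ i ∈ S, y i = x i, p y

/-- The conditional entropy `H(X_i ∣ X_Q) = 𝔼[-log P(X_i ∣ X_Q)]` (in nats) of a random vector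
with law `p`. It depends on `p` only through the marginal on the coordinates `{i} ∪ Q`. -/
def condEntropy (p : (∀ i, α i) → ℝ) (i : ι) (Q : Finset ι) : ℝ :=
  ∑ x : (∀ i, α i), -(p x * Real.log (margAt p (insert i Q) x / margAt p Q x))

open Classical in
/-- The marginal law on the coordinates in `V`. -/
def marginal (p : (∀ i, α i) → ℝ) (V : Finset ι) : (∀ i : V, α i) → ℝ :=
  fun x => ∑ y : (∀ i, α i) with ∀ i : V, y i = x i, p y

/-- `X_A` and `X_B` are conditionally independent given `X_C`, for a random vector with law `p`. -/
def CondIndep (p : (∀ i, α i) → ℝ) (A B C : Finset ι) : Prop :=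
  ∀ x, margAt p (A ∪ B ∪ C) x * margAt p C x = margAt p (A ∪ C) x * margAt p (B ∪ C) x

end Entropy

section Graphs

/-- A directed acyclic graph on `ι`, given by its parent sets. -/
structure Dag (ι : Type*) where
  /-- the parents of a node -/
  pa : ι → Finset ι
  acyclic : ∀ i, ¬ Relation.TransGen (fun a b => a ∈ pa b) i i

/-- A family: a child together with its parent set. -/
abbrev Family (ι : Type*) := ι × Finset ι

variable {ι : Type*} [Fintype ι] [DecidableEq ι]

/-- The set of families of a graph. -/
def Dag.families (G : Dag ι) : Set (Family ι) := {f | G.pa f.1 = f.2}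

/-- The DAGs on `ι` in which each node has at most `k` parents. -/
def structs (ι : Type*) (k : ℕ) : Set (Dag ι) := {G | ∀ i, (G.pa i).card ≤ k}

/-- All the possible families over `ι` with at most `k` parents. -/
def allFamilies (ι : Type*) [Fintype ι] [DecidableEq ι] (k : ℕ) : Finset (Family ι) :=
  Finset.univ.filter fun f => f.1 ∉ f.2 ∧ f.2.card ≤ k

/-- `p` is generated by a Bayesian network with graph `G`:
`p x = ∏ i, P(x i ∣ x restricted to the parents of i)` for some conditional distributions. -/
def Factorizes {β : ι → Type*} [∀ i, Fintype (β i)] (G : Dag ι) (p : (∀ i, β i) → ℝ) : Prop :=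
  ∃ θ : ∀ i, (∀ j : G.pa i, β j) → β i → ℝ,
    (∀ i u a, 0 ≤ θ i u a) ∧ (∀ i u, ∑ a, θ i u a = 1) ∧
    ∀ x, p x = ∏ i, θ i (fun j => x j) (x i)

/-- The conditional independence constraints induced by `G`: the statements
`X_A ⊥ X_B ∣ X_C` that hold in every discrete distribution generated by a network with graph `G`. -/
def inducedCI (G : Dag ι) : Set (Finset ι × Finset ι × Finset ι) :=
  {s | Disjoint s.1 s.2.1 ∧ Disjoint s.1 s.2.2 ∧ Disjoint s.2.1 s.2.2 ∧
    ∀ (m : ι → ℕ) (p : (∀ i, Fin (m i)) → ℝ), Factorizes G p → CondIndep p s.1 s.2.1 s.2.2}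

/-- Markov equivalence: the same induced conditional independence constraints. -/
def MarkovEquiv (G G' : Dag ι) : Prop := inducedCI G = inducedCI G'

/-- The Markov equivalence class of `G` within the graphs of in-degree at most `k`. -/
def classOf (k : ℕ) (G : Dag ι) : Set (Dag ι) := {G' | G' ∈ structs ι k ∧ MarkovEquiv G G'}

/-- The Markov equivalence classes of the graphs on `ι` of in-degree at most `k`. -/
def ecs (ι : Type*) [Fintype ι] [DecidableEq ι] (k : ℕ) : Set (Set (Dag ι)) :=
  {E | ∃ G ∈ structs ι k, E = classOf k G}

variable {α : ι → Type*} [∀ i, Fintype (α i)]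

/-- The score `-∑ i, H(X_i ∣ parents of i)` of a graph, for a random vector with law `p`. -/
def score (p : (∀ i, α i) → ℝ) (G : Dag ι) : ℝ := -∑ i, condEntropy p i (G.pa i)

/-- The maximal score of a graph of in-degree at most `k` (a maximum over a finite set). -/
def optScore (k : ℕ) (p : (∀ i, α i) → ℝ) : ℝ := sSup (score p '' structs ι k)

/-- `(γ, V)`-stability: in every graph whose score is `γ`-close to optimal, the parents of nodes in
`V` are in `V`; and for the marginal on `V` there is an equivalence class whose score exceeds the
score of every graph over `V` outside of this class by more than `γ`. -/
structure Stable (k : ℕ) (γ : ℝ) (V : Finset ι) (p : (∀ i, α i) → ℝ) : Prop where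
  closed : ∀ G ∈ structs ι k, optScore k p - γ ≤ score p G → ∀ i ∈ V, G.pa i ⊆ V
  unique_gap : ∃ E ∈ ecs V k, ∀ G ∈ E, ∀ G' ∈ structs V k, G' ∉ E →
    score (marginal p V) G' + γ < score (marginal p V) G

end Graphs

section Sampling

/-- The number of samples `N(ε, δ)` used for estimating the conditional entropy of one variable
given at most `k` others up to `ε` with confidence `1 - δ` by the plug-in estimator, when all
variables have at most `K` values. -/
def sampleBound (k K : ℕ) (ε δ : ℝ) : ℕ :=
  ⌈max (8 / ε ^ 2 * Real.log (2 / δ) * Real.log (8 * Real.log (2 / δ) / ε ^ 2) ^ 2)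
    (max (Real.exp 2) (max (K : ℝ) (((K : ℝ) - 1) * (K : ℝ) ^ k / ε)))⌉₊

variable {ι : Type*} [Fintype ι] [DecidableEq ι]

/-- The sets of variables that can be observed: all those of size `k + 1`. -/
def obsSets (ι : Type*) [Fintype ι] (k : ℕ) : Finset (Finset ι) :=
  Finset.powersetCard (k + 1) Finset.univ

/-- The number of vector draws of the naive algorithm, which observes each variable set of size
`k + 1` in `N(ε / (2d), δ / |all families|)` draws. -/
def naiveDraws (ι : Type*) [Fintype ι] [DecidableEq ι] (k K : ℕ) (ε δ : ℝ) : ℕ :=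
  (obsSets ι k).card *
    sampleBound k K (ε / (2 * Fintype.card ι)) (δ / (allFamilies ι k).card)

variable {α : ι → Type*} [∀ i, Fintype (α i)]

/-- The outcomes of all potential draws: `ω (S, n)` is the random vector drawn at the `n`-th time
that the variable set `S` is observed. Only its coordinates in `S` are revealed. -/
abbrev Table (α : ι → Type*) := Finset ι × ℕ → ∀ i, α i

/-- The draws in which all variables of `Q` were observed together, after each variable set `S` has
been observed `cnt S` times. -/
def draws (k : ℕ) (cnt : Finset ι → ℕ) (Q : Finset ι) : Finset (Finset ι × ℕ) :=
  ((obsSets ι k).filter fun S => Q ⊆ S).biUnion fun S =>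
    (Finset.range (cnt S)).image fun n => (S, n)

open Classical in
/-- The empirical law of a finite set of draws. -/
def empLaw (ω : Table α) (D : Finset (Finset ι × ℕ)) : (∀ i, α i) → ℝ :=
  fun x => ((D.filter fun r => ω r = x).card : ℝ) / D.card

/-- The plug-in estimate of `H(X_i ∣ X_Q)`, from the draws in which `{i} ∪ Q` was observed.
Its value depends only on the coordinates in `{i} ∪ Q` of these draws. -/
def empEntropy (k : ℕ) (ω : Table α) (cnt : Finset ι → ℕ) (i : ι) (Q : Finset ι) : ℝ :=
  condEntropy (empLaw ω (draws k cnt (insert i Q))) i Q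

/-- The empirical score of a graph. -/
def empScore (k : ℕ) (ω : Table α) (cnt : Finset ι → ℕ) (G : Dag ι) : ℝ :=
  -∑ i, empEntropy k ω cnt i (G.pa i)

end Sampling

section Algorithm

variable {ι : Type*} [Fintype ι] [DecidableEq ι] {α : ι → Type*} [∀ i, Fintype (α i)]

/-- A way to resolve the free choices of the algorithm: which empirically optimal graph is used and
which of the acceptable families is accepted. The choices may depend on the round and on the set of
families accepted so far, which together identify an iteration within a run. -/
structure TieBreak (ι : Type*) where
  graph : ℕ → Finset (Family ι) → Set (Dag ι) → Dag ι
  graph_mem : ∀ t A s, s.Nonempty → graph t A s ∈ s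
  family : ℕ → Finset (Family ι) → Set (Family ι) → Family ι
  family_mem : ∀ t A s, s.Nonempty → family t A s ∈ s

/-- The variables whose families have been accepted. -/
def accVars (A : Finset (Family ι)) : Finset ι := A.image Prod.fst

/-- The candidate families: those whose child is not in `V`. -/
def active (k : ℕ) (V : Finset ι) : Finset (Family ι) :=
  (allFamilies ι k).filter fun f => f.1 ∉ V

/-- The graphs of `E` that include all the families in `A`. -/
def consistent (A : Finset (Family ι)) (E : Set (Dag ι)) : Set (Dag ι) :=
  {G ∈ E | ∀ f ∈ A, f ∈ G.families}

/-- The families that appear in some graph of `E`. -/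
def familiesOf (E : Set (Dag ι)) : Set (Family ι) := {f | ∃ G ∈ E, f ∈ G.families}

/-- The graphs of in-degree at most `k` that include all the families in `A` and have a maximal
value of `s` among these. -/
def argmaxGraphs (k : ℕ) (s : Dag ι → ℝ) (A : Finset (Family ι)) : Set (Dag ι) :=
  {G ∈ consistent A (structs ι k) | ∀ G' ∈ consistent A (structs ι k), s G' ≤ s G}

/-- The value of `s` on a (finite, nonempty) set of graphs: the maximum over the set. -/
def setScore (s : Dag ι → ℝ) (E : Set (Dag ι)) : ℝ := sSup (s '' E)

/-- The families which may be accepted in an iteration with empirical score `s`, accuracy `ε_t`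
and accepted families `A`, when `G` is the chosen empirically optimal graph. -/
def acceptable (k : ℕ) (s : Dag ι → ℝ) (εt : ℝ) (A : Finset (Family ι)) (G : Dag ι) :
    Set (Family ι) :=
  {f | f ∈ familiesOf (consistent A (classOf k G)) ∧ f ∈ active k (accVars A) ∧
    ∀ E ∈ ecs ι k, (consistent A E).Nonempty →
      setScore s (consistent A (classOf k G)) - setScore s (consistent A E)
        ≤ ((Fintype.card ι : ℝ) - (accVars A).card) * εt →
      f ∈ familiesOf (consistent A E)}

open Classical in
/-- One iteration of the inner loop in round `t`: accept a family if possible. -/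
def iteration (k : ℕ) (τ : TieBreak ι) (t : ℕ) (s : Dag ι → ℝ) (εt : ℝ)
    (A : Finset (Family ι)) : Finset (Family ι) :=
  let F := acceptable k s εt A (τ.graph t A (argmaxGraphs k s A))
  if F.Nonempty then insert (τ.family t A F) A else A

theorem subset_iteration (k : ℕ) (τ : TieBreak ι) (t : ℕ) (s : Dag ι → ℝ) (εt : ℝ)
    (A : Finset (Family ι)) : A ⊆ iteration k τ t s εt A := by
  unfold iteration
  dsimp only
  split_ifs
  · exact Finset.subset_insert _ _
  · exact Finset.Subset.refl _

/-- The inner loop: iterate until no family is accepted. -/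
def innerLoop (k : ℕ) (τ : TieBreak ι) (t : ℕ) (s : Dag ι → ℝ) (εt : ℝ)
    (A : Finset (Family ι)) : Finset (Family ι) :=
  if iteration k τ t s εt A = A then A
  else innerLoop k τ t s εt (iteration k τ t s εt A)
termination_by Fintype.card (Family ι) - A.card
decreasing_by
  rename_i h
  have h1 : A.card < (iteration k τ t s εt A).card :=
    Finset.card_lt_card
      (Finset.ssubset_iff_subset_ne.2 ⟨subset_iteration k τ t s εt A, Ne.symm h⟩)
  have h2 := Finset.card_le_univ (iteration k τ t s εt A)
  omega

/-- The state of the algorithm between rounds: the accepted families, and the number of times that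
each variable set has been observed. -/
structure State (ι : Type*) where
  acc : Finset (Family ι)
  cnt : Finset ι → ℕ

/-- The accuracy level of a round, with rounds numbered from `0`; it is halved every round. -/
def accuracy (ε₁ : ℝ) (t : ℕ) : ℝ := ε₁ / 2 ^ t

/-- The bound `T = ⌈log₂ (2 d ε₁ / ε)⌉` on the number of rounds. -/
def maxRounds (ι : Type*) [Fintype ι] (ε ε₁ : ℝ) : ℕ :=
  ⌈Real.logb 2 (2 * Fintype.card ι * ε₁ / ε)⌉₊

/-- The number of times `N(a / 2, δ / (T |active families|))` that each active variable set should
have been observed for accuracy `a`. -/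
def target (k K : ℕ) (ε ε₁ δ : ℝ) (A : Finset (Family ι)) (a : ℝ) : ℕ :=
  sampleBound k K (a / 2) (δ / (maxRounds ι ε ε₁ * (active k (accVars A)).card))

/-- Observe each variable set that is not contained in `V` until it has been observed `n` times. -/
def observe (V : Finset ι) (n : ℕ) (cnt : Finset ι → ℕ) : Finset ι → ℕ :=
  fun S => if S ⊆ V then cnt S else max (cnt S) n

/-- A round of the algorithm. -/
def round (k K : ℕ) (ε ε₁ δ : ℝ) (τ : TieBreak ι) (ω : Table α) (t : ℕ) (σ : State ι) : State ι :=
  let cnt := observe (accVars σ.acc) (target k K ε ε₁ δ σ.acc (accuracy ε₁ t)) σ.cnt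
  ⟨innerLoop k τ t (empScore k ω cnt) (accuracy ε₁ t) σ.acc, cnt⟩

/-- The state of the algorithm after `t` rounds, as long as the main loop is still running. -/
def stateAt (k K : ℕ) (ε ε₁ δ : ℝ) (τ : TieBreak ι) (ω : Table α) : ℕ → State ι
  | 0 => ⟨∅, fun _ => 0⟩
  | t + 1 => round k K ε ε₁ δ τ ω t (stateAt k K ε ε₁ δ τ ω t)

/-- The condition for executing another round: not all families have been accepted, and
`ε_t > ε / (d - |V|)`. -/
def Running (ε ε₁ : ℝ) (t : ℕ) (σ : State ι) : Prop :=
  accVars σ.acc ≠ Finset.univ ∧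
    ε / ((Fintype.card ι : ℝ) - (accVars σ.acc).card) < accuracy ε₁ t

/-- The main loop terminates. -/
theorem exists_not_running (k K : ℕ) {ε : ℝ} (hε : 0 < ε) (ε₁ δ : ℝ) (τ : TieBreak ι)
    (ω : Table α) : ∃ t, ¬ Running ε ε₁ t (stateAt k K ε ε₁ δ τ ω t) := by
  by_contra! h
  have hd : 0 < (Fintype.card ι : ℝ) := by
    rcases isEmpty_or_nonempty ι with hι | hι
    · exact absurd (Subsingleton.elim _ _) (h 0).1
    · exact_mod_cast Fintype.card_pos
  have hlim : Filter.Tendsto (accuracy ε₁) Filter.atTop (nhds 0) :=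
    tendsto_const_nhds.div_atTop (tendsto_pow_atTop_atTop_of_one_lt one_lt_two)
  obtain ⟨t, ht⟩ := (hlim.eventually (gt_mem_nhds (div_pos hε hd))).exists
  have h1 := h t
  have hlt : ((accVars (stateAt k K ε ε₁ δ τ ω t).acc).card : ℝ) < Fintype.card ι := by
    exact_mod_cast (Finset.card_lt_iff_ne_univ _).2 h1.1
  have h2 : ε / (Fintype.card ι : ℝ) ≤
      ε / ((Fintype.card ι : ℝ) - (accVars (stateAt k K ε ε₁ δ τ ω t).acc).card) := by
    apply div_le_div_of_nonneg_left hε.le (by linarith)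
    have : (0 : ℝ) ≤ ((accVars (stateAt k K ε ε₁ δ τ ω t).acc).card : ℝ) := by positivity
    linarith
  linarith [h1.2]

/-- The number of rounds executed by the main loop. -/
def numRounds (k K : ℕ) (ε ε₁ δ : ℝ) (τ : TieBreak ι) (ω : Table α) : ℕ :=
  sInf {t | ¬ Running ε ε₁ t (stateAt k K ε ε₁ δ τ ω t)}

/-- The number of times that each variable set was observed when the algorithm ends: if there are
variables without an accepted family when the main loop ends, then the remaining variable sets are
observed according to the accuracy level `ε / (d - |V|)`. -/
def finalCounts (k K : ℕ) (ε ε₁ δ : ℝ) (τ : TieBreak ι) (ω : Table α) : Finset ι → ℕ :=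
  let σ := stateAt k K ε ε₁ δ τ ω (numRounds k K ε ε₁ δ τ ω)
  if accVars σ.acc = Finset.univ then σ.cnt
  else observe (accVars σ.acc)
    (target k K ε ε₁ δ σ.acc (ε / ((Fintype.card ι : ℝ) - (accVars σ.acc).card))) σ.cnt

/-- The total number of vector draws of the interactive algorithm. -/
def activeDraws (k K : ℕ) (ε ε₁ δ : ℝ) (τ : TieBreak ι) (ω : Table α) : ℕ :=
  ∑ S ∈ obsSets ι k, finalCounts k K ε ε₁ δ τ ω S

end Algorithm

end BNSL

end

set_option linter.unusedSectionVars false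

/-! Cost. `sampleBound` grows like 1/ε² up to logarithms. Once all variables of V have accepted
families, only sets containing one of the q variables outside V are still observed, a fraction
O(1/d) of all sets. At most q variables are then open, so no accuracy finer than ε/q is requested,
against ε/d for the naive algorithm: a further factor O(1/d²). Before that point accuracies of order
γ/d are enough, and the cost relative to the naive one is of order (ε/γ)², which is O(d⁻³) because ε
≤ C d^(-3/2). Both contributions are O(d⁻³) up to logarithms (`activeDraws_le_of_accurateRounds`).

Acceptance. Suppose that the estimated entropy differences of round t are correct up to ε_t. The
accepted families then always extend to an optimal graph (`Extendable.insert`): the class of such a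
graph passes the threshold test, hence contains a graph with the new family, and equivalent graphs
have equal scores. The last fact (`MarkovEquiv.score_eq`) holds because the score is the best
expected log-likelihood among the laws generated by the graph, and equivalent graphs generate the
same laws. When moreover 2dε_t ≤ γ, each class that passes the test contains a consistent graph
whose true score is within γ of the optimum. Stability makes V parent-closed in it and puts its
restriction to V in the unique optimal class. The same is true of Ĝ, so the V-part of Ĝ can be
transplanted into that graph without leaving its class (`MarkovEquiv.glue`). Every open family of Ĝ
with child in V is therefore acceptable (`acceptable_nonempty`), and V is exhausted.

Estimation. Square roots of empirical frequencies concentrate at a rate independent of the frequency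
(`measure_sqrt_deviation_le`), and -x log x is Lipschitz in √x (`abs_negMulLog_sub_le`). A union
bound over families and over all sample sizes n covers the counts chosen adaptively. The loss, a
factor of order K^(k+1) and a term log n, is absorbed by the log² in N once d is large
(`deviation_le`). For bounded d, the interactive cost is at most polylogarithmic times the naive one
on every outcome (`activeDraws_le_mul`), and c absorbs d³. -/

namespace BNSL

/-! ### Marginal probabilities. -/

section Marginals

variable {ι : Type*} [Fintype ι] [DecidableEq ι] {α : ι → Type*} [∀ i, Fintype (α i)]
  {p : (∀ i, α i) → ℝ}

theorem margAt_nonneg (hp : ∀ x, 0 ≤ p x) (S : Finset ι) (x : ∀ i, α i) : 0 ≤ margAt p S x :=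
  Finset.sum_nonneg fun y _ => hp y

theorem margAt_anti (hp : ∀ x, 0 ≤ p x) {S T : Finset ι} (h : S ⊆ T) (x : ∀ i, α i) :
    margAt p T x ≤ margAt p S x := by
  classical
  refine Finset.sum_le_sum_of_subset_of_nonneg (fun y hy => ?_) fun y _ _ => hp y
  simp only [Finset.mem_filter, Finset.mem_univ, true_and] at hy ⊢
  exact fun i hi => hy i (h hi)

theorem margAt_congr {S : Finset ι} {x y : ∀ i, α i} (h : ∀ i ∈ S, x i = y i) :
    margAt p S x = margAt p S y := by
  classical
  unfold margAt
  congr 1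
  ext z
  simp only [Finset.mem_filter, Finset.mem_univ, true_and]
  exact ⟨fun hz i hi => (hz i hi).trans (h i hi), fun hz i hi => (hz i hi).trans (h i hi).symm⟩

theorem margAt_univ (x : ∀ i, α i) : margAt p Finset.univ x = p x := by
  classical
  unfold margAt
  rw [Finset.sum_eq_single_of_mem x (by simp)]
  intro y hy hne
  simp only [Finset.mem_filter, Finset.mem_univ, true_and, true_implies] at hy
  exact absurd (funext hy) hne

theorem le_margAt (hp : ∀ x, 0 ≤ p x) (S : Finset ι) (x : ∀ i, α i) : p x ≤ margAt p S x := by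
  rw [← margAt_univ (p := p) x]
  exact margAt_anti hp (Finset.subset_univ S) x

theorem margAt_empty (x : ∀ i, α i) : margAt p ∅ x = ∑ y, p y := by
  simp [margAt]

theorem margAt_eq_sum_update {S : Finset ι} {j : ι} (hj : j ∉ S) (x : ∀ i, α i) :
    margAt p S x = ∑ b, margAt p (insert j S) (Function.update x j b) := by
  classical
  unfold margAt
  rw [← Finset.sum_fiberwise (Finset.univ.filter fun y : ∀ i, α i => ∀ i ∈ S, y i = x i)
    (fun y => y j) p]
  refine Finset.sum_congr rfl fun b _ => Finset.sum_congr ?_ fun _ _ => rfl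
  ext y
  simp only [Finset.mem_filter, Finset.mem_univ, true_and, Finset.mem_insert, forall_eq_or_imp,
    Function.update_self]
  have h : ∀ i ∈ S, Function.update x j b i = x i := fun i hi =>
    Function.update_of_ne (ne_of_mem_of_not_mem hi hj) _ _
  constructor
  · rintro ⟨h1, h2⟩
    exact ⟨h2, fun i hi => (h1 i hi).trans (h i hi).symm⟩
  · rintro ⟨h1, h2⟩
    exact ⟨fun i hi => (h2 i hi).trans (h i hi), h1⟩

end Marginals

/-! ### Factorization along a DAG and the ordered Markov property. -/

section Factorization

variable {ι : Type*} {α : ι → Type*} [∀ i, Fintype (α i)]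

theorem Dag.notMem_pa (G : Dag ι) (i : ι) : i ∉ G.pa i :=
  fun h => G.acyclic i (.single h)

theorem Dag.ext_pa {G G' : Dag ι} (h : ∀ i, G.pa i = G'.pa i) : G = G' := by
  cases G
  cases G'
  congr
  exact funext h

/-- A set of nodes that contains the parents of its elements. -/
def Dag.Closed (G : Dag ι) (W : Finset ι) : Prop := ∀ i ∈ W, G.pa i ⊆ W

variable [Fintype ι] [DecidableEq ι] {p : (∀ i, α i) → ℝ} {G : Dag ι}

theorem Dag.exists_source (G : Dag ι) {W : Finset ι} (hW : W ≠ Finset.univ) :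
    ∃ i ∉ W, G.pa i ⊆ W := by
  have : Std.Irrefl (Relation.TransGen fun a b => a ∈ G.pa b) := ⟨G.acyclic⟩
  have wf : WellFounded (Relation.TransGen fun a b => a ∈ G.pa b) :=
    Finite.wellFounded_of_trans_of_irrefl _
  obtain ⟨j, hj⟩ : ∃ j, j ∉ W := by
    by_contra! h
    exact hW (Finset.eq_univ_iff_forall.2 h)
  obtain ⟨i, hi, hmin⟩ := wf.has_min {j | j ∉ W} ⟨j, hj⟩
  refine ⟨i, hi, fun a ha => ?_⟩
  by_contra h
  exact hmin a h (.single ha)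

theorem Dag.Closed.insert {W : Finset ι} (hW : G.Closed W) {i : ι} (hi : G.pa i ⊆ W) :
    G.Closed (insert i W) := by
  intro j hj
  rcases Finset.mem_insert.1 hj with rfl | hj
  · exact hi.trans (Finset.subset_insert _ _)
  · exact (hW j hj).trans (Finset.subset_insert _ _)

theorem Dag.closed_empty (G : Dag ι) : G.Closed ∅ := fun i hi => absurd hi (Finset.notMem_empty i)

/-- To prove a property of the set of all nodes, add the nodes in a topological order. -/
theorem Dag.univ_induction (G : Dag ι) {P : Finset ι → Prop} (h0 : P ∅)
    (hs : ∀ W i, G.Closed W → i ∉ W → G.pa i ⊆ W → P W → P (insert i W)) : P Finset.univ := by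
  have key : ∀ n ≤ Fintype.card ι, ∃ W : Finset ι, W.card = n ∧ G.Closed W ∧ P W := by
    intro n
    induction n with
    | zero => exact fun _ => ⟨∅, rfl, G.closed_empty, h0⟩
    | succ n ih =>
      intro hn
      obtain ⟨W, hc, hW, hP⟩ := ih (by omega)
      have hne : W ≠ Finset.univ := by
        rintro rfl
        rw [Finset.card_univ] at hc
        omega
      obtain ⟨i, hi, hpa⟩ := G.exists_source hne
      exact ⟨insert i W, by rw [Finset.card_insert_of_notMem hi, hc], hW.insert hpa,
        hs W i hW hi hpa hP⟩
  obtain ⟨W, hc, -, hP⟩ := key _ le_rfl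
  rwa [← (Finset.card_eq_iff_eq_univ W).1 hc]

/-- To prove a property of all closed sets, remove nodes in a reverse topological order. -/
theorem Dag.closed_induction (G : Dag ι) {P : Finset ι → Prop} (h0 : P Finset.univ)
    (hs : ∀ W i, G.Closed W → i ∉ W → G.pa i ⊆ W → P (insert i W) → P W) {W : Finset ι}
    (hW : G.Closed W) : P W := by
  induction hn : Fintype.card ι - W.card generalizing W with
  | zero =>
    have : W = Finset.univ := by
      rw [← Finset.card_eq_iff_eq_univ]
      have := Finset.card_le_univ W
      omega
    rwa [this]
  | succ n ih =>
    have hne : W ≠ Finset.univ := by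
      rintro rfl
      rw [Finset.card_univ] at hn
      omega
    obtain ⟨i, hi, hpa⟩ := G.exists_source hne
    refine hs W i hW hi hpa (ih (hW.insert hpa) ?_)
    rw [Finset.card_insert_of_notMem hi]
    omega

/-- Conditional distributions of the nodes given their parents, as functions of the joint value. -/
structure IsKernel (G : Dag ι) (θ : ι → (∀ i, α i) → ℝ) : Prop where
  nonneg : ∀ i x, 0 ≤ θ i x
  congr : ∀ i x y, x i = y i → (∀ j ∈ G.pa i, x j = y j) → θ i x = θ i y
  sum_update : ∀ i x, ∑ a, θ i (Function.update x i a) = 1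

/-- Kernels defined on full joint values avoid the dependent type of parent configurations. The
point `x₀` only fills in coordinates on which a kernel does not depend. -/
theorem factorizes_iff (x₀ : ∀ i, α i) :
    Factorizes G p ↔ ∃ θ : ι → (∀ i, α i) → ℝ, IsKernel G θ ∧ ∀ x, p x = ∏ i, θ i x := by
  constructor
  · rintro ⟨θ, h0, h1, h⟩
    refine ⟨fun i x => θ i (fun j => x j) (x i), ⟨fun i x => h0 _ _ _, ?_, ?_⟩, h⟩
    · intro i x y hi hpa
      have : (fun j : G.pa i => x j) = fun j : G.pa i => y j := funext fun j => hpa j j.2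
      simp only [this, hi]
    · intro i x
      have : ∀ a, (fun j : G.pa i => Function.update x i a j) = fun j : G.pa i => x j :=
        fun a => funext fun j => Function.update_of_ne (ne_of_mem_of_not_mem j.2 (G.notMem_pa i)) _ _
      simp only [this, Function.update_self, h1]
  · rintro ⟨θ, hθ, h⟩
    refine ⟨fun i u a => θ i (Function.update
      (fun j => if hj : j ∈ G.pa i then u ⟨j, hj⟩ else x₀ j) i a),
      fun i u a => hθ.nonneg _ _, fun i u => hθ.sum_update _ _, fun x => ?_⟩
    rw [h x]
    refine Finset.prod_congr rfl fun i _ => hθ.congr i _ _ (by simp) fun j hj => ?_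
    rw [Function.update_of_ne (ne_of_mem_of_not_mem hj (G.notMem_pa i))]
    simp [hj]

variable {θ : ι → (∀ i, α i) → ℝ}

theorem prod_update_kernel (hθ : IsKernel G θ) {W : Finset ι} (hW : G.Closed W) {i : ι}
    (hi : i ∉ W) (x : ∀ i, α i) (a : α i) :
    ∏ j ∈ W, θ j (Function.update x i a) = ∏ j ∈ W, θ j x :=
  Finset.prod_congr rfl fun j hj => hθ.congr j _ _
    (Function.update_of_ne (ne_of_mem_of_not_mem hj hi) _ _)
    fun _ hl => Function.update_of_ne (ne_of_mem_of_not_mem (hW j hj hl) hi) _ _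

/-- Summing out a node none of whose children remain removes its kernel, which sums to one, and
leaves the other factors unchanged. -/
theorem margAt_closed (hθ : IsKernel G θ) (hp : ∀ x, p x = ∏ i, θ i x) {W : Finset ι}
    (hW : G.Closed W) : ∀ x, margAt p W x = ∏ i ∈ W, θ i x := by
  refine G.closed_induction (P := fun W => ∀ x, margAt p W x = ∏ i ∈ W, θ i x) ?_ ?_ hW
  · intro x
    rw [margAt_univ, hp]
  · intro W i hW hi _ ih x
    rw [margAt_eq_sum_update hi]
    simp only [ih, Finset.prod_insert hi, prod_update_kernel hθ hW hi]
    rw [← Finset.sum_mul, hθ.sum_update, one_mul]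

theorem sum_eq_one_of_kernel (hθ : IsKernel G θ) (hp : ∀ x, p x = ∏ i, θ i x) (x₀ : ∀ i, α i) :
    ∑ x, p x = 1 := by
  rw [← margAt_empty x₀, margAt_closed hθ hp G.closed_empty, Finset.prod_empty]

/-- It holds for `S = W` by `margAt_closed`. Summing out the variables of `W \ S` one at a time
preserves it, since `θ i` does not depend on them. -/
theorem margAt_insert_kernel (hθ : IsKernel G θ) (hp : ∀ x, p x = ∏ i, θ i x) {W : Finset ι}
    (hW : G.Closed W) {i : ι} (hi : i ∉ W) (hpa : G.pa i ⊆ W) {S : Finset ι} (hS : G.pa i ⊆ S)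
    (hSW : S ⊆ W) (x : ∀ i, α i) : margAt p (insert i S) x = margAt p S x * θ i x := by
  induction hn : W.card - S.card generalizing S x with
  | zero =>
    have : S = W := Finset.eq_of_subset_of_card_le hSW (by omega)
    subst this
    rw [margAt_closed hθ hp (hW.insert hpa), margAt_closed hθ hp hW, Finset.prod_insert hi,
      mul_comm]
  | succ n ih =>
    obtain ⟨j, hjW, hjS⟩ : ∃ j ∈ W, j ∉ S := by
      by_contra! h
      rw [Finset.Subset.antisymm hSW h] at hn
      omega
    have hji : j ≠ i := fun h => hi (h ▸ hjW)
    have hj' : j ∉ insert i S := by simp [hji, hjS]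
    rw [margAt_eq_sum_update hj', margAt_eq_sum_update hjS, Finset.sum_mul]
    refine Finset.sum_congr rfl fun b _ => ?_
    rw [Finset.insert_comm, ih (hS.trans (Finset.subset_insert _ _))
      (Finset.insert_subset hjW hSW) _ (by rw [Finset.card_insert_of_notMem hjS]; omega)]
    congr 1
    exact hθ.congr i _ _ (Function.update_of_ne hji.symm _ _)
      fun _ hl => Function.update_of_ne (ne_of_mem_of_not_mem (hS hl) hjS) _ _

theorem singleton_union_sdiff_union (i : ι) {W Q : Finset ι} (h : Q ⊆ W) :
    {i} ∪ W \ Q ∪ Q = insert i W := by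
  rw [Finset.union_assoc, Finset.sdiff_union_of_subset h, Finset.insert_eq]

/-- The ordered Markov property. -/
theorem condIndep_of_kernel (hθ : IsKernel G θ) (hp : ∀ x, p x = ∏ i, θ i x) {W : Finset ι}
    (hW : G.Closed W) {i : ι} (hi : i ∉ W) (hpa : G.pa i ⊆ W) :
    CondIndep p {i} (W \ G.pa i) (G.pa i) := by
  intro x
  rw [singleton_union_sdiff_union i hpa, Finset.sdiff_union_of_subset hpa, ← Finset.insert_eq,
    margAt_insert_kernel hθ hp hW hi hpa hpa subset_rfl,
    margAt_insert_kernel hθ hp hW hi hpa subset_rfl hpa]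
  ring

open Classical in
/-- The conditional distributions of the nodes given their parents for a random vector with law
`p` (uniform where the parents have probability zero). -/
noncomputable def condKernel (p : (∀ i, α i) → ℝ) (G : Dag ι) (i : ι) (x : ∀ i, α i) : ℝ :=
  if margAt p (G.pa i) x = 0 then ((Fintype.card (α i) : ℝ))⁻¹
  else margAt p (insert i (G.pa i)) x / margAt p (G.pa i) x

theorem isKernel_condKernel (hp : ∀ x, 0 ≤ p x) : IsKernel G (condKernel p G) where
  nonneg i x := by
    unfold condKernel
    split_ifs
    · positivity
    · exact div_nonneg (margAt_nonneg hp _ _) (margAt_nonneg hp _ _)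
  congr i x y hi hpa := by
    unfold condKernel
    rw [margAt_congr hpa, margAt_congr (S := insert i (G.pa i)) (y := y)]
    simpa using ⟨hi, hpa⟩
  sum_update i x := by
    have h : ∀ a, margAt p (G.pa i) (Function.update x i a) = margAt p (G.pa i) x := fun a =>
      margAt_congr fun j hj => Function.update_of_ne (ne_of_mem_of_not_mem hj (G.notMem_pa i)) _ _
    unfold condKernel
    simp only [h]
    split_ifs with h0
    · have : Nonempty (α i) := ⟨x i⟩
      simp
    · rw [← Finset.sum_div, ← margAt_eq_sum_update (G.notMem_pa i), div_self h0]

/-- The chain rule in a topological order, where conditional independence replaces all predecessors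
of a node by its parents. With `condIndep_of_kernel`, factorization thus becomes a matter of
independence statements only. -/
theorem eq_prod_condKernel (hp : ∀ x, 0 ≤ p x) (hp1 : ∑ x, p x = 1)
    (h : ∀ W i, G.Closed W → i ∉ W → G.pa i ⊆ W → CondIndep p {i} (W \ G.pa i) (G.pa i)) :
    ∀ x, p x = ∏ i, condKernel p G i x := by
  suffices H : ∀ x, margAt p Finset.univ x = ∏ i, condKernel p G i x from
    fun x => (margAt_univ x).symm.trans (H x)
  refine G.univ_induction (P := fun W => ∀ x, margAt p W x = ∏ i ∈ W, condKernel p G i x) ?_ ?_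
  · intro x
    rw [margAt_empty, hp1, Finset.prod_empty]
  · intro W i hW hi hpa ih x
    rw [Finset.prod_insert hi, ← ih]
    have h1 := h W i hW hi hpa x
    rw [singleton_union_sdiff_union i hpa, Finset.sdiff_union_of_subset hpa,
      ← Finset.insert_eq] at h1
    unfold condKernel
    split_ifs with h0
    -- Where the parents have probability zero both sides vanish, so the uniform default of
    -- `condKernel` plays no role.
    · have e1 : margAt p W x = 0 :=
        le_antisymm (h0 ▸ margAt_anti hp hpa x) (margAt_nonneg hp _ _)
      have e2 : margAt p (insert i W) x = 0 :=
        le_antisymm (e1 ▸ margAt_anti hp (Finset.subset_insert i W) x) (margAt_nonneg hp _ _)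
      rw [e1, e2, mul_zero]
    · field_simp
      exact h1

end Factorization

/-! ### Renaming values: `inducedCI` only tests laws on the types `Fin (m i)`, other finite types
are reduced to these. -/

section Relabel

variable {ι : Type*} [Fintype ι] [DecidableEq ι] {α β : ι → Type*} [∀ i, Fintype (α i)]
  [∀ i, Fintype (β i)] {p : (∀ i, α i) → ℝ} {G : Dag ι}

theorem margAt_relabel (e : ∀ i, α i ≃ β i) (S : Finset ι) (x : ∀ i, α i) :
    margAt (fun y : ∀ i, β i => p fun i => (e i).symm (y i)) S (fun i => e i (x i)) =
      margAt p S x := by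
  classical
  unfold margAt
  refine (Finset.sum_equiv (Equiv.piCongrRight e) (fun y => ?_) fun y _ => ?_).symm
  · simp
  · simp

theorem condIndep_relabel (e : ∀ i, α i ≃ β i) {A B C : Finset ι}
    (h : CondIndep (fun y : ∀ i, β i => p fun i => (e i).symm (y i)) A B C) :
    CondIndep p A B C := by
  intro x
  simpa only [margAt_relabel] using h fun i => e i (x i)

theorem factorizes_relabel (e : ∀ i, α i ≃ β i) (x₀ : ∀ i, α i) (h : Factorizes G p) :
    Factorizes G (fun y : ∀ i, β i => p fun i => (e i).symm (y i)) := by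
  obtain ⟨θ, hθ, hp⟩ := (factorizes_iff x₀).1 h
  refine (factorizes_iff fun i => e i (x₀ i)).2
    ⟨fun i y => θ i fun j => (e j).symm (y j), ⟨fun i y => hθ.nonneg _ _, ?_, ?_⟩, fun y => hp _⟩
  · intro i x y hi hpa
    exact hθ.congr _ _ _ (by rw [hi]) fun j hj => by rw [hpa j hj]
  · intro i y
    have : ∀ a, (fun j => (e j).symm (Function.update y i a j)) =
        Function.update (fun j => (e j).symm (y j)) i ((e i).symm a) := by
      intro a
      ext j
      rcases eq_or_ne j i with rfl | hj
      · simp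
      · simp [hj]
    simp only [this]
    rw [Equiv.sum_comp (e i).symm fun b => θ i (Function.update (fun j => (e j).symm (y j)) i b)]
    exact hθ.sum_update _ _

end Relabel

/-! ### Score equivalence of Markov equivalent graphs. -/

section Equivalence

variable {ι : Type*} [Fintype ι] [DecidableEq ι] {α : ι → Type*} [∀ i, Fintype (α i)]
  {p : (∀ i, α i) → ℝ} {G G' : Dag ι}

theorem condIndep_of_mem_inducedCI {A B C : Finset ι} (h : (A, B, C) ∈ inducedCI G)
    (x₀ : ∀ i, α i) (hp : Factorizes G p) : CondIndep p A B C :=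
  condIndep_relabel (fun i => Fintype.equivFin (α i))
    (h.2.2.2 _ _ (factorizes_relabel (fun i => Fintype.equivFin (α i)) x₀ hp))

theorem mem_inducedCI {W : Finset ι} (hW : G.Closed W) {i : ι} (hi : i ∉ W)
    (hpa : G.pa i ⊆ W) : ({i}, W \ G.pa i, G.pa i) ∈ inducedCI G := by
  refine ⟨?_, ?_, Finset.sdiff_disjoint, fun m p hp => ?_⟩
  · rw [Finset.disjoint_singleton_left]
    exact fun h => hi (Finset.mem_sdiff.1 h).1
  · rw [Finset.disjoint_singleton_left]
    exact G.notMem_pa i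
  · by_cases hne : Nonempty (∀ i, Fin (m i))
    · obtain ⟨θ, hθ, hp⟩ := (factorizes_iff hne.some).1 hp
      exact condIndep_of_kernel hθ hp hW hi hpa
    · exact fun x => absurd ⟨x⟩ hne

/-- Markov equivalent graphs generate the same distributions. -/
theorem MarkovEquiv.factorizes (h : MarkovEquiv G G') (x₀ : ∀ i, α i) (hp : Factorizes G p) :
    Factorizes G' p := by
  obtain ⟨θ, hθ, hpθ⟩ := (factorizes_iff x₀).1 hp
  have h0 : ∀ x, 0 ≤ p x := fun x => hpθ x ▸ Finset.prod_nonneg fun i _ => hθ.nonneg i x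
  refine (factorizes_iff x₀).2 ⟨condKernel p G', isKernel_condKernel h0,
    eq_prod_condKernel h0 (sum_eq_one_of_kernel hθ hpθ x₀) fun W i hW hi hpa => ?_⟩
  have hm := mem_inducedCI hW hi hpa
  rw [← show inducedCI G = inducedCI G' from h] at hm
  exact condIndep_of_mem_inducedCI hm x₀ hp

/-- Both sides sum `g x * p y` over the pairs that agree on `S`, a symmetric relation. -/
theorem sum_mul_margAt_comm (p g : (∀ i, α i) → ℝ) (S : Finset ι) :
    ∑ x, g x * margAt p S x = ∑ x, p x * margAt g S x := by
  classical
  simp only [margAt, Finset.mul_sum, Finset.sum_filter]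
  rw [Finset.sum_comm]
  refine Finset.sum_congr rfl fun y _ => Finset.sum_congr rfl fun x _ => ?_
  have : (∀ i ∈ S, y i = x i) ↔ ∀ i ∈ S, x i = y i :=
    ⟨fun h i hi => (h i hi).symm, fun h i hi => (h i hi).symm⟩
  simp only [this]
  split_ifs <;> ring

theorem margAt_mul {F : (∀ i, α i) → ℝ} {S : Finset ι}
    (hF : ∀ x y, (∀ i ∈ S, x i = y i) → F x = F y) (x : ∀ i, α i) :
    margAt (fun y => F y * p y) S x = F x * margAt p S x := by
  classical
  unfold margAt
  rw [Finset.mul_sum]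
  refine Finset.sum_congr rfl fun y hy => ?_
  exact congrArg (· * p y) (hF y x (Finset.mem_filter.1 hy).2)

variable (hp : ∀ x, 0 ≤ p x) (hp1 : ∑ x, p x = 1)
include hp

theorem condKernel_of_pos (i : ι) {x : ∀ i, α i} (hx : 0 < p x) :
    condKernel p G i x = margAt p (insert i (G.pa i)) x / margAt p (G.pa i) x := by
  unfold condKernel
  rw [if_neg (hx.trans_le (le_margAt hp _ _)).ne']

theorem condKernel_pos (i : ι) {x : ∀ i, α i} (hx : 0 < p x) : 0 < condKernel p G i x := by
  rw [condKernel_of_pos hp i hx]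
  exact div_pos (hx.trans_le (le_margAt hp _ _)) (hx.trans_le (le_margAt hp _ _))

theorem neg_condEntropy_eq (i : ι) :
    -condEntropy p i (G.pa i) = ∑ x, p x * Real.log (condKernel p G i x) := by
  unfold condEntropy
  rw [← Finset.sum_neg_distrib]
  refine Finset.sum_congr rfl fun x _ => ?_
  rcases (hp x).eq_or_lt with h | h
  · simp [← h]
  · rw [neg_neg, condKernel_of_pos hp i h]

include hp1

/-- Gibbs' inequality: the true conditional distribution maximizes the expected log-likelihood. -/
theorem sum_mul_log_kernel_le {θ : ι → (∀ i, α i) → ℝ} (hθ : IsKernel G θ) (i : ι)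
    (hpos : ∀ x, 0 < p x → 0 < θ i x) :
    ∑ x, p x * Real.log (θ i x) ≤ -condEntropy p i (G.pa i) := by
  set T := insert i (G.pa i) with hT
  -- `F` times the marginal of the parents is the likelihood ratio of `θ i` to the true conditional
  -- law where `p` is positive. `F` itself depends only on coordinates in `T`, so it can be pulled
  -- out of marginals on `T`.
  set F : (∀ i, α i) → ℝ := fun x => θ i x / margAt p T x with hF
  have hFl : ∀ x y, (∀ j ∈ T, x j = y j) → F x = F y := fun x y h => by
    rw [hF]
    dsimp only
    rw [margAt_congr h, hθ.congr i x y (h i (Finset.mem_insert_self _ _))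
      fun j hj => h j (Finset.mem_insert_of_mem hj)]
  -- The expected likelihood ratio is at most one; it can be smaller because `θ i` may give mass to
  -- values of probability zero. The claim then follows from log y ≤ y - 1.
  have key : ∑ x, F x * p x * margAt p (G.pa i) x ≤ 1 := by
    rw [sum_mul_margAt_comm p fun x => F x * p x, ← hp1]
    refine Finset.sum_le_sum fun x _ => mul_le_of_le_one_right (hp x) ?_
    rw [margAt_eq_sum_update (G.notMem_pa i), ← hθ.sum_update i x]
    refine Finset.sum_le_sum fun a _ => ?_
    rw [margAt_mul hFl]
    rcases (margAt_nonneg hp T (Function.update x i a)).eq_or_lt with h | h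
    · rw [← h, mul_zero]
      exact hθ.nonneg _ _
    · rw [hF]
      dsimp only
      rw [div_mul_cancel₀ _ h.ne']
  rw [neg_condEntropy_eq hp, ← sub_nonpos, ← Finset.sum_sub_distrib]
  calc ∑ x, (p x * Real.log (θ i x) - p x * Real.log (condKernel p G i x))
      ≤ ∑ x, (F x * p x * margAt p (G.pa i) x - p x) := by
        refine Finset.sum_le_sum fun x _ => ?_
        rcases (hp x).eq_or_lt with h | h
        · simp [← h]
        · have h1 := condKernel_pos hp (G := G) i h
          rw [← mul_sub, ← Real.log_div (hpos x h).ne' h1.ne']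
          have h2 := Real.log_le_sub_one_of_pos (div_pos (hpos x h) h1)
          have h3 : F x * p x * margAt p (G.pa i) x - p x =
              p x * (θ i x / condKernel p G i x - 1) := by
            rw [condKernel_of_pos hp i h, hF, ← hT]
            dsimp only
            field_simp
          rw [h3]
          exact mul_le_mul_of_nonneg_left h2 h.le
    _ ≤ 0 := by
        rw [Finset.sum_sub_distrib, hp1]
        linarith

/-- The law `p` need not factorize over `G`. Its projection, the product of the `condKernel p G i`,
does, and its expected log-likelihood under `p` is the score of `G`. By equivalence the projection
also factorizes over `G'`, and Gibbs' inequality for each node bounds this log-likelihood by the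
score of `G'`. -/
theorem MarkovEquiv.score_le (h : MarkovEquiv G G') : score p G ≤ score p G' := by
  obtain ⟨x₀⟩ : Nonempty (∀ i, α i) := by
    by_contra hne
    rw [not_nonempty_iff] at hne
    simp at hp1
  obtain ⟨θ, hθ, hpθ⟩ := (factorizes_iff x₀).1 (h.factorizes x₀
    ((factorizes_iff x₀).2 ⟨condKernel p G, isKernel_condKernel hp, fun x => rfl⟩))
  have hpos : ∀ i x, 0 < p x → 0 < θ i x := by
    intro i x hx
    have h1 : 0 < ∏ i, condKernel p G i x := Finset.prod_pos fun i _ => condKernel_pos hp i hx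
    rw [hpθ x] at h1
    exact (hθ.nonneg i x).lt_of_ne' (Finset.prod_ne_zero_iff.1 h1.ne' i (Finset.mem_univ i))
  unfold score
  rw [← Finset.sum_neg_distrib, ← Finset.sum_neg_distrib]
  calc ∑ i, -condEntropy p i (G.pa i)
      = ∑ i, ∑ x, p x * Real.log (condKernel p G i x) :=
        Finset.sum_congr rfl fun i _ => neg_condEntropy_eq hp i
    _ = ∑ x, p x * Real.log (∏ i, condKernel p G i x) := by
        rw [Finset.sum_comm]
        refine Finset.sum_congr rfl fun x _ => ?_
        rcases (hp x).eq_or_lt with h | h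
        · simp [← h]
        · rw [Real.log_prod fun i _ => (condKernel_pos hp i h).ne', Finset.mul_sum]
    _ = ∑ i, ∑ x, p x * Real.log (θ i x) := by
        rw [Finset.sum_comm]
        refine Finset.sum_congr rfl fun x _ => ?_
        rcases (hp x).eq_or_lt with h | h
        · simp [← h]
        · rw [hpθ x, Real.log_prod fun i _ => (hpos i x h).ne', Finset.mul_sum]
    _ ≤ ∑ i, -condEntropy p i (G'.pa i) :=
        Finset.sum_le_sum fun i _ => sum_mul_log_kernel_le hp hp1 hθ i (hpos i)

/-- Markov equivalent graphs have the same score. -/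
theorem MarkovEquiv.score_eq (h : MarkovEquiv G G') : score p G = score p G' :=
  le_antisymm (h.score_le hp hp1) (MarkovEquiv.score_le hp hp1 (Eq.symm h))

end Equivalence

/-! ### Passing to the marginal law on a set of nodes. -/

section Marginal

variable {ι : Type*} [Fintype ι] [DecidableEq ι] {α : ι → Type*} [∀ i, Fintype (α i)]
  {p : (∀ i, α i) → ℝ}

theorem margAt_eq_marginal (S : Finset ι) (x : ∀ i, α i) :
    margAt p S x = marginal p S fun i => x i := by
  classical
  unfold margAt marginal
  refine Finset.sum_congr ?_ fun _ _ => rfl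
  ext y
  simp

theorem marginal_nonneg (hp : ∀ x, 0 ≤ p x) (V : Finset ι) (u : ∀ i : V, α i) :
    0 ≤ marginal p V u :=
  Finset.sum_nonneg fun y _ => hp y

theorem sum_mul_marginal (p : (∀ i, α i) → ℝ) (V : Finset ι) (F : (∀ i : V, α i) → ℝ) :
    ∑ u, marginal p V u * F u = ∑ x, p x * F fun i => x i := by
  classical
  rw [← Finset.sum_fiberwise Finset.univ (fun x : ∀ i, α i => fun i : V => x i)]
  refine Finset.sum_congr rfl fun u _ => ?_
  unfold marginal
  rw [Finset.sum_mul]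
  refine Finset.sum_congr ?_ fun x hx => ?_
  · ext y
    simp [funext_iff]
  · rw [(Finset.mem_filter.1 hx).2]

theorem margAt_marginal (V : Finset ι) (Q : Finset V) (x : ∀ i, α i) :
    margAt (marginal p V) Q (fun i => x i) = margAt p (Q.map (.subtype _)) x := by
  classical
  have := sum_mul_marginal p V fun u => if ∀ i ∈ Q, u i = x i then 1 else 0
  simp only [mul_ite, mul_one, mul_zero, ← Finset.sum_filter] at this
  unfold margAt
  rw [this]
  refine Finset.sum_congr ?_ fun _ _ => rfl
  ext y
  simp

theorem condEntropy_marginal (V : Finset ι) (i : V) (Q : Finset V) :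
    condEntropy (marginal p V) i Q = condEntropy p i (Q.map (.subtype _)) := by
  unfold condEntropy
  simp only [Finset.sum_neg_distrib]
  rw [sum_mul_marginal]
  simp only [margAt_marginal, Finset.map_insert, Function.Embedding.subtype_apply]

end Marginal

/-! ### Restricting a graph to V and replacing its part on V. -/

section Glue

variable {ι : Type*} [DecidableEq ι] {α : ι → Type*} [∀ i, Fintype (α i)]
  {p : (∀ i, α i) → ℝ} {V : Finset ι}

/-- The graph on the nodes in `V` induced by `G`. -/
def Dag.restrict (G : Dag ι) (V : Finset ι) : Dag V where
  pa i := (G.pa i).subtype (· ∈ V)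
  acyclic i h := G.acyclic i (Relation.TransGen.lift Subtype.val
    (fun _ _ h => Finset.mem_subtype.1 h) i i h)

/-- The graph in which the nodes in `V` have their parents in `H`, and the other nodes have their
parents in `G`. -/
def Dag.glue (G : Dag ι) (H : Dag V) : Dag ι where
  pa i := if h : i ∈ V then (H.pa ⟨i, h⟩).map (.subtype _) else G.pa i
  acyclic i := by
    -- Edges into V start in V. Hence a path that ends in V lies in V and is a path of `H`, while a
    -- path between nodes outside V never enters V and is a path of `G`.
    have key : ∀ a b, Relation.TransGen (fun a b => a ∈ (if h : b ∈ V then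
        (H.pa ⟨b, h⟩).map (Function.Embedding.subtype (· ∈ V)) else G.pa b)) a b →
        (∀ hb : b ∈ V, ∃ ha : a ∈ V,
          Relation.TransGen (fun a b => a ∈ H.pa b) ⟨a, ha⟩ ⟨b, hb⟩) ∧
        (b ∉ V → a ∉ V → Relation.TransGen (fun a b => a ∈ G.pa b) a b) := by
      intro a b hab
      have step : ∀ a b, (a ∈ (if h : b ∈ V then
          (H.pa ⟨b, h⟩).map (Function.Embedding.subtype (· ∈ V)) else G.pa b)) →
          ∀ hb : b ∈ V, ∃ ha : a ∈ V, (⟨a, ha⟩ : V) ∈ H.pa ⟨b, hb⟩ := by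
        intro a b h hb
        rw [dif_pos hb] at h
        obtain ⟨⟨c, hc⟩, hm, rfl⟩ := Finset.mem_map.1 h
        exact ⟨hc, hm⟩
      induction hab with
      | single h =>
        refine ⟨fun hb => ?_, fun hb _ => ?_⟩
        · obtain ⟨ha, h⟩ := step _ _ h hb
          exact ⟨ha, .single h⟩
        · rw [dif_neg hb] at h
          exact .single h
      | tail _ h ih =>
        rename_i b c _
        refine ⟨fun hc => ?_, fun hc ha => ?_⟩
        · obtain ⟨hb, h⟩ := step _ _ h hc
          obtain ⟨ha, h'⟩ := ih.1 hb
          exact ⟨ha, h'.tail h⟩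
        · rw [dif_neg hc] at h
          by_cases hb : b ∈ V
          · exact absurd (ih.1 hb).1 ha
          · exact (ih.2 hb ha).tail h
    intro h
    by_cases hi : i ∈ V
    · exact H.acyclic _ ((key i i h).1 hi).2
    · exact G.acyclic i ((key i i h).2 hi hi)

theorem Dag.glue_pa_mem (G : Dag ι) (H : Dag V) {i : ι} (h : i ∈ V) :
    (G.glue H).pa i = (H.pa ⟨i, h⟩).map (.subtype _) :=
  dif_pos h

theorem Dag.glue_pa_notMem (G : Dag ι) (H : Dag V) {i : ι} (h : i ∉ V) :
    (G.glue H).pa i = G.pa i :=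
  dif_neg h

theorem Dag.closed_glue (G : Dag ι) (H : Dag V) : (G.glue H).Closed V := by
  intro i hi j hj
  rw [G.glue_pa_mem H hi] at hj
  obtain ⟨c, -, rfl⟩ := Finset.mem_map.1 hj
  exact c.2

theorem Dag.restrict_pa_map (G : Dag ι) (hG : G.Closed V) {i : ι} (h : i ∈ V) :
    ((G.restrict V).pa ⟨i, h⟩).map (.subtype _) = G.pa i := by
  unfold Dag.restrict
  rw [Finset.subtype_map, Finset.filter_true_of_mem (hG i h)]

theorem Dag.glue_restrict (G : Dag ι) (hG : G.Closed V) : G.glue (G.restrict V) = G := by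
  refine Dag.ext_pa fun i => ?_
  by_cases h : i ∈ V
  · rw [G.glue_pa_mem _ h, G.restrict_pa_map hG]
  · exact G.glue_pa_notMem _ h

variable [Fintype ι] {k : ℕ}

theorem Dag.glue_mem_structs {G : Dag ι} {H : Dag V} (hG : G ∈ structs ι k)
    (hH : H ∈ structs V k) : G.glue H ∈ structs ι k := by
  intro i
  by_cases h : i ∈ V
  · rw [G.glue_pa_mem H h, Finset.card_map]
    exact hH _
  · rw [G.glue_pa_notMem H h]
    exact hG i

theorem Dag.restrict_mem_structs {G : Dag ι} (hG : G ∈ structs ι k) :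
    G.restrict V ∈ structs V k := by
  intro i
  refine le_trans ?_ (hG i)
  rw [← Finset.card_map (.subtype (· ∈ V))]
  refine Finset.card_le_card fun j hj => ?_
  obtain ⟨c, hc, rfl⟩ := Finset.mem_map.1 hj
  exact Finset.mem_subtype.1 (show c ∈ (G.pa i).subtype (· ∈ V) from hc)

theorem score_glue (G : Dag ι) (H : Dag V) :
    score p (G.glue H) =
      score (marginal p V) H - ∑ i ∈ Finset.univ.filter (· ∉ V), condEntropy p i (G.pa i) := by
  unfold score
  rw [← Finset.sum_filter_add_sum_filter_not Finset.univ (· ∈ V), neg_add, sub_eq_add_neg]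
  congr 2
  · rw [Finset.filter_mem_eq_inter, Finset.univ_inter, ← Finset.sum_coe_sort]
    refine Finset.sum_congr rfl fun i _ => ?_
    rw [condEntropy_marginal, G.glue_pa_mem H i.2]
  · refine Finset.sum_congr rfl fun i hi => ?_
    rw [G.glue_pa_notMem H (Finset.mem_filter.1 hi).2]

/-- V is closed, so the kernels of its nodes multiply to the marginal law on V. That marginal
factorizes over `H`, hence over `H'`; its new kernels replace the old ones in V and the other
kernels are kept. -/
theorem factorizes_glue {G : Dag ι} {H H' : Dag V} (h : MarkovEquiv H H') (x₀ : ∀ i, α i)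
    (hp : Factorizes (G.glue H) p) : Factorizes (G.glue H') p := by
  obtain ⟨θ, hθ, hpθ⟩ := (factorizes_iff x₀).1 hp
  let ext : (∀ i : V, α i) → ∀ i, α i := fun u j => if hj : j ∈ V then u ⟨j, hj⟩ else x₀ j
  have ext_val : ∀ (u : ∀ i : V, α i) (j : V), ext u j = u j := fun u j => dif_pos j.2
  have hV : Factorizes H (marginal p V) := by
    refine (factorizes_iff (α := fun i : V => α i) fun i => x₀ i).2 ⟨fun i u => θ i (ext u), ⟨fun _ _ => hθ.nonneg _ _,
      fun i u v hi hpa => hθ.congr _ _ _ ?_ ?_, fun i u => ?_⟩, fun u => ?_⟩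
    · rw [ext_val, ext_val, hi]
    · intro j hj
      rw [G.glue_pa_mem H i.2] at hj
      obtain ⟨c, hc, rfl⟩ := Finset.mem_map.1 hj
      simpa only [Function.Embedding.subtype_apply, ext_val] using hpa c hc
    · have : ∀ a, ext (Function.update u i a) = Function.update (ext u) i a := by
        intro a
        ext j
        by_cases hj : j ∈ V
        · lift j to V using hj
          rw [ext_val]
          rcases eq_or_ne j i with rfl | hji
          · simp
          · rw [Function.update_of_ne hji, Function.update_of_ne (Subtype.coe_injective.ne hji),
              ext_val]
        · rw [Function.update_of_ne (ne_of_mem_of_not_mem i.2 hj).symm]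
          simp [ext, hj]
      simp only [this]
      exact hθ.sum_update _ _
    · have : u = fun i : V => ext u i := funext fun i => (ext_val u i).symm
      conv_lhs => rw [this]
      rw [← margAt_eq_marginal, margAt_closed hθ hpθ (G.closed_glue H),
        ← Finset.prod_coe_sort]
  obtain ⟨θ', hθ', hpθ'⟩ := (factorizes_iff (α := fun i : V => α i) fun i => x₀ i).1 (h.factorizes (fun i => x₀ i) hV)
  refine (factorizes_iff x₀).2 ⟨fun i x => if hi : i ∈ V then θ' ⟨i, hi⟩ (fun j => x j) else θ i x,
    ⟨fun i x => ?_, fun i x y hi hpa => ?_, fun i x => ?_⟩, fun x => ?_⟩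
  · split_ifs
    exacts [hθ'.nonneg _ _, hθ.nonneg _ _]
  · split_ifs with h
    · rw [G.glue_pa_mem _ h] at hpa
      exact hθ'.congr _ _ _ hi fun j hj => hpa j (Finset.mem_map_of_mem _ hj)
    · rw [G.glue_pa_notMem _ h] at hpa
      exact hθ.congr _ _ _ hi fun j hj => hpa j (by rwa [G.glue_pa_notMem _ h] at hj)
  · by_cases h : i ∈ V
    · simp only [h, dif_pos]
      have : ∀ a, (fun j : V => Function.update x i a j) =
          Function.update (fun j : V => x j) ⟨i, h⟩ a := by
        intro a
        ext j
        rcases eq_or_ne j ⟨i, h⟩ with rfl | hji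
        · simp
        · rw [Function.update_of_ne hji, Function.update_of_ne fun e => hji (Subtype.ext e)]
      simp only [this]
      exact hθ'.sum_update ⟨i, h⟩ fun j : V => x j
    · simp only [h, dif_neg, not_false_eq_true]
      exact hθ.sum_update i x
  · rw [hpθ, ← Finset.prod_filter_mul_prod_filter_not Finset.univ (· ∈ V),
      ← Finset.prod_filter_mul_prod_filter_not Finset.univ (· ∈ V) fun i =>
        if hi : i ∈ V then θ' ⟨i, hi⟩ (fun j => x j) else θ i x]
    congr 1
    · rw [Finset.filter_mem_eq_inter, Finset.univ_inter, ← margAt_closed hθ hpθ (G.closed_glue H),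
        margAt_eq_marginal, hpθ', ← Finset.prod_coe_sort V]
      exact Finset.prod_congr rfl fun i _ => by rw [dif_pos i.2]
    · exact Finset.prod_congr rfl fun i hi => by rw [dif_neg (Finset.mem_filter.1 hi).2]

theorem inducedCI_subset_of_factorizes {ι : Type*} [Fintype ι] [DecidableEq ι] {G G' : Dag ι}
    (h : ∀ (m : ι → ℕ) (p : (∀ i, Fin (m i)) → ℝ), (∀ i, Fin (m i)) →
      Factorizes G' p → Factorizes G p) : inducedCI G ⊆ inducedCI G' := by
  rintro ⟨A, B, C⟩ ⟨h1, h2, h3, h4⟩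
  exact ⟨h1, h2, h3, fun m p hp x => h4 m p (h m p x hp) x⟩

theorem MarkovEquiv.glue {G : Dag ι} {H H' : Dag V} (h : MarkovEquiv H H') :
    MarkovEquiv (G.glue H) (G.glue H') :=
  Set.Subset.antisymm
    (inducedCI_subset_of_factorizes fun _ _ x₀ hp => factorizes_glue (Eq.symm h) x₀ hp)
    (inducedCI_subset_of_factorizes fun _ _ x₀ hp => factorizes_glue h x₀ hp)

end Glue

/-! ### Soundness and completeness of one acceptance step. -/

section Core

variable {ι : Type*} [Fintype ι] [DecidableEq ι]

theorem Dag.pa_injective : Function.Injective (Dag.pa : Dag ι → ι → Finset ι) :=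
  fun _ _ h => Dag.ext_pa fun i => congrFun h i

instance : Finite (Dag ι) := Finite.of_injective _ Dag.pa_injective

theorem le_setScore (s : Dag ι → ℝ) {E : Set (Dag ι)} {G : Dag ι} (h : G ∈ E) :
    s G ≤ setScore s E :=
  le_csSup (Set.toFinite _).bddAbove (Set.mem_image_of_mem s h)

theorem exists_eq_setScore (s : Dag ι → ℝ) {E : Set (Dag ι)} (h : E.Nonempty) :
    ∃ G ∈ E, s G = setScore s E :=
  (h.image s).csSup_mem (Set.toFinite _)

theorem mem_classOf {k : ℕ} {G : Dag ι} (h : G ∈ structs ι k) : G ∈ classOf k G := ⟨h, rfl⟩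

theorem argmaxGraphs_nonempty {k : ℕ} (s : Dag ι → ℝ) {A : Finset (Family ι)}
    (h : (consistent A (structs ι k)).Nonempty) : (argmaxGraphs k s A).Nonempty := by
  obtain ⟨G, hG, hmax⟩ := Set.exists_max_image _ s (Set.toFinite _) h
  exact ⟨G, hG, hmax⟩

theorem setScore_classOf_argmax {k : ℕ} {s : Dag ι → ℝ} {A : Finset (Family ι)} {G : Dag ι}
    (h : G ∈ argmaxGraphs k s A) : setScore s (consistent A (classOf k G)) = s G := by
  have hmem : G ∈ consistent A (classOf k G) := ⟨mem_classOf h.1.1, h.1.2⟩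
  obtain ⟨G', hG', he⟩ := exists_eq_setScore s ⟨G, hmem⟩
  exact le_antisymm (he ▸ h.2 G' ⟨hG'.1.1, hG'.2⟩) (le_setScore s hmem)

variable {α : ι → Type*} [∀ i, Fintype (α i)] {k : ℕ} {p : (∀ i, α i) → ℝ}

/-- The families in `A` belong to a common optimal graph. -/
def Extendable (k : ℕ) (p : (∀ i, α i) → ℝ) (A : Finset (Family ι)) : Prop :=
  ∃ G ∈ consistent A (structs ι k), ∀ G' ∈ structs ι k, score p G' ≤ score p G

theorem extendable_empty (k : ℕ) (p : (∀ i, α i) → ℝ) : Extendable k p ∅ := by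
  have hne : (structs ι k).Nonempty := by
    refine ⟨⟨fun _ => ∅, fun i h => ?_⟩, fun i => by simp⟩
    obtain ⟨b, -, hb⟩ := Relation.TransGen.tail'_iff.1 h
    simp at hb
  obtain ⟨G, hG, hmax⟩ := Set.exists_max_image _ (score p) (Set.toFinite _) hne
  exact ⟨G, ⟨hG, by simp⟩, hmax⟩

/-- The differences of the estimates `h` for the families of a child that is not in `U` are
correct up to `e`. -/
def Accurate (k : ℕ) (p : (∀ i, α i) → ℝ) (h : ι → Finset ι → ℝ) (e : ℝ) (U : Finset ι) : Prop :=
  ∀ i ∉ U, ∀ Q Q' : Finset ι, i ∉ Q → i ∉ Q' → Q.card ≤ k → Q'.card ≤ k →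
    (h i Q - h i Q') - (condEntropy p i Q - condEntropy p i Q') ≤ e

theorem Accurate.mono {h : ι → Finset ι → ℝ} {e : ℝ} {U U' : Finset ι}
    (H : Accurate k p h e U) (hU : U ⊆ U') : Accurate k p h e U' :=
  fun i hi => H i fun h => hi (hU h)

theorem pa_eq_of_mem_accVars {A : Finset (Family ι)} {E E' : Set (Dag ι)} {G G' : Dag ι}
    (hG : G ∈ consistent A E) (hG' : G' ∈ consistent A E') {i : ι} (hi : i ∈ accVars A) :
    G.pa i = G'.pa i := by
  obtain ⟨f, hf, rfl⟩ := Finset.mem_image.1 hi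
  exact (hG.2 f hf).trans (hG'.2 f hf).symm

variable {h : ι → Finset ι → ℝ} {e : ℝ} {A : Finset (Family ι)}

/-- Nodes with accepted families have the same parents in both graphs and cancel. Each of the
remaining d - |V| nodes contributes at most `e`, which is where the acceptance threshold comes from.
-/
theorem Accurate.score_sub (H : Accurate k p h e (accVars A)) {G G' : Dag ι}
    (hG : G ∈ consistent A (structs ι k)) (hG' : G' ∈ consistent A (structs ι k)) :
    (-∑ i, h i (G.pa i) - -∑ i, h i (G'.pa i)) - (score p G - score p G') ≤
      ((Fintype.card ι : ℝ) - (accVars A).card) * e := by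
  have h1 : (-∑ i, h i (G.pa i) - -∑ i, h i (G'.pa i)) - (score p G - score p G') =
      ∑ i, ((h i (G'.pa i) - h i (G.pa i)) -
        (condEntropy p i (G'.pa i) - condEntropy p i (G.pa i))) := by
    unfold score
    simp only [Finset.sum_sub_distrib]
    ring
  rw [h1, ← Finset.sum_add_sum_compl (accVars A), Finset.sum_eq_zero, zero_add]
  · have hc : (((accVars A)ᶜ.card : ℕ) : ℝ) = (Fintype.card ι : ℝ) - (accVars A).card := by
      rw [Finset.card_compl, Nat.cast_sub (Finset.card_le_univ _)]
    rw [← hc, ← nsmul_eq_mul]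
    exact Finset.sum_le_card_nsmul _ _ _ fun i hi => H i (Finset.mem_compl.1 hi) _ _
      (G'.notMem_pa i) (G.notMem_pa i) (hG'.1 i) (hG.1 i)
  · intro i hi
    rw [pa_eq_of_mem_accVars hG hG' hi]
    ring

variable (hp : ∀ x, 0 ≤ p x) (hp1 : ∑ x, p x = 1)
include hp hp1

/-- The class of an optimal consistent graph is within the threshold of the empirical optimum, so
the acceptance rule applies to it and yields a consistent graph of this class containing `f`. Score
equivalence makes that graph optimal too. -/
theorem Extendable.insert (hA : Extendable k p A) (H : Accurate k p h e (accVars A)) {G : Dag ι}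
    (hG : G ∈ argmaxGraphs k (fun G => -∑ i, h i (G.pa i)) A) {f : Family ι}
    (hf : f ∈ acceptable k (fun G => -∑ i, h i (G.pa i)) e A G) :
    Extendable k p (insert f A) := by
  obtain ⟨Go, hGo, hopt⟩ := hA
  have hmem : Go ∈ consistent A (classOf k Go) := ⟨mem_classOf hGo.1, hGo.2⟩
  obtain ⟨G', hG', hfG'⟩ := hf.2.2 (classOf k Go) ⟨Go, hGo.1, rfl⟩ ⟨Go, hmem⟩ (by
    rw [setScore_classOf_argmax hG]
    have h1 := le_setScore (fun G => -∑ i, h i (G.pa i)) hmem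
    have h2 := H.score_sub hG.1 hGo
    have h3 := hopt G hG.1.1
    linarith)
  refine ⟨G', ⟨hG'.1.1, ?_⟩, fun G'' hG'' => ?_⟩
  · intro f' hf'
    rcases Finset.mem_insert.1 hf' with rfl | hf'
    exacts [hfG', hG'.2 f' hf']
  · rw [← MarkovEquiv.score_eq hp hp1 hG'.1.2]
    exact hopt G'' hG''

/-- The witness is the family in `G` of any variable of V that is still open: transplanting the
V-part of `G` puts this family into every class within the threshold. -/
theorem acceptable_nonempty {γ : ℝ} {V : Finset ι} (hs : Stable k γ V p) (hA : Extendable k p A)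
    (H : Accurate k p h e (accVars A)) (he : 0 ≤ e) (hγ : 2 * (Fintype.card ι * e) ≤ γ)
    (hV : ¬ V ⊆ accVars A) {G : Dag ι}
    (hG : G ∈ argmaxGraphs k (fun G => -∑ i, h i (G.pa i)) A) :
    (acceptable k (fun G => -∑ i, h i (G.pa i)) e A G).Nonempty := by
  set s : Dag ι → ℝ := fun G => -∑ i, h i (G.pa i) with hs_def
  obtain ⟨Go, hGo, hopt⟩ := hA
  have hoptS : optScore k p = score p Go :=
    le_antisymm (csSup_le (Set.Nonempty.image _ ⟨Go, hGo.1⟩) (by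
      rintro _ ⟨G', hG', rfl⟩
      exact hopt G' hG')) (le_csSup (Set.toFinite _).bddAbove (Set.mem_image_of_mem _ hGo.1))
  obtain ⟨E, ⟨H₀, hH₀, rfl⟩, hgap⟩ := hs.unique_gap
  have hle : ((Fintype.card ι : ℝ) - (accVars A).card) * e ≤ Fintype.card ι * e :=
    mul_le_mul_of_nonneg_right (sub_le_self _ (Nat.cast_nonneg _)) he
  -- The threshold and the estimation error are each at most d·e, so the true score of `G₁` is
  -- within 2de ≤ γ of the optimum. If its restriction to V were not in the optimal class, gluing in
  -- `H₀` would gain more than γ and beat the optimum.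
  have near : ∀ G₁ ∈ consistent A (structs ι k),
      s G - s G₁ ≤ ((Fintype.card ι : ℝ) - (accVars A).card) * e →
      G₁.Closed V ∧ MarkovEquiv H₀ (G₁.restrict V) := by
    intro G₁ hG₁ hsc
    have h1 : score p Go - γ ≤ score p G₁ := by
      have h2 := hG.2 Go hGo
      have h3 := H.score_sub hG₁ hGo
      simp only [hs_def] at hsc h2 h3
      linarith
    have hcl : G₁.Closed V := hs.closed G₁ hG₁.1 (hoptS ▸ h1)
    refine ⟨hcl, ?_⟩
    by_contra hne
    have h2 := hgap H₀ (mem_classOf hH₀) (G₁.restrict V) (Dag.restrict_mem_structs hG₁.1)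
      fun hmem => hne hmem.2
    have h3 := hopt _ (Dag.glue_mem_structs hG₁.1 hH₀)
    have h4 := score_glue (p := p) G₁ (G₁.restrict V)
    rw [G₁.glue_restrict hcl] at h4
    rw [score_glue] at h3
    linarith
  obtain ⟨i, hiV, hiA⟩ := Finset.not_subset.1 hV
  have hpos : 0 ≤ ((Fintype.card ι : ℝ) - (accVars A).card) * e :=
    mul_nonneg (sub_nonneg.2 (by exact_mod_cast Finset.card_le_univ _)) he
  obtain ⟨hGcl, hGeq⟩ := near G hG.1 (by rw [sub_self]; exact hpos)
  refine ⟨(i, G.pa i), ⟨G, ⟨mem_classOf hG.1.1, hG.1.2⟩, rfl⟩, ?_, ?_⟩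
  · simp only [active, allFamilies, Finset.mem_filter, Finset.mem_univ, true_and]
    exact ⟨⟨G.notMem_pa i, hG.1.1 i⟩, hiA⟩
  · rintro _ ⟨G₂, hG₂, rfl⟩ hne hsc
    rw [setScore_classOf_argmax hG] at hsc
    obtain ⟨G₁, hG₁, he₁⟩ := exists_eq_setScore s hne
    rw [← he₁] at hsc
    obtain ⟨hcl₁, heq₁⟩ := near G₁ ⟨hG₁.1.1, hG₁.2⟩ hsc
    -- On V this graph agrees with `G`, elsewhere with `G₁`; both contain `A`, so it does as well.
    -- It is equivalent to `G₁` because both restrictions are equivalent to `H₀`.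
    refine ⟨G₁.glue (G.restrict V), ⟨⟨Dag.glue_mem_structs hG₁.1.1
      (Dag.restrict_mem_structs hG.1.1), ?_⟩, ?_⟩, ?_⟩
    · have h1 : MarkovEquiv (G₁.glue (G₁.restrict V)) (G₁.glue (G.restrict V)) :=
        MarkovEquiv.glue ((Eq.symm heq₁).trans hGeq)
      rw [G₁.glue_restrict hcl₁] at h1
      exact Eq.trans hG₁.1.2 h1
    · intro f hf
      change (G₁.glue (G.restrict V)).pa f.1 = f.2
      by_cases hfV : f.1 ∈ V
      · rw [Dag.glue_pa_mem _ _ hfV, G.restrict_pa_map hGcl]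
        exact hG.1.2 f hf
      · rw [Dag.glue_pa_notMem _ _ hfV]
        exact hG₁.2 f hf
    · change (G₁.glue (G.restrict V)).pa i = G.pa i
      rw [Dag.glue_pa_mem _ _ hiV, G.restrict_pa_map hGcl]

end Core

/-! ### The inner loop. -/

section Loop

variable {ι : Type*} [Fintype ι] [DecidableEq ι] (k : ℕ) (τ : TieBreak ι) (t : ℕ)
  (s : Dag ι → ℝ) (e : ℝ)

theorem innerLoop_induction {P : Finset (Family ι) → Prop}
    (hs : ∀ A, P A → P (iteration k τ t s e A)) (A : Finset (Family ι)) (h0 : P A) :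
    P (innerLoop k τ t s e A) := by
  induction A using innerLoop.induct k τ t s e with
  | case1 A h => rwa [innerLoop, if_pos h]
  | case2 A h ih =>
    rw [innerLoop, if_neg h]
    exact ih (hs A h0)

theorem subset_innerLoop (A : Finset (Family ι)) : A ⊆ innerLoop k τ t s e A :=
  innerLoop_induction k τ t s e (P := fun B => A ⊆ B)
    (fun B h => h.trans (subset_iteration k τ t s e B)) A subset_rfl

theorem iteration_innerLoop (A : Finset (Family ι)) :
    iteration k τ t s e (innerLoop k τ t s e A) = innerLoop k τ t s e A := by
  induction A using innerLoop.induct k τ t s e with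
  | case1 A h => rw [innerLoop, if_pos h, h]
  | case2 A h ih => rwa [innerLoop, if_neg h]

/-- An acceptable family is active, so its child is not yet accepted and inserting it really
enlarges `A`. -/
theorem not_nonempty_of_iteration_eq {A : Finset (Family ι)} (h : iteration k τ t s e A = A) :
    ¬ (acceptable k s e A (τ.graph t A (argmaxGraphs k s A))).Nonempty := by
  intro hne
  have hm := τ.family_mem t A _ hne
  unfold iteration at h
  dsimp only at h
  rw [if_pos hne] at h
  have h1 := Finset.insert_eq_self.1 h
  exact (Finset.mem_filter.1 hm.2.1).2 (Finset.mem_image_of_mem Prod.fst h1)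

variable {k τ t e} {α : ι → Type*} [∀ i, Fintype (α i)] {p : (∀ i, α i) → ℝ}
  {h : ι → Finset ι → ℝ}

/-- With accurate estimates, the inner loop only accepts families of an optimal graph, and it
accepts families for all variables in `V` if the accuracy is sufficient. -/
theorem innerLoop_spec (hp : ∀ x, 0 ≤ p x) (hp1 : ∑ x, p x = 1) {A : Finset (Family ι)}
    (hA : Extendable k p A) (H : Accurate k p h e (accVars A)) :
    Extendable k p (innerLoop k τ t (fun G => -∑ i, h i (G.pa i)) e A) ∧
      ∀ γ V, Stable k γ V p → 0 ≤ e → 2 * (Fintype.card ι * e) ≤ γ →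
        V ⊆ accVars (innerLoop k τ t (fun G => -∑ i, h i (G.pa i)) e A) := by
  set s : Dag ι → ℝ := fun G => -∑ i, h i (G.pa i)
  have argmax_mem : ∀ B, Extendable k p B →
      τ.graph t B (argmaxGraphs k s B) ∈ argmaxGraphs k s B := fun B hB =>
    τ.graph_mem t B _ (argmaxGraphs_nonempty s ⟨hB.choose, hB.choose_spec.1⟩)
  have mono : ∀ B, A ⊆ B → Accurate k p h e (accVars B) := fun B hB =>
    H.mono (Finset.image_subset_image hB)
  have key : A ⊆ innerLoop k τ t s e A ∧ Extendable k p (innerLoop k τ t s e A) := by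
    refine innerLoop_induction k τ t s e (P := fun B => A ⊆ B ∧ Extendable k p B) ?_ A
      ⟨subset_rfl, hA⟩
    rintro B ⟨hAB, hB⟩
    refine ⟨hAB.trans (subset_iteration k τ t s e B), ?_⟩
    unfold iteration
    dsimp only
    split_ifs with hne
    · exact hB.insert hp hp1 (mono B hAB) (argmax_mem B hB) (τ.family_mem t B _ hne)
    · exact hB
  refine ⟨key.2, fun γ V hs he hγ => ?_⟩
  by_contra hV
  exact not_nonempty_of_iteration_eq k τ t s e (iteration_innerLoop k τ t s e A)
    (acceptable_nonempty hp hp1 hs key.2 (mono _ key.1) he hγ hV (argmax_mem _ key.2))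

end Loop

/-! ### Monotonicity of the sample bound. -/

section SampleBound

theorem mul_sq_log_le_four {x : ℝ} (h0 : 0 ≤ x) (h1 : x ≤ 1) : x * Real.log x ^ 2 ≤ 4 := by
  rcases h0.eq_or_lt with rfl | h0
  · norm_num
  have h2 : |Real.log √x * √x| < 1 :=
    Real.abs_log_mul_self_lt _ (Real.sqrt_pos.2 h0) (Real.sqrt_le_one.2 h1)
  rw [Real.log_sqrt h0.le] at h2
  have h3 := (sq_lt_one_iff_abs_lt_one _).2 h2
  rw [mul_pow, Real.sq_sqrt h0.le] at h3
  linarith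

theorem four_le_exp_two : (4 : ℝ) ≤ Real.exp 2 := by
  have h := Real.add_one_le_exp (1 : ℝ)
  have h2 : Real.exp 2 = Real.exp 1 * Real.exp 1 := by rw [← Real.exp_add]; norm_num
  rw [h2]
  nlinarith

/-- The quantity of which `sampleBound` is the ceiling. -/
noncomputable def realBound (k K : ℕ) (ε δ : ℝ) : ℝ :=
  max (8 / ε ^ 2 * Real.log (2 / δ) * Real.log (8 * Real.log (2 / δ) / ε ^ 2) ^ 2)
    (max (Real.exp 2) (max (K : ℝ) (((K : ℝ) - 1) * (K : ℝ) ^ k / ε)))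

theorem sampleBound_eq (k K : ℕ) (ε δ : ℝ) : sampleBound k K ε δ = ⌈realBound k K ε δ⌉₊ := rfl

/-- x log² x is not monotone on (0, 1), but there it is at most 4 ≤ e², and e² is one of the terms
in the maximum defining N. -/
theorem mul_sq_log_mono {x y : ℝ} (hx : 0 ≤ x) (hxy : x ≤ y) :
    x * Real.log x ^ 2 ≤ max (y * Real.log y ^ 2) (Real.exp 2) := by
  rcases le_total x 1 with h | h
  · exact le_max_of_le_right ((mul_sq_log_le_four hx h).trans four_le_exp_two)
  · refine le_max_of_le_left ?_
    have h1 := Real.log_nonneg h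
    have h2 := Real.log_le_log (by linarith) hxy
    have hy := hx.trans hxy
    gcongr

theorem firstTerm_eq (ε L : ℝ) :
    8 / ε ^ 2 * L * Real.log (8 * L / ε ^ 2) ^ 2 =
      (8 * L / ε ^ 2) * Real.log (8 * L / ε ^ 2) ^ 2 := by
  ring

theorem realBound_mono (k : ℕ) {K : ℕ} (hK : 1 ≤ K) {e₁ e₂ δ₁ δ₂ : ℝ} (he : 0 < e₁)
    (hee : e₁ ≤ e₂) (hL0 : 0 ≤ Real.log (2 / δ₂)) (hL : Real.log (2 / δ₂) ≤ Real.log (2 / δ₁)) :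
    realBound k K e₂ δ₂ ≤ realBound k K e₁ δ₁ := by
  have hK' : (0 : ℝ) ≤ (K : ℝ) - 1 := sub_nonneg.2 (by exact_mod_cast hK)
  have he₂ := he.trans_le hee
  unfold realBound
  rw [firstTerm_eq, firstTerm_eq]
  refine max_le ?_ (le_max_of_le_right (max_le_max le_rfl (max_le_max le_rfl ?_)))
  · have hx0 : 0 ≤ 8 * Real.log (2 / δ₂) / e₂ ^ 2 := by positivity
    have hx : 8 * Real.log (2 / δ₂) / e₂ ^ 2 ≤ 8 * Real.log (2 / δ₁) / e₁ ^ 2 := by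
      have := hL0.trans hL
      gcongr
    exact (mul_sq_log_mono hx0 hx).trans (max_le_max le_rfl (le_max_left _ _))
  · gcongr

theorem sampleBound_mono (k : ℕ) {K : ℕ} (hK : 1 ≤ K) {e₁ e₂ δ₁ δ₂ : ℝ} (he : 0 < e₁)
    (hee : e₁ ≤ e₂) (hL0 : 0 ≤ Real.log (2 / δ₂)) (hL : Real.log (2 / δ₂) ≤ Real.log (2 / δ₁)) :
    sampleBound k K e₂ δ₂ ≤ sampleBound k K e₁ δ₁ :=
  Nat.ceil_mono (realBound_mono k hK he hee hL0 hL)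

end SampleBound

/-! ### How often each variable set is observed. -/

section Counts

variable {ι : Type*} [Fintype ι] [DecidableEq ι]

theorem active_subset (k : ℕ) (U : Finset ι) : active k U ⊆ allFamilies ι k :=
  Finset.filter_subset _ _

theorem active_card_pos (k : ℕ) {U : Finset ι} (hU : U ≠ Finset.univ) :
    0 < (active k U).card := by
  obtain ⟨i, hi⟩ : ∃ i, i ∉ U := by
    by_contra! h
    exact hU (Finset.eq_univ_iff_forall.2 h)
  refine Finset.card_pos.2 ⟨(i, ∅), ?_⟩
  simp [active, allFamilies, hi]

/-- An upper bound on the number of samples for accuracy `a`. -/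
noncomputable def capBound (ι : Type*) [Fintype ι] [DecidableEq ι] (k K : ℕ) (ε ε₁ δ a : ℝ) : ℕ :=
  sampleBound k K (a / 2) (δ / (max (maxRounds ι ε ε₁ : ℝ) 1 * (allFamilies ι k).card))

variable {k K : ℕ} {ε ε₁ δ : ℝ}

theorem capBound_anti (hK : 1 ≤ K) (hδ : 0 < δ) (hδ1 : δ < 1) (hne : Nonempty ι) {a b : ℝ}
    (ha : 0 < a) (hab : a ≤ b) : capBound ι k K ε ε₁ δ b ≤ capBound ι k K ε ε₁ δ a := by
  refine sampleBound_mono k hK (by linarith) (by linarith) ?_ le_rfl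
  have h1 := active_card_pos k (U := (∅ : Finset ι)) Finset.univ_nonempty.ne_empty.symm
  have h2 : 0 < (allFamilies ι k).card := h1.trans_le (Finset.card_le_card (active_subset k _))
  apply Real.log_nonneg
  rw [one_le_div (by positivity)]
  have h3 : (1 : ℝ) ≤ max (maxRounds ι ε ε₁ : ℝ) 1 * (allFamilies ι k).card :=
    one_le_mul_of_one_le_of_one_le (le_max_right _ _) (by exact_mod_cast h2)
  have := div_le_self hδ.le h3
  linarith

theorem target_le_capBound (hK : 1 ≤ K) (hδ : 0 < δ) (hδ1 : δ < 1) {A : Finset (Family ι)}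
    (hA : accVars A ≠ Finset.univ) {a b : ℝ} (ha : 0 < a) (hab : a ≤ b) :
    target k K ε ε₁ δ A b ≤ capBound ι k K ε ε₁ δ a := by
  have h1 := active_card_pos k hA
  have h2 := Finset.card_le_card (active_subset k (accVars A))
  have h1' : (1 : ℝ) ≤ (active k (accVars A)).card := by exact_mod_cast h1
  have h2' : ((active k (accVars A)).card : ℝ) ≤ (allFamilies ι k).card := by exact_mod_cast h2
  set T : ℝ := (maxRounds ι ε ε₁ : ℝ) with hT
  have hT0 : 0 ≤ T := Nat.cast_nonneg _
  have h3 : (1 : ℝ) ≤ max T 1 * (allFamilies ι k).card :=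
    one_le_mul_of_one_le_of_one_le (le_max_right _ _) (h1'.trans h2')
  have h4 : 1 ≤ 2 / (δ / (max T 1 * (allFamilies ι k).card)) := by
    rw [one_le_div (by positivity)]
    have := div_le_self hδ.le h3
    linarith
  have key : 0 ≤ Real.log (2 / (δ / (T * (active k (accVars A)).card))) ∧
      Real.log (2 / (δ / (T * (active k (accVars A)).card))) ≤
        Real.log (2 / (δ / (max T 1 * (allFamilies ι k).card))) := by
    -- If T = 0, division by zero makes the confidence parameter 0 and its logarithm 0, which is
    -- harmless for an upper bound.
    rcases Nat.eq_zero_or_pos (maxRounds ι ε ε₁) with h0 | h0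
    · have : T = 0 := by rw [hT, h0, Nat.cast_zero]
      simp only [this, zero_mul, div_zero, Real.log_zero, le_refl, true_and]
      rw [this] at h4
      exact Real.log_nonneg h4
    · have hT1 : 1 ≤ T := by
        rw [hT]
        exact_mod_cast h0
      have hpos : 1 ≤ T * (active k (accVars A)).card := one_le_mul_of_one_le_of_one_le hT1 h1'
      have h5 : 1 ≤ 2 / (δ / (T * (active k (accVars A)).card)) := by
        rw [one_le_div (by positivity)]
        have := div_le_self hδ.le hpos
        linarith
      refine ⟨Real.log_nonneg h5, Real.log_le_log (by linarith) ?_⟩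
      have h6 : T ≤ max T 1 := le_max_left _ _
      gcongr
  exact sampleBound_mono k hK (by linarith) (by linarith) key.1 key.2

theorem accuracy_anti (hε₁ : 0 < ε₁) {s t : ℕ} (h : s ≤ t) : accuracy ε₁ t ≤ accuracy ε₁ s := by
  unfold accuracy
  gcongr
  norm_num

theorem accuracy_pos (hε₁ : 0 < ε₁) (t : ℕ) : 0 < accuracy ε₁ t := by
  unfold accuracy
  positivity

variable {α : ι → Type*} [∀ i, Fintype (α i)] {τ : TieBreak ι} {ω : Table α}

theorem accVars_stateAt_mono {s t : ℕ} (h : s ≤ t) :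
    accVars (stateAt k K ε ε₁ δ τ ω s).acc ⊆ accVars (stateAt k K ε ε₁ δ τ ω t).acc := by
  induction t, h using Nat.le_induction with
  | base => exact subset_rfl
  | succ t _ ih => exact ih.trans (Finset.image_subset_image (subset_innerLoop k τ t _ _ _))

theorem running_of_lt {t : ℕ} (h : t < numRounds k K ε ε₁ δ τ ω) :
    Running ε ε₁ t (stateAt k K ε ε₁ δ τ ω t) :=
  not_not.1 (Nat.notMem_of_lt_sInf h)

theorem not_running_numRounds (hε : 0 < ε) :
    ¬ Running ε ε₁ (numRounds k K ε ε₁ δ τ ω)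
      (stateAt k K ε ε₁ δ τ ω (numRounds k K ε ε₁ δ τ ω)) :=
  Nat.sInf_mem (exists_not_running k K hε ε₁ δ τ ω)

/-- The variable sets that still contain an active variable have all been observed equally often. -/
theorem exists_cnt_eq (t : ℕ) : ∃ n, ∀ S, ¬ S ⊆ accVars (stateAt k K ε ε₁ δ τ ω t).acc →
    (stateAt k K ε ε₁ δ τ ω t).cnt S = n := by
  induction t with
  | zero => exact ⟨0, fun _ _ => rfl⟩
  | succ t ih =>
    obtain ⟨n, hn⟩ := ih
    refine ⟨max n (target k K ε ε₁ δ (stateAt k K ε ε₁ δ τ ω t).acc (accuracy ε₁ t)), fun S hS => ?_⟩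
    have hS' : ¬ S ⊆ accVars (stateAt k K ε ε₁ δ τ ω t).acc := fun h =>
      hS (h.trans (accVars_stateAt_mono (Nat.le_succ t)))
    change observe _ _ _ S = _
    rw [observe, if_neg hS', hn S hS']

/-- The draws used for a family with open child `i` come from sets containing `i`, and these all
have the same count. The estimates are therefore those of a constant count, and concentration is
needed only for constant counts although the sampling is adaptive. -/
theorem draws_congr {cnt : Finset ι → ℕ} {U : Finset ι} {n : ℕ} (h : ∀ S, ¬ S ⊆ U → cnt S = n)
    {i : ι} (hi : i ∉ U) (Q : Finset ι) :
    draws k cnt (insert i Q) = draws k (fun _ => n) (insert i Q) := by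
  unfold draws
  refine Finset.biUnion_congr rfl fun S hS => ?_
  rw [h S fun hSU => hi (hSU ((Finset.mem_filter.1 hS).2 (Finset.mem_insert_self _ _)))]

theorem cnt_stateAt_le {S : Finset ι} {B : ℕ} {t : ℕ}
    (h : ∀ s < t, ¬ S ⊆ accVars (stateAt k K ε ε₁ δ τ ω s).acc →
      target k K ε ε₁ δ (stateAt k K ε ε₁ δ τ ω s).acc (accuracy ε₁ s) ≤ B) :
    (stateAt k K ε ε₁ δ τ ω t).cnt S ≤ B := by
  induction t with
  | zero => exact Nat.zero_le _
  | succ t ih =>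
    change observe _ _ _ S ≤ B
    rw [observe]
    split_ifs with hS
    · exact ih fun s hs => h s (by omega)
    · exact max_le (ih fun s hs => h s (by omega)) (h t (by omega) hS)

theorem finalCounts_le {S : Finset ι} {B : ℕ}
    (h : ∀ s < numRounds k K ε ε₁ δ τ ω, ¬ S ⊆ accVars (stateAt k K ε ε₁ δ τ ω s).acc →
      target k K ε ε₁ δ (stateAt k K ε ε₁ δ τ ω s).acc (accuracy ε₁ s) ≤ B)
    (hlast : ∀ A, A = (stateAt k K ε ε₁ δ τ ω (numRounds k K ε ε₁ δ τ ω)).acc →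
      accVars A ≠ Finset.univ → ¬ S ⊆ accVars A →
      target k K ε ε₁ δ A (ε / ((Fintype.card ι : ℝ) - (accVars A).card)) ≤ B) :
    finalCounts k K ε ε₁ δ τ ω S ≤ B := by
  unfold finalCounts
  split_ifs with hu
  · exact cnt_stateAt_le h
  · rw [observe]
    split_ifs with hS
    · exact cnt_stateAt_le h
    · exact max_le (cnt_stateAt_le h) (hlast _ rfl hu hS)

theorem card_sub_accVars_pos {A : Finset (Family ι)} (hA : accVars A ≠ Finset.univ) :
    0 < (Fintype.card ι : ℝ) - (accVars A).card :=
  sub_pos.2 (by exact_mod_cast (Finset.card_lt_iff_ne_univ _).2 hA)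

theorem le_last_of_not_running {t : ℕ} {σ : State ι} (h : ¬ Running ε ε₁ t σ)
    (hσ : accVars σ.acc ≠ Finset.univ) :
    accuracy ε₁ t ≤ ε / ((Fintype.card ι : ℝ) - (accVars σ.acc).card) := by
  by_contra! h'
  exact h ⟨hσ, h'⟩

/-- No accuracy finer than ε/d is ever requested: the loop condition and the last stage both keep it
at least ε/(d - |V|). This uses no accuracy of the estimates. -/
theorem finalCounts_le_capBound (hK : 1 ≤ K) (hε : 0 < ε) (hδ : 0 < δ) (hδ1 : δ < 1)
    (S : Finset ι) :
    finalCounts k K ε ε₁ δ τ ω S ≤ capBound ι k K ε ε₁ δ (ε / Fintype.card ι) := by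
  have hle : ∀ A : Finset (Family ι), accVars A ≠ Finset.univ →
      ε / (Fintype.card ι : ℝ) ≤ ε / ((Fintype.card ι : ℝ) - (accVars A).card) := fun A hA =>
    div_le_div_of_nonneg_left hε.le (card_sub_accVars_pos hA) (sub_le_self _ (Nat.cast_nonneg _))
  have hpos : ∀ A : Finset (Family ι), accVars A ≠ Finset.univ →
      0 < ε / (Fintype.card ι : ℝ) := fun A hA =>
    div_pos hε ((card_sub_accVars_pos hA).trans_le (sub_le_self _ (Nat.cast_nonneg _)))
  refine finalCounts_le (fun s hs _ => ?_) fun A _ hA _ =>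
    target_le_capBound hK hδ hδ1 hA (hpos A hA) (hle A hA)
  have hr := running_of_lt hs
  exact target_le_capBound hK hδ hδ1 hr.1 (hpos _ hr.1) ((hle _ hr.1).trans hr.2.le)

/-- The estimates from the stated number of samples are accurate enough in every round. -/
def AccurateRounds (k K : ℕ) (p : (∀ i, α i) → ℝ) (ε ε₁ δ : ℝ) (ω : Table α) : Prop :=
  ∀ (t : ℕ) (A : Finset (Family ι)), accVars A ≠ Finset.univ →
    ∀ n, target k K ε ε₁ δ A (accuracy ε₁ t) ≤ n →
      Accurate k p (empEntropy k ω fun _ => n) (accuracy ε₁ t) (accVars A)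

variable {p : (∀ i, α i) → ℝ}

theorem accurate_round (h : AccurateRounds k K p ε ε₁ δ ω) {t : ℕ}
    (ht : t < numRounds k K ε ε₁ δ τ ω) :
    Accurate k p (empEntropy k ω (stateAt k K ε ε₁ δ τ ω (t + 1)).cnt) (accuracy ε₁ t)
      (accVars (stateAt k K ε ε₁ δ τ ω t).acc) := by
  obtain ⟨n, hn⟩ := exists_cnt_eq (k := k) (K := K) (ε := ε) (ε₁ := ε₁) (δ := δ) (τ := τ) (ω := ω) t
  set A := (stateAt k K ε ε₁ δ τ ω t).acc
  have hcnt : ∀ S, ¬ S ⊆ accVars A → (stateAt k K ε ε₁ δ τ ω (t + 1)).cnt S =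
      max n (target k K ε ε₁ δ A (accuracy ε₁ t)) := by
    intro S hS
    change observe _ _ _ S = _
    rw [observe, if_neg hS, hn S hS]
  intro i hi Q Q' h1 h2 h3 h4
  have := h t A (running_of_lt ht).1 _ (le_max_right n _) i hi Q Q' h1 h2 h3 h4
  unfold empEntropy at this ⊢
  rwa [draws_congr hcnt hi, draws_congr hcnt hi]

variable (hp : ∀ x, 0 ≤ p x) (hp1 : ∑ x, p x = 1)
include hp hp1

theorem extendable_stateAt (h : AccurateRounds k K p ε ε₁ δ ω) {t : ℕ}
    (ht : t ≤ numRounds k K ε ε₁ δ τ ω) :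
    Extendable k p (stateAt k K ε ε₁ δ τ ω t).acc := by
  induction t with
  | zero => exact extendable_empty k p
  | succ t ih =>
    exact (innerLoop_spec hp hp1 (ih (by omega)) (accurate_round h (τ := τ) (by omega))).1

theorem subset_accVars_stateAt (h : AccurateRounds k K p ε ε₁ δ ω) (hε₁ : 0 < ε₁) {γ : ℝ}
    {V : Finset ι} (hs : Stable k γ V p) {t : ℕ} (ht : t < numRounds k K ε ε₁ δ τ ω)
    (hγ : 2 * (Fintype.card ι * accuracy ε₁ t) ≤ γ) :
    V ⊆ accVars (stateAt k K ε ε₁ δ τ ω (t + 1)).acc :=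
  (innerLoop_spec hp hp1 (extendable_stateAt hp hp1 h ht.le) (accurate_round h (τ := τ) ht)).2
    γ V hs (accuracy_pos hε₁ t).le hγ

/-- Sets inside V are not observed after round `t`, since all of V is accepted by then. If the loop
ends earlier, the last accuracy is no finer than that of the round at which it stopped. -/
theorem finalCounts_le_of_subset (h : AccurateRounds k K p ε ε₁ δ ω) (hK : 1 ≤ K) (hε : 0 < ε)
    (hε₁ : 0 < ε₁) (hδ : 0 < δ) (hδ1 : δ < 1) {γ : ℝ} {V : Finset ι} (hs : Stable k γ V p) {t : ℕ}
    (hγ : 2 * (Fintype.card ι * accuracy ε₁ t) ≤ γ) {S : Finset ι} (hS : S ⊆ V) :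
    finalCounts k K ε ε₁ δ τ ω S ≤ capBound ι k K ε ε₁ δ (accuracy ε₁ t) := by
  have key : ∀ s ≤ numRounds k K ε ε₁ δ τ ω,
      ¬ S ⊆ accVars (stateAt k K ε ε₁ δ τ ω s).acc → s ≤ t := by
    intro s hs' hS'
    by_contra! hlt
    exact hS' (hS.trans ((subset_accVars_stateAt hp hp1 h hε₁ hs (hlt.trans_le hs') hγ).trans
      (accVars_stateAt_mono hlt)))
  refine finalCounts_le (fun s hs' hS' => ?_) ?_
  · exact target_le_capBound hK hδ hδ1 (running_of_lt hs').1 (accuracy_pos hε₁ t)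
      (accuracy_anti hε₁ (key s hs'.le hS'))
  · rintro _ rfl hA hS'
    exact target_le_capBound hK hδ hδ1 hA (accuracy_pos hε₁ t)
      ((accuracy_anti hε₁ (key _ le_rfl hS')).trans
        (le_last_of_not_running (not_running_numRounds hε) hA))

/-- After round `t` at most `q` variables are open, so the loop condition and the last stage request
no accuracy finer than ε/q. -/
theorem finalCounts_le_of_card (h : AccurateRounds k K p ε ε₁ δ ω) (hK : 1 ≤ K) (hε : 0 < ε)
    (hε₁ : 0 < ε₁) (hδ : 0 < δ) (hδ1 : δ < 1) {γ : ℝ} {V : Finset ι} (hs : Stable k γ V p) {t : ℕ}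
    (hγ : 2 * (Fintype.card ι * accuracy ε₁ t) ≤ γ) {q : ℕ} (hq : 0 < q)
    (hV : Fintype.card ι ≤ V.card + q) (S : Finset ι) :
    finalCounts k K ε ε₁ δ τ ω S ≤
      capBound ι k K ε ε₁ δ (min (accuracy ε₁ t) (ε / q)) := by
  have hmin : 0 < min (accuracy ε₁ t) (ε / q) := lt_min (accuracy_pos hε₁ t) (by positivity)
  have hlast : ∀ A : Finset (Family ι), accVars A ≠ Finset.univ → V ⊆ accVars A →
      ε / q ≤ ε / ((Fintype.card ι : ℝ) - (accVars A).card) := by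
    intro A hA hVA
    refine div_le_div_of_nonneg_left hε.le (card_sub_accVars_pos hA) ?_
    have h1 : ((Fintype.card ι : ℕ) : ℝ) ≤ (accVars A).card + q := by
      exact_mod_cast hV.trans (Nat.add_le_add_right (Finset.card_le_card hVA) q)
    linarith
  have key : ∀ s ≤ numRounds k K ε ε₁ δ τ ω, s ≤ t ∨
      V ⊆ accVars (stateAt k K ε ε₁ δ τ ω s).acc := by
    intro s hs'
    by_contra! hlt
    exact hlt.2 ((subset_accVars_stateAt hp hp1 h hε₁ hs (hlt.1.trans_le hs') hγ).trans
      (accVars_stateAt_mono hlt.1))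
  refine finalCounts_le (fun s hs' _ => ?_) ?_
  · have hr := running_of_lt hs'
    refine target_le_capBound hK hδ hδ1 hr.1 hmin ?_
    rcases key s hs'.le with h1 | h1
    · exact (min_le_left _ _).trans (accuracy_anti hε₁ h1)
    · exact (min_le_right _ _).trans ((hlast _ hr.1 h1).trans hr.2.le)
  · rintro _ rfl hA -
    refine target_le_capBound hK hδ hδ1 hA hmin ?_
    rcases key _ le_rfl with h1 | h1
    · exact (min_le_left _ _).trans ((accuracy_anti hε₁ h1).trans
        (le_last_of_not_running (not_running_numRounds hε) hA))
    · exact (min_le_right _ _).trans (hlast _ hA h1)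

end Counts

/-! ### A Chernoff bound for square roots of frequencies. -/

section Chernoff

open ProbabilityTheory

/-- The tilt is half of log(q/p), which would be optimal for the Poisson bound. With log y ≥ 1 - 1/y
the exponent becomes exactly minus the squared difference of the roots. -/
theorem chernoff_exponent_le {p q : ℝ} (hp : 0 < p) (hq : 0 < q) :
    -Real.log (√q / √p) * q + p * (√q / √p - 1) ≤ -(√q - √p) ^ 2 := by
  obtain ⟨a, ha, rfl⟩ : ∃ a, 0 < a ∧ p = a ^ 2 :=
    ⟨√p, Real.sqrt_pos.2 hp, (Real.sq_sqrt hp.le).symm⟩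
  obtain ⟨b, hb, rfl⟩ : ∃ b, 0 < b ∧ q = b ^ 2 :=
    ⟨√q, Real.sqrt_pos.2 hq, (Real.sq_sqrt hq.le).symm⟩
  rw [Real.sqrt_sq ha.le, Real.sqrt_sq hb.le]
  have h3 := mul_le_mul_of_nonneg_left (Real.one_sub_inv_le_log_of_pos (div_pos hb ha)) hq.le
  have h4 : b ^ 2 * (1 - (b / a)⁻¹) = b ^ 2 - b * a := by field_simp
  have h5 : a ^ 2 * (b / a - 1) = b * a - a ^ 2 := by field_simp
  rw [h4] at h3
  rw [h5]
  nlinarith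

variable {X I : Type*} [MeasurableSpace X] (P : Measure X) [IsProbabilityMeasure P]

open Classical in
/-- The number of the draws in `D` with outcome in `B`. -/
noncomputable def hits (B : Set X) (D : Finset I) (ω : I → X) : ℕ := (D.filter fun r => ω r ∈ B).card

theorem hits_eq_sum (B : Set X) (D : Finset I) :
    (fun ω => (hits B D ω : ℝ)) = ∑ r ∈ D, fun ω : I → X => B.indicator (fun _ => (1 : ℝ)) (ω r) := by
  classical
  ext ω
  rw [Finset.sum_apply, hits, Finset.card_filter]
  push_cast
  exact Finset.sum_congr rfl fun r _ => by simp [Set.indicator_apply]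

theorem measurable_hits {B : Set X} (hB : MeasurableSet B) (D : Finset I) :
    Measurable fun ω => (hits B D ω : ℝ) := by
  rw [hits_eq_sum]
  convert Finset.measurable_sum D fun r _ =>
    ((measurable_const (a := (1 : ℝ))).indicator hB).comp (measurable_pi_apply r)
  rw [Finset.sum_apply]
  rfl

theorem integrable_exp_hits {B : Set X} (hB : MeasurableSet B) (D : Finset I) (t : ℝ) :
    Integrable (fun ω => Real.exp (t * hits B D ω)) (Measure.infinitePi fun _ : I => P) := by
  refine Integrable.of_bound ((measurable_hits hB D).const_mul t).exp.aestronglyMeasurable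
    (Real.exp (|t| * D.card)) (Filter.Eventually.of_forall fun ω => ?_)
  rw [Real.norm_eq_abs, Real.abs_exp]
  refine Real.exp_le_exp.2 ((le_abs_self _).trans ?_)
  rw [abs_mul, Nat.abs_cast]
  refine mul_le_mul_of_nonneg_left ?_ (abs_nonneg t)
  classical
  unfold hits
  exact_mod_cast Finset.card_filter_le _ _

theorem mgf_hits_le {B : Set X} (hB : MeasurableSet B) (D : Finset I) (t : ℝ) :
    mgf (fun ω => (hits B D ω : ℝ)) (Measure.infinitePi fun _ : I => P) t ≤
      Real.exp (D.card * (P.real B * (Real.exp t - 1))) := by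
  have hm : Measurable (B.indicator fun _ => (1 : ℝ)) := measurable_const.indicator hB
  have hind : iIndepFun (fun (r : I) (ω : I → X) => B.indicator (fun _ => (1 : ℝ)) (ω r))
      (Measure.infinitePi fun _ : I => P) :=
    iIndepFun_infinitePi (X := fun _ => B.indicator fun _ => (1 : ℝ)) fun _ => hm
  rw [hits_eq_sum, hind.mgf_sum (fun r => hm.comp (measurable_pi_apply r)), ← nsmul_eq_mul,
    Real.exp_nsmul, ← Finset.prod_const]
  refine Finset.prod_le_prod (fun r _ => mgf_nonneg) fun r _ => ?_
  have h1 : mgf (fun ω : I → X => B.indicator (fun _ => (1 : ℝ)) (ω r))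
      (Measure.infinitePi fun _ : I => P) t = ∫ x, Real.exp (t * B.indicator (fun _ => 1) x) ∂P := by
    have := (measurePreserving_eval_infinitePi (fun _ : I => P) r).map_eq
    conv_rhs => rw [← this]
    rw [integral_map (measurable_pi_apply r).aemeasurable
      ((hm.const_mul t).exp.aestronglyMeasurable)]
    rfl
  have h2 : (fun x => Real.exp (t * B.indicator (fun _ => 1) x)) =
      fun x => 1 + B.indicator (fun _ => Real.exp t - 1) x := by
    ext x
    by_cases hx : x ∈ B <;> simp [hx]
  rw [h1, h2, integral_add (integrable_const _) ((integrable_const _).indicator hB),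
    integral_indicator_const _ hB]
  simp only [integral_const, probReal_univ, smul_eq_mul, mul_one]
  rw [add_comm]
  exact Real.add_one_le_exp _

theorem sq_le_of_sqrt_add_lt {a p u : ℝ} (hu : 0 < u) (h : √p + u < √a) :
    (√p + u) ^ 2 ≤ a := by
  have h0 : 0 ≤ √p := Real.sqrt_nonneg p
  have ha : 0 < a := Real.sqrt_pos.1 (by linarith)
  calc (√p + u) ^ 2 ≤ √a ^ 2 := by gcongr
    _ = a := Real.sq_sqrt ha.le

/-- Concentration of the square root of an empirical frequency. -/
theorem measure_sqrt_deviation_le {B : Set X} (hB : MeasurableSet B) {D : Finset I}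
    (hD : D.Nonempty) {u : ℝ} (hu : 0 < u) :
    Measure.infinitePi (fun _ : I => P)
        {ω | u < |√((hits B D ω : ℝ) / D.card) - √(P.real B)|} ≤
      ENNReal.ofReal (2 * Real.exp (-(D.card * u ^ 2))) := by
  set μ := Measure.infinitePi fun _ : I => P
  set p := P.real B
  set m : ℝ := (D.card : ℝ) with hm_def
  have hm : 0 < m := Nat.cast_pos.2 hD.card_pos
  have hp : 0 ≤ p := measureReal_nonneg
  have hint := integrable_exp_hits P hB D
  have upper : μ.real {ω | m * (√p + u) ^ 2 ≤ hits B D ω} ≤ Real.exp (-(m * u ^ 2)) := by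
    -- For p = 0 the tilt is undefined; t = 1 works since the moment generating function is then at
    -- most 1.
    rcases hp.eq_or_lt with h0 | h0
    · refine (measure_ge_le_exp_mul_mgf _ zero_le_one (hint 1)).trans ?_
      refine (mul_le_mul_of_nonneg_left (mgf_hits_le P hB D 1) (Real.exp_pos _).le).trans ?_
      change _ * Real.exp (m * (p * _)) ≤ _
      rw [← h0]
      simp
    · have hq : 0 < (√p + u) ^ 2 := by positivity
      have hsq : √((√p + u) ^ 2) = √p + u := Real.sqrt_sq (by positivity)
      have hp' : 0 < √p := Real.sqrt_pos.2 h0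
      have hr : 0 < (√p + u) / √p := by positivity
      have ht : 0 ≤ Real.log ((√p + u) / √p) :=
        Real.log_nonneg ((one_le_div hp').2 (by linarith))
      refine (measure_ge_le_exp_mul_mgf _ ht (hint _)).trans ?_
      refine (mul_le_mul_of_nonneg_left (mgf_hits_le P hB D _) (Real.exp_pos _).le).trans ?_
      rw [← Real.exp_add, Real.exp_log hr]
      refine Real.exp_le_exp.2 ?_
      have := chernoff_exponent_le h0 hq
      rw [hsq] at this
      have := mul_le_mul_of_nonneg_left this hm.le
      change -_ * (m * _) + m * (p * _) ≤ _
      linarith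
  have lower : u < √p →
      μ.real {ω | (hits B D ω : ℝ) ≤ m * (√p - u) ^ 2} ≤ Real.exp (-(m * u ^ 2)) := by
    intro hup
    have h0 : 0 < p := Real.sqrt_pos.1 (hu.trans hup)
    have hpu : 0 < √p - u := sub_pos.2 hup
    have hq : 0 < (√p - u) ^ 2 := by positivity
    have hsq : √((√p - u) ^ 2) = √p - u := Real.sqrt_sq hpu.le
    have hp' : 0 < √p := Real.sqrt_pos.2 h0
    have hr : 0 < (√p - u) / √p := by positivity
    have ht : Real.log ((√p - u) / √p) ≤ 0 :=
      Real.log_nonpos hr.le ((div_le_one hp').2 (by linarith))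
    refine (measure_le_le_exp_mul_mgf _ ht (hint _)).trans ?_
    refine (mul_le_mul_of_nonneg_left (mgf_hits_le P hB D _) (Real.exp_pos _).le).trans ?_
    rw [← Real.exp_add, Real.exp_log hr]
    refine Real.exp_le_exp.2 ?_
    have := chernoff_exponent_le h0 hq
    rw [hsq] at this
    have := mul_le_mul_of_nonneg_left this hm.le
    change -_ * (m * _) + m * (p * _) ≤ _
    linarith
  have hsub : {ω : I → X | u < |√((hits B D ω : ℝ) / m) - √p|} ⊆
      {ω | m * (√p + u) ^ 2 ≤ hits B D ω} ∪
        {ω | u < √p ∧ (hits B D ω : ℝ) ≤ m * (√p - u) ^ 2} := by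
    intro ω hω
    have hω' : u < |√((hits B D ω : ℝ) / m) - √p| := hω
    rcases lt_abs.1 hω' with h | h
    · left
      have h1 := sq_le_of_sqrt_add_lt (a := (hits B D ω : ℝ) / m) (p := p) hu (by linarith)
      rw [le_div_iff₀ hm] at h1
      rw [Set.mem_ofPred_eq]
      linarith
    · right
      have h0 : 0 ≤ √((hits B D ω : ℝ) / m) := Real.sqrt_nonneg _
      have h1 : u < √p := by linarith
      refine ⟨h1, ?_⟩
      have h2 : √((hits B D ω : ℝ) / m) ^ 2 ≤ (√p - u) ^ 2 :=
        pow_le_pow_left₀ h0 (by linarith) 2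
      rw [Real.sq_sqrt (by positivity), div_le_iff₀ hm] at h2
      linarith
  refine (measure_mono hsub).trans ((measure_union_le _ _).trans ?_)
  rw [two_mul, ENNReal.ofReal_add (Real.exp_pos _).le (Real.exp_pos _).le]
  refine add_le_add ?_ ?_
  · rw [← ofReal_measureReal]
    exact ENNReal.ofReal_le_ofReal upper
  -- For u ≥ √p the lower deviation cannot occur.
  · by_cases hup : u < √p
    · simp only [hup, true_and]
      rw [← ofReal_measureReal]
      exact ENNReal.ofReal_le_ofReal (lower hup)
    · simp [hup]

end Chernoff

/-! ### Continuity of the entropy in the square roots of probabilities. -/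

section EntropyContinuity

/-- With y = √x, -x log x equals -2y² log y, whose derivative -4y log y - 2y is bounded by 4 on (0,
1) because |y log y| < 1. -/
theorem abs_negMulLog_sub_le {a b : ℝ} (ha : 0 ≤ a) (ha1 : a ≤ 1) (hb : 0 ≤ b) (hb1 : b ≤ 1) :
    |Real.negMulLog a - Real.negMulLog b| ≤ 4 * |√a - √b| := by
  have key : ∀ x ∈ Set.Icc (0 : ℝ) 1, Real.negMulLog x = 2 * (√x * Real.negMulLog √x) := by
    intro x hx
    simp only [Real.negMulLog, Real.log_sqrt hx.1]
    have := Real.mul_self_sqrt hx.1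
    linear_combination (Real.log x) * this
  rw [key a ⟨ha, ha1⟩, key b ⟨hb, hb1⟩]
  have hderiv : ∀ x ∈ interior (Set.Icc (0 : ℝ) 1),
      HasDerivWithinAt (fun x => 2 * (x * Real.negMulLog x))
        (2 * (1 * Real.negMulLog x + x * (-Real.log x - 1))) (interior (Set.Icc (0 : ℝ) 1)) x := by
    intro x hx
    rw [interior_Icc] at hx
    exact (((hasDerivAt_id x).mul (Real.hasDerivAt_negMulLog hx.1.ne')).const_mul 2).hasDerivWithinAt
  have hcont : ContinuousOn (fun x => 2 * (x * Real.negMulLog x)) (Set.Icc (0 : ℝ) 1) := by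
    have := Real.continuous_negMulLog
    fun_prop
  have hbound : ∀ x ∈ Set.Ioo (0 : ℝ) 1,
      ‖2 * (1 * Real.negMulLog x + x * (-Real.log x - 1))‖ ≤ 4 := by
    intro x hx
    have h1 := Real.abs_log_mul_self_lt x hx.1 hx.2.le
    have h2 : Real.log x * x ≤ 0 := mul_nonpos_of_nonpos_of_nonneg
      (Real.log_nonpos hx.1.le hx.2.le) hx.1.le
    have h3 := (abs_lt.1 h1).1
    rw [Real.norm_eq_abs, abs_le, Real.negMulLog]
    constructor <;> nlinarith [hx.1, hx.2]
  have hconv : Convex ℝ (Set.Icc (0 : ℝ) 1) := convex_Icc 0 1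
  have hmem : ∀ x, 0 ≤ x → x ≤ 1 → √x ∈ Set.Icc (0 : ℝ) 1 := fun x _ hx1 =>
    ⟨Real.sqrt_nonneg x, Real.sqrt_le_one.2 hx1⟩
  have hD : DifferentiableOn ℝ (fun x => 2 * (x * Real.negMulLog x))
      (interior (Set.Icc (0 : ℝ) 1)) := fun x hx => (hderiv x hx).differentiableWithinAt
  have hd : ∀ x ∈ interior (Set.Icc (0 : ℝ) 1),
      |deriv (fun x => 2 * (x * Real.negMulLog x)) x| ≤ 4 := by
    intro x hx
    rw [((hderiv x hx).hasDerivAt (isOpen_interior.mem_nhds hx)).deriv]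
    rw [interior_Icc] at hx
    exact hbound x hx
  have main : ∀ x ∈ Set.Icc (0 : ℝ) 1, ∀ y ∈ Set.Icc (0 : ℝ) 1, x ≤ y →
      |2 * (y * Real.negMulLog y) - 2 * (x * Real.negMulLog x)| ≤ 4 * |y - x| := by
    intro x hx y hy hxy
    have h1 := hconv.image_sub_le_mul_sub_of_deriv_le hcont hD
      (fun z hz => (abs_le.1 (hd z hz)).2) x hx y hy hxy
    have h2 := hconv.mul_sub_le_image_sub_of_le_deriv hcont hD
      (fun z hz => (abs_le.1 (hd z hz)).1) x hx y hy hxy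
    rw [abs_of_nonneg (sub_nonneg.2 hxy), abs_le]
    constructor <;> linarith
  rcases le_total √a √b with h | h
  · rw [abs_sub_comm, abs_sub_comm √a]
    exact main _ (hmem a ha ha1) _ (hmem b hb hb1) h
  · exact main _ (hmem b hb hb1) _ (hmem a ha ha1) h

variable {ι : Type*} [Fintype ι] [DecidableEq ι] {α : ι → Type*} [∀ i, Fintype (α i)]
  {p : (∀ i, α i) → ℝ}

/-- The joint entropy of the variables in `S`. -/
noncomputable def entropyOn (p : (∀ i, α i) → ℝ) (S : Finset ι) : ℝ :=
  ∑ u, Real.negMulLog (marginal p S u)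

theorem entropyOn_eq (p : (∀ i, α i) → ℝ) (S : Finset ι) :
    entropyOn p S = -∑ x, p x * Real.log (margAt p S x) := by
  unfold entropyOn Real.negMulLog
  simp only [margAt_eq_marginal, neg_mul, Finset.sum_neg_distrib]
  rw [sum_mul_marginal p S fun u => Real.log (marginal p S u)]

/-- The chain rule for the entropy. -/
theorem condEntropy_eq_sub (hp : ∀ x, 0 ≤ p x) (i : ι) (Q : Finset ι) :
    condEntropy p i Q = entropyOn p (insert i Q) - entropyOn p Q := by
  rw [entropyOn_eq, entropyOn_eq, sub_neg_eq_add, ← Finset.sum_neg_distrib,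
    ← Finset.sum_add_distrib]
  refine Finset.sum_congr rfl fun x _ => ?_
  rcases (hp x).eq_or_lt with h | h
  · simp [← h]
  · rw [Real.log_div (h.trans_le (le_margAt hp _ _)).ne' (h.trans_le (le_margAt hp _ _)).ne']
    ring

theorem marginal_le_one (hp : ∀ x, 0 ≤ p x) (hp1 : ∑ x, p x ≤ 1) (S : Finset ι)
    (u : ∀ i : S, α i) : marginal p S u ≤ 1 := by
  refine le_trans ?_ hp1
  exact Finset.sum_le_sum_of_subset_of_nonneg (Finset.subset_univ _) fun x _ _ => hp x

theorem card_pi_le {K k : ℕ} (hK : 1 ≤ K) (hα : ∀ i, Fintype.card (α i) ≤ K) {S : Finset ι}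
    (hS : S.card ≤ k) : Fintype.card (∀ i : S, α i) ≤ K ^ k := by
  rw [Fintype.card_pi]
  calc ∏ i : S, Fintype.card (α i) ≤ ∏ _i : S, K := Finset.prod_le_prod' fun i _ => hα i
    _ = K ^ S.card := by rw [Finset.prod_const, Finset.card_univ, Fintype.card_coe]
    _ ≤ K ^ k := Nat.pow_le_pow_right hK hS

theorem abs_entropyOn_sub_le {p' : (∀ i, α i) → ℝ} (hp : ∀ x, 0 ≤ p x) (hp1 : ∑ x, p x ≤ 1)
    (hp' : ∀ x, 0 ≤ p' x) (hp1' : ∑ x, p' x ≤ 1) {K k : ℕ} (hK : 1 ≤ K)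
    (hα : ∀ i, Fintype.card (α i) ≤ K) {S : Finset ι} (hS : S.card ≤ k) {w : ℝ} (hw0 : 0 ≤ w)
    (hw : ∀ u, |√(marginal p' S u) - √(marginal p S u)| ≤ w) :
    |entropyOn p' S - entropyOn p S| ≤ 4 * K ^ k * w := by
  unfold entropyOn
  rw [← Finset.sum_sub_distrib]
  calc |∑ u, (Real.negMulLog (marginal p' S u) - Real.negMulLog (marginal p S u))|
      ≤ ∑ u, |Real.negMulLog (marginal p' S u) - Real.negMulLog (marginal p S u)| :=
        Finset.abs_sum_le_sum_abs _ _
    _ ≤ ∑ _u : (∀ i : S, α i), 4 * w := by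
        refine Finset.sum_le_sum fun u _ => (abs_negMulLog_sub_le (marginal_nonneg hp' S u)
          (marginal_le_one hp' hp1' S u) (marginal_nonneg hp S u)
          (marginal_le_one hp hp1 S u)).trans ?_
        linarith [hw u]
    _ ≤ 4 * K ^ k * w := by
        rw [Finset.sum_const, nsmul_eq_mul, Finset.card_univ]
        have : (Fintype.card (∀ i : S, α i) : ℝ) ≤ (K : ℝ) ^ k := by
          exact_mod_cast card_pi_le hK hα hS
        nlinarith

theorem empLaw_nonneg (ω : Table α) (D : Finset (Finset ι × ℕ)) (x : ∀ i, α i) :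
    0 ≤ empLaw ω D x :=
  div_nonneg (Nat.cast_nonneg _) (Nat.cast_nonneg _)

theorem marginal_empLaw (ω : Table α) (D : Finset (Finset ι × ℕ)) (S : Finset ι)
    (u : ∀ i : S, α i) :
    marginal (empLaw ω D) S u = (hits {x | ∀ i : S, x i = u i} D ω : ℝ) / D.card := by
  classical
  unfold marginal empLaw hits
  rw [← Finset.sum_div]
  congr 1
  have := Finset.card_eq_sum_card_fiberwise (f := ω) (s := D.filter fun r => ∀ i : S, ω r i = u i)
    (t := Finset.univ.filter fun y : ∀ i, α i => ∀ i : S, y i = u i) (by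
      intro r hr
      simpa using (Finset.mem_filter.1 hr).2)
  simp only [Set.mem_ofPred_eq]
  rw [this]
  push_cast
  refine Finset.sum_congr rfl fun y hy => ?_
  congr 2
  ext r
  simp only [Finset.mem_filter, Finset.mem_univ, true_and] at hy ⊢
  constructor
  · rintro ⟨h1, rfl⟩
    exact ⟨⟨h1, hy⟩, rfl⟩
  · rintro ⟨⟨h1, -⟩, h2⟩
    exact ⟨h1, h2⟩

theorem sum_empLaw_le (ω : Table α) (D : Finset (Finset ι × ℕ)) : ∑ x, empLaw ω D x ≤ 1 := by
  classical
  unfold empLaw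
  rw [← Finset.sum_div]
  refine div_le_one_of_le₀ ?_ (Nat.cast_nonneg _)
  rw [Finset.card_eq_sum_card_fiberwise (f := ω) (s := D) (t := Finset.univ) (by simp)]
  push_cast
  exact le_rfl

/-- A single observable superset of `Q` already provides `n` draws. -/
theorem le_card_draws {k : ℕ} (hk : k + 1 ≤ Fintype.card ι) {Q : Finset ι} (hQ : Q.card ≤ k + 1)
    (n : ℕ) : n ≤ (draws k (fun _ => n) Q).card := by
  obtain ⟨S, hQS, hS⟩ := Finset.exists_superset_card_eq hQ hk
  have hsub : (Finset.range n).image (fun m => (S, m)) ⊆ draws k (fun _ => n) Q := by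
    unfold draws
    refine Finset.subset_biUnion_of_mem (fun S => (Finset.range n).image fun m => (S, m)) ?_
    simp [obsSets, Finset.mem_powersetCard, hS, hQS]
  refine le_trans ?_ (Finset.card_le_card hsub)
  rw [Finset.card_image_of_injective _ fun a b h => (Prod.ext_iff.1 h).2, Finset.card_range]

end EntropyContinuity

/-! ### Uniform convergence of the plug-in estimates. -/

section UniformConvergence

variable {ι : Type*} [Fintype ι] [DecidableEq ι] {α : ι → Type*} [∀ i, Fintype (α i)]
  [∀ i, MeasurableSpace (α i)] [∀ i, MeasurableSingletonClass (α i)]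
  (P : Measure (∀ i, α i)) [IsProbabilityMeasure P]

theorem sum_real_singleton : ∑ x, P.real {x} = 1 := by
  rw [← measureReal_biUnion_finset (by simp [Set.PairwiseDisjoint, Set.Pairwise])
    fun x _ => measurableSet_singleton x]
  have : (⋃ x ∈ (Finset.univ : Finset (∀ i, α i)), ({x} : Set (∀ i, α i))) = Set.univ := by
    ext x
    simp
  rw [this, probReal_univ]

theorem marginal_real (S : Finset ι) (u : ∀ i : S, α i) :
    marginal (fun x => P.real {x}) S u = P.real {x | ∀ i : S, x i = u i} := by
  classical
  unfold marginal
  rw [← measureReal_biUnion_finset (by simp [Set.PairwiseDisjoint, Set.Pairwise])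
    fun x _ => measurableSet_singleton x]
  congr 1
  ext x
  simp

/-- The deviation of the square roots of the empirical frequencies from `n` samples. -/
noncomputable def deviation (ι : Type*) [Fintype ι] [DecidableEq ι] (k K : ℕ) (δ : ℝ) (n : ℕ) : ℝ :=
  √(Real.log (8 * (allFamilies ι k).card * K ^ (k + 1) * n ^ 2 / δ) / n)

theorem one_le_card_allFamilies (ι : Type*) [Fintype ι] [DecidableEq ι] [Nonempty ι] (k : ℕ) :
    1 ≤ (allFamilies ι k).card :=
  (active_card_pos k (U := (∅ : Finset ι)) Finset.univ_nonempty.ne_empty.symm).trans_le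
    (Finset.card_le_card (active_subset k _))

variable {k K : ℕ} {δ : ℝ}

theorem one_lt_deviation_arg [Nonempty ι] (hK : 1 ≤ K) (hδ : 0 < δ) (hδ1 : δ < 1) {n : ℕ}
    (hn : 1 ≤ n) :
    1 < 8 * (allFamilies ι k).card * (K : ℝ) ^ (k + 1) * n ^ 2 / δ := by
  have h1 : (1 : ℝ) ≤ (allFamilies ι k).card := by
    exact_mod_cast one_le_card_allFamilies ι k
  have h2 : (1 : ℝ) ≤ (K : ℝ) ^ (k + 1) := one_le_pow₀ (by exact_mod_cast hK)
  have h3 : (1 : ℝ) ≤ (n : ℝ) ^ 2 := one_le_pow₀ (by exact_mod_cast hn)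
  have h4 := one_le_mul_of_one_le_of_one_le (one_le_mul_of_one_le_of_one_le h1 h2) h3
  rw [lt_div_iff₀ hδ]
  nlinarith

theorem measure_deviation_le [Nonempty ι] (hk : k + 1 ≤ Fintype.card ι) (hK : 1 ≤ K)
    (hα : ∀ i, Fintype.card (α i) ≤ K) (hδ : 0 < δ) (hδ1 : δ < 1) {n : ℕ} (hn : 1 ≤ n)
    {Q S : Finset ι} (hQ : Q.card ≤ k + 1) (hS : S.card ≤ k + 1) :
    Measure.infinitePi (fun _ : Finset ι × ℕ => P)
      {ω | ∃ u, deviation ι k K δ n < |√(marginal (empLaw ω (draws k (fun _ => n) Q)) S u) -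
        √(marginal (fun x => P.real {x}) S u)|} ≤
      ENNReal.ofReal (δ / (4 * (allFamilies ι k).card * n ^ 2)) := by
  set w := deviation ι k K δ n with hw
  have hlog := one_lt_deviation_arg (ι := ι) (k := k) hK hδ hδ1 hn
  set R : ℝ := 8 * (allFamilies ι k).card * (K : ℝ) ^ (k + 1) * n ^ 2 / δ with hR
  have hn0 : (0 : ℝ) < n := Nat.cast_pos.2 hn
  have hw2 : n * w ^ 2 = Real.log R := by
    rw [hw, deviation, Real.sq_sqrt (div_nonneg (Real.log_nonneg hlog.le) hn0.le)]
    field_simp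
  -- Each value fails with probability at most 2/R, and there are at most K^(k+1) values. The n² in
  -- R makes the bound summable over n.
  have hw0 : 0 < w := Real.sqrt_pos.2 (div_pos (Real.log_pos hlog) hn0)
  have hcard := le_card_draws hk hQ n
  have hD : (draws k (fun _ => n) Q).Nonempty := Finset.card_pos.1 (hn.trans hcard)
  have hset : {ω : Table α | ∃ u, w < |√(marginal (empLaw ω (draws k (fun _ => n) Q)) S u) -
        √(marginal (fun x => P.real {x}) S u)|} ⊆
      ⋃ u : (∀ i : S, α i), {ω | w < |√((hits {x | ∀ i : S, x i = u i} (draws k (fun _ => n) Q) ω : ℝ)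
        / (draws k (fun _ => n) Q).card) - √(P.real {x | ∀ i : S, x i = u i})|} := by
    rintro ω ⟨u, hu⟩
    rw [marginal_empLaw, marginal_real] at hu
    exact Set.mem_iUnion.2 ⟨u, hu⟩
  have hF : (0 : ℝ) < (allFamilies ι k).card := by
    exact_mod_cast one_le_card_allFamilies ι k
  have hK' : (0 : ℝ) < (K : ℝ) ^ (k + 1) := by positivity
  calc _ ≤ _ := measure_mono hset
    _ ≤ ∑ u : (∀ i : S, α i), _ := measure_iUnion_fintype_le _ _
    _ ≤ ∑ _u : (∀ i : S, α i), ENNReal.ofReal (2 * R⁻¹) := by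
        refine Finset.sum_le_sum fun u _ => (measure_sqrt_deviation_le P
          (Set.Finite.measurableSet (Set.toFinite _)) hD hw0).trans (ENNReal.ofReal_le_ofReal ?_)
        have h1 : R⁻¹ = Real.exp (-(n * w ^ 2)) := by
          rw [hw2, Real.exp_neg, Real.exp_log (by linarith)]
        rw [h1]
        have h2 : (n : ℝ) ≤ (draws k (fun _ => n) Q).card := by exact_mod_cast hcard
        gcongr
    _ = ENNReal.ofReal (Fintype.card (∀ i : S, α i) * (2 * R⁻¹)) := by
        rw [Finset.sum_const, ENNReal.ofReal_mul (Nat.cast_nonneg _), nsmul_eq_mul,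
          ENNReal.ofReal_natCast, Finset.card_univ]
    _ ≤ ENNReal.ofReal (δ / (4 * (allFamilies ι k).card * n ^ 2)) := by
        refine ENNReal.ofReal_le_ofReal ?_
        have h1 : (Fintype.card (∀ i : S, α i) : ℝ) ≤ (K : ℝ) ^ (k + 1) := by
          exact_mod_cast card_pi_le hK hα hS
        calc (Fintype.card (∀ i : S, α i) : ℝ) * (2 * R⁻¹) ≤ (K : ℝ) ^ (k + 1) * (2 * R⁻¹) := by
              have : 0 < R := by linarith
              gcongr
          _ = _ := by
              rw [hR]
              field_simp
              norm_num

theorem tsum_ofReal_inv_sq_le {c : ℝ} (hc : 0 ≤ c) :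
    ∑' n : ℕ, ENNReal.ofReal (c / (2 * (n : ℝ) ^ 2)) ≤ ENNReal.ofReal c := by
  have h := (hasSum_zeta_two.mul_left (c / 2))
  have h' : (fun n : ℕ => c / (2 * (n : ℝ) ^ 2)) = fun n : ℕ => c / 2 * (1 / (n : ℝ) ^ 2) := by
    ext n
    rw [div_mul_div_comm, mul_one]
  rw [← h'] at h
  rw [← ENNReal.ofReal_tsum_of_nonneg (fun n => by positivity) h.summable, h.tsum_eq]
  refine ENNReal.ofReal_le_ofReal ?_
  -- The sum is c·π²/12.
  have hpi := Real.pi_lt_d2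
  have hpi2 : Real.pi ^ 2 ≤ 12 := by nlinarith [Real.pi_pos]
  nlinarith

/-- The plug-in estimates are uniformly close to the conditional entropies. -/
theorem measure_empEntropy_le [Nonempty ι] (hk : k + 1 ≤ Fintype.card ι) (hK : 1 ≤ K)
    (hα : ∀ i, Fintype.card (α i) ≤ K) (hδ : 0 < δ) (hδ1 : δ < 1) :
    Measure.infinitePi (fun _ : Finset ι × ℕ => P)
      {ω | ¬ ∀ f ∈ allFamilies ι k, ∀ n : ℕ, 1 ≤ n →
        |empEntropy k ω (fun _ => n) f.1 f.2 - condEntropy (fun x => P.real {x}) f.1 f.2| ≤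
          8 * K ^ (k + 1) * deviation ι k K δ n} ≤ ENNReal.ofReal δ := by
  classical
  set μ := Measure.infinitePi (fun _ : Finset ι × ℕ => P)
  set p : (∀ i, α i) → ℝ := fun x => P.real {x}
  have hp : ∀ x, 0 ≤ p x := fun x => measureReal_nonneg
  have hp1 : ∑ x, p x ≤ 1 := (sum_real_singleton P).le
  let bad : Family ι → Finset ι → ℕ → Set (Table α) := fun f S n =>
    {ω | ∃ u, deviation ι k K δ n <
      |√(marginal (empLaw ω (draws k (fun _ => n) (insert f.1 f.2))) S u) - √(marginal p S u)|}
  have hsub : {ω : Table α | ¬ ∀ f ∈ allFamilies ι k, ∀ n : ℕ, 1 ≤ n →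
      |empEntropy k ω (fun _ => n) f.1 f.2 - condEntropy p f.1 f.2| ≤
        8 * K ^ (k + 1) * deviation ι k K δ n} ⊆
      ⋃ n : ℕ, {ω | 1 ≤ n ∧ ω ∈ ⋃ f ∈ allFamilies ι k, (bad f (insert f.1 f.2) n ∪ bad f f.2 n)} := by
    intro ω hω
    by_contra hgood
    refine hω fun f hf n hn => ?_
    have hnb : ω ∉ bad f (insert f.1 f.2) n ∪ bad f f.2 n := fun h =>
      hgood (Set.mem_iUnion.2 ⟨n, hn, Set.mem_biUnion hf h⟩)
    rw [Set.mem_union, not_or] at hnb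
    have h1 : ∀ u, |√(marginal (empLaw ω (draws k (fun _ => n) (insert f.1 f.2)))
        (insert f.1 f.2) u) - √(marginal p (insert f.1 f.2) u)| ≤ deviation ι k K δ n := fun u =>
      not_lt.1 fun h => hnb.1 ⟨u, h⟩
    have h2 : ∀ u, |√(marginal (empLaw ω (draws k (fun _ => n) (insert f.1 f.2)))
        f.2 u) - √(marginal p f.2 u)| ≤ deviation ι k K δ n := fun u =>
      not_lt.1 fun h => hnb.2 ⟨u, h⟩
    have hfc : f.2.card ≤ k := (Finset.mem_filter.1 hf).2.2
    have hw0 : 0 ≤ deviation ι k K δ n := Real.sqrt_nonneg _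
    have h3 := abs_entropyOn_sub_le hp hp1 (empLaw_nonneg ω _) (sum_empLaw_le ω _) hK hα
      ((Finset.card_insert_le _ _).trans (Nat.add_le_add_right hfc 1)) hw0 h1
    have h4 := abs_entropyOn_sub_le hp hp1 (empLaw_nonneg ω _) (sum_empLaw_le ω _) hK hα
      (hfc.trans (Nat.le_add_right k 1)) hw0 h2
    -- The chain rule writes the conditional entropy as a difference of two joint entropies, whence
    -- 8 = 2·4.
    unfold empEntropy
    rw [condEntropy_eq_sub hp, condEntropy_eq_sub (empLaw_nonneg ω _)]
    rw [abs_le] at h3 h4 ⊢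
    constructor <;> linarith
  refine (measure_mono hsub).trans ((measure_iUnion_le _).trans
    (le_trans (ENNReal.tsum_le_tsum fun n => ?_) (tsum_ofReal_inv_sq_le hδ.le)))
  by_cases hn : 1 ≤ n
  swap
  · simp [hn]
  have hF : (0 : ℝ) < (allFamilies ι k).card := by
    exact_mod_cast one_le_card_allFamilies ι k
  have hn0 : (0 : ℝ) < n := Nat.cast_pos.2 hn
  simp only [hn, true_and]
  calc _ ≤ ∑ f ∈ allFamilies ι k, μ (bad f (insert f.1 f.2) n ∪ bad f f.2 n) :=
        measure_biUnion_finset_le _ _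
    _ ≤ ∑ f ∈ allFamilies ι k, ENNReal.ofReal (δ / (2 * (allFamilies ι k).card * n ^ 2)) := by
        refine Finset.sum_le_sum fun f hf => (measure_union_le _ _).trans ?_
        have hfc : f.2.card ≤ k := (Finset.mem_filter.1 hf).2.2
        have hfc' : (insert f.1 f.2).card ≤ k + 1 :=
          (Finset.card_insert_le _ _).trans (Nat.add_le_add_right hfc 1)
        refine (add_le_add (measure_deviation_le P hk hK hα hδ hδ1 hn hfc' hfc')
          (measure_deviation_le P hk hK hα hδ hδ1 hn hfc' (hfc.trans (Nat.le_succ k)))).trans ?_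
        rw [← ENNReal.ofReal_add (by positivity) (by positivity)]
        refine ENNReal.ofReal_le_ofReal (le_of_eq ?_)
        field_simp
        norm_num
    _ = ENNReal.ofReal (δ / (2 * (n : ℝ) ^ 2)) := by
        rw [Finset.sum_const, nsmul_eq_mul, ← ENNReal.ofReal_natCast,
          ← ENNReal.ofReal_mul (Nat.cast_nonneg _)]
        congr 1
        field_simp

end UniformConvergence

/-! ### Comparing sample bounds, and what their logarithms pay for. -/

section Comparison

theorem half_le_log_div {F δ : ℝ} (hF : 1 ≤ F) (hδ : 0 < δ) (hδ1 : δ < 1) :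
    1 / 2 ≤ Real.log (2 / (δ / F)) := by
  have h1 : 2 ≤ 2 / (δ / F) := by
    rw [le_div_iff₀ (by positivity)]
    have := div_le_self hδ.le hF
    linarith
  have h2 := Real.log_le_log two_pos h1
  have h3 := Real.log_two_gt_d9
  linarith

/-- For X ≥ e, log x ≤ κ log X; together with the factor κ in x this gives κ³. For X < e, log x ≤ κ
and the term e² in N dominates X. -/
theorem mul_sq_log_le_of_le {x κ r X N : ℝ} (hx : 1 ≤ x) (hκ : 1 ≤ κ) (hr0 : 0 ≤ r) (hr1 : r ≤ 1)
    (hX : 0 < X) (hN1 : X * Real.log X ^ 2 ≤ N) (hN2 : Real.exp 2 ≤ N) (hxle : x ≤ κ * (r * X)) :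
    x * Real.log x ^ 2 ≤ κ ^ 3 * (r * N) := by
  have hx0 : 0 < x := by linarith
  have hκ0 : 0 < κ := by linarith
  have hlog0 := Real.log_nonneg hx
  have hxX : x ≤ κ * X :=
    hxle.trans (mul_le_mul_of_nonneg_left (mul_le_of_le_one_left hX.le hr1) hκ0.le)
  have hlogκ : Real.log κ ≤ κ - 1 := Real.log_le_sub_one_of_pos hκ0
  rcases le_or_gt (Real.exp 1) X with h1 | h1
  · have hlogX : 1 ≤ Real.log X := (Real.le_log_iff_exp_le hX).2 h1
    have h2 : Real.log x ≤ κ * Real.log X := by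
      have h3 := Real.log_le_log hx0 hxX
      rw [Real.log_mul hκ0.ne' hX.ne'] at h3
      have h4 := mul_nonneg (sub_nonneg.2 hκ) (sub_nonneg.2 hlogX)
      linarith
    calc x * Real.log x ^ 2 ≤ κ * (r * X) * (κ * Real.log X) ^ 2 := by gcongr
      _ = κ ^ 3 * (r * (X * Real.log X ^ 2)) := by ring
      _ ≤ κ ^ 3 * (r * N) := by gcongr
  · have h2 : Real.log x ≤ κ := by
      have h3 := Real.log_le_log hx0 (hxX.trans (mul_le_mul_of_nonneg_left h1.le hκ0.le))
      rw [Real.log_mul hκ0.ne' (Real.exp_pos _).ne', Real.log_exp] at h3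
      linarith
    have h3 : X ≤ N := h1.le.trans ((Real.exp_le_exp.2 one_le_two).trans hN2)
    calc x * Real.log x ^ 2 ≤ κ * (r * X) * κ ^ 2 := by gcongr
      _ = κ ^ 3 * (r * X) := by ring
      _ ≤ κ ^ 3 * (r * N) := by gcongr

/-- Comparison of the numbers of samples for two accuracies and confidences. -/
theorem sampleBound_le_mul (k : ℕ) {K : ℕ} (hK : 1 ≤ K) {B e₁ e₂ δ T F : ℝ} (he₂ : 0 < e₂)
    (hee : e₂ ≤ e₁) (heB : e₁ ≤ B) (hδ : 0 < δ) (hδ1 : δ < 1) (hT : 1 ≤ T) (hF : 1 ≤ F) :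
    (sampleBound k K e₁ (δ / (T * F)) : ℝ) ≤
      (1 + B ^ 2 / 4 * (5 + Real.exp 2 + K) + K ^ (k + 1) * B / 4) *
        (1 + 2 * Real.log T) ^ 3 * (e₂ / e₁) ^ 2 * sampleBound k K e₂ (δ / F) := by
  set L := Real.log (2 / (δ / F)) with hL
  set κ := 1 + 2 * Real.log T with hκ
  have he₁ := he₂.trans_le hee
  have hlogT := Real.log_nonneg hT
  have hL0 : 1 / 2 ≤ L := half_le_log_div hF hδ hδ1
  have hκ1 : 1 ≤ κ := by linarith
  have hL1 : Real.log (2 / (δ / (T * F))) = Real.log T + L := by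
    rw [hL, ← Real.log_mul (by positivity) (by positivity)]
    congr 1
    field_simp
  -- The factor 2 in κ comes from L ≥ 1/2.
  have hL1κ : Real.log T + L ≤ κ * L := by nlinarith
  set X := 8 * L / e₂ ^ 2 with hX
  set r := (e₂ / e₁) ^ 2 with hr
  have hr0 : 0 < r := by positivity
  have hr1 : r ≤ 1 := pow_le_one₀ (by positivity) ((div_le_one he₁).2 hee)
  have hX0 : 0 < X := by positivity
  set N : ℝ := (sampleBound k K e₂ (δ / F) : ℝ) with hN
  have hNle : realBound k K e₂ (δ / F) ≤ N := Nat.le_ceil _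
  have hN1 : X * Real.log X ^ 2 ≤ N := by
    refine le_trans ?_ hNle
    rw [hX, ← firstTerm_eq]
    exact le_max_left _ _
  have hN2 : Real.exp 2 ≤ N := (le_max_of_le_right (le_max_left _ _)).trans hNle
  have hN4 := four_le_exp_two.trans hN2
  have he3 : Real.exp 1 < 3 := Real.exp_one_lt_d9.trans (by norm_num)
  have hlogX : Real.exp 1 ≤ X → 1 ≤ Real.log X := fun h =>
    (Real.le_log_iff_exp_le hX0).2 h
  -- Equivalently e₂² N ≥ 4. With e₁ ≤ B this pays for the terms of N(e₁) that grow more slowly than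
  -- 1/e₁², namely the constants, the rounding and the 1/e₁ term.
  have hstar : 4 / e₁ ^ 2 ≤ r * N := by
    have h1 : r * N = (e₂ ^ 2 * N) / e₁ ^ 2 := by
      rw [hr]
      field_simp
    rw [h1]
    refine div_le_div_of_nonneg_right ?_ (by positivity)
    rcases le_or_gt (Real.exp 1) X with h | h
    · have h2 : X ≤ N := by
        refine le_trans ?_ hN1
        have := one_le_pow₀ (n := 2) (hlogX h)
        nlinarith
      have h3 : e₂ ^ 2 * X = 8 * L := by
        rw [hX]
        field_simp
      nlinarith [sq_nonneg e₂]
    · have h2 : 8 * L < 3 * e₂ ^ 2 := by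
        rw [hX, div_lt_iff₀ (by positivity)] at h
        nlinarith [sq_nonneg e₂, sq_pos_of_pos he₂]
      nlinarith
  have hB : 0 ≤ B := by linarith
  have hrN : 0 ≤ r * N := by positivity
  have hκ3 : 1 ≤ κ ^ 3 := one_le_pow₀ hκ1
  have hone : 1 ≤ B ^ 2 / 4 * (r * N) := by
    have h1 : e₁ ^ 2 ≤ B ^ 2 := by gcongr
    rw [div_le_iff₀ (by positivity)] at hstar
    nlinarith
  have hlin : (K : ℝ) ^ (k + 1) / e₁ ≤ K ^ (k + 1) * B / 4 * (r * N) := by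
    have h1 : (1 : ℝ) / e₁ ≤ B / 4 * (r * N) := by
      calc (1 : ℝ) / e₁ = e₁ / 4 * (4 / e₁ ^ 2) := by field_simp
        _ ≤ B / 4 * (r * N) := by gcongr
    have h2 : (0 : ℝ) ≤ (K : ℝ) ^ (k + 1) := by positivity
    have := mul_le_mul_of_nonneg_left h1 h2
    rw [mul_one_div] at this
    linarith
  set x := 8 * (Real.log T + L) / e₁ ^ 2 with hx
  have hx0 : 0 < x := by positivity
  have hxle : x ≤ κ * (r * X) := by
    have : κ * (r * X) = 8 * (κ * L) / e₁ ^ 2 := by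
      rw [hr, hX]
      field_simp
    rw [this]
    exact div_le_div_of_nonneg_right (by linarith) (by positivity)
  have hκN : 0 ≤ κ ^ 3 * (r * N) := by positivity
  clear_value x κ X r N
  have hfirst : x * Real.log x ^ 2 ≤ 4 * (B ^ 2 / 4 * (r * N)) + κ ^ 3 * (r * N) := by
    rcases le_total x 1 with h | h
    · have := mul_sq_log_le_four hx0.le h
      linarith
    · have key := mul_sq_log_le_of_le h hκ1 hr0.le hr1 hX0 hN1 hN2 hxle
      have h0 : 0 ≤ B ^ 2 / 4 * (r * N) := by linarith
      linarith
  have hceil : (sampleBound k K e₁ (δ / (T * F)) : ℝ) ≤ realBound k K e₁ (δ / (T * F)) + 1 := by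
    rw [sampleBound_eq]
    refine (Nat.ceil_lt_add_one ?_).le
    exact le_trans (Real.exp_pos 2).le (le_max_of_le_right (le_max_left _ _))
  have hsum : realBound k K e₁ (δ / (T * F)) ≤
      x * Real.log x ^ 2 + Real.exp 2 + K + K ^ (k + 1) / e₁ := by
    have h1 : (0 : ℝ) ≤ x * Real.log x ^ 2 := by positivity
    have h2 := (Real.exp_pos 2).le
    have h3 : (0 : ℝ) ≤ K := Nat.cast_nonneg K
    have h4 : (0 : ℝ) ≤ (K : ℝ) ^ (k + 1) / e₁ := by positivity
    unfold realBound
    rw [hL1, firstTerm_eq, ← hx]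
    refine max_le (by linarith) (max_le (by linarith) (max_le (by linarith) ?_))
    have h5 : ((K : ℝ) - 1) * (K : ℝ) ^ k / e₁ ≤ (K : ℝ) ^ (k + 1) / e₁ := by
      rw [pow_succ', sub_mul, one_mul]
      gcongr
      exact sub_le_self _ (by positivity)
    linarith
  have hK0 : (0 : ℝ) ≤ Real.exp 2 + K + 1 := by positivity
  have hc : Real.exp 2 + K + 1 ≤ B ^ 2 / 4 * (Real.exp 2 + K + 1) * (r * N) := by
    have := mul_le_mul_of_nonneg_left hone hK0
    linarith
  have hC0 : 0 ≤ (B ^ 2 / 4 * (5 + Real.exp 2 + K) + K ^ (k + 1) * B / 4) * (r * N) := by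
    positivity
  calc (sampleBound k K e₁ (δ / (T * F)) : ℝ)
      ≤ κ ^ 3 * (r * N) +
        (B ^ 2 / 4 * (5 + Real.exp 2 + K) + K ^ (k + 1) * B / 4) * (r * N) := by linarith
    _ ≤ κ ^ 3 * (r * N) +
        κ ^ 3 * ((B ^ 2 / 4 * (5 + Real.exp 2 + K) + K ^ (k + 1) * B / 4) * (r * N)) := by
        have := mul_le_mul_of_nonneg_right hκ3 hC0
        linarith
    _ = _ := by ring

/-- The number of samples suffices for the deviations of the empirical frequencies. -/
theorem log_le_of_sampleBound_le {k : ℕ} (hk : 1 ≤ k) {M L e n : ℝ} (hM : 1 ≤ M) (hL : 1 ≤ L)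
    (he : 0 < e) (hx : M ^ 2 * (k + 2) ≤ Real.log (8 * L / e ^ 2))
    (hn : 8 * L / e ^ 2 * Real.log (8 * L / e ^ 2) ^ 2 ≤ n) :
    (k + 2) * L + 2 * Real.log n ≤ n * e ^ 2 / M ^ 2 := by
  set x := 8 * L / e ^ 2 with hx_def
  set l := Real.log x with hl
  have hx0 : 0 < x := by positivity
  have hM2 : 1 ≤ M ^ 2 := one_le_pow₀ hM
  have hk' : (1 : ℝ) ≤ k := by exact_mod_cast hk
  have hl3 : 3 * M ^ 2 ≤ l := by nlinarith
  have hl1 : 1 ≤ l := by nlinarith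
  have hxe : Real.exp 1 ≤ x := (Real.le_log_iff_exp_le hx0).1 hl1
  set y := x * l ^ 2 with hy
  have hy0 : 0 < y := by positivity
  have hxy : x ≤ y := by nlinarith [one_le_pow₀ (n := 2) hl1]
  have hlogy : Real.log y ≤ 3 * l := by
    rw [hy, Real.log_mul hx0.ne' (by positivity), Real.log_pow]
    have := Real.log_le_sub_one_of_pos (show 0 < l by linarith)
    push_cast
    linarith
  have hn0 : 0 < n := by linarith
  have hxe2 : x * e ^ 2 = 8 * L := by
    rw [hx_def]
    field_simp
  -- log n / n decreases beyond e, so the smallest admissible n = y is the worst case. There log y ≤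
  -- 3l, and the remaining factor l of the squared logarithm dominates M².
  have h1 : Real.log n / n ≤ Real.log y / y :=
    Real.log_div_self_antitoneOn (hxe.trans hxy) ((hxe.trans hxy).trans hn) hn
  have h2 : Real.log y / y ≤ e ^ 2 / (4 * M ^ 2) := by
    rw [div_le_div_iff₀ hy0 (by positivity)]
    have h3 : e ^ 2 * y = 8 * L * l ^ 2 := by rw [hy, ← hxe2]; ring
    rw [h3]
    calc Real.log y * (4 * M ^ 2) ≤ 3 * l * (4 * M ^ 2) := by gcongr
      _ ≤ 8 * 1 * l ^ 2 := by nlinarith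
      _ ≤ 8 * L * l ^ 2 := by gcongr
  have h4 : 2 * Real.log n ≤ n * e ^ 2 / (2 * M ^ 2) := by
    have := h1.trans h2
    rw [div_le_iff₀ hn0] at this
    calc 2 * Real.log n ≤ 2 * (e ^ 2 / (4 * M ^ 2) * n) := by linarith
      _ = _ := by field_simp; norm_num
  have h5 : (k + 2) * L ≤ n * e ^ 2 / (2 * M ^ 2) := by
    rw [le_div_iff₀ (by positivity)]
    have h6 : 8 * L * l ^ 2 ≤ n * e ^ 2 := by
      calc 8 * L * l ^ 2 = y * e ^ 2 := by rw [← hxe2, hy]; ring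
        _ ≤ n * e ^ 2 := by gcongr
    have h7 : M ^ 2 * (k + 2) ≤ l ^ 2 := by nlinarith
    nlinarith
  calc (k + 2) * L + 2 * Real.log n ≤ n * e ^ 2 / (2 * M ^ 2) + n * e ^ 2 / (2 * M ^ 2) :=
        add_le_add h5 h4
    _ = _ := by field_simp; norm_num

end Comparison

/-! ### Counting families and observable sets. -/

section Cardinalities

variable {ι : Type*} [Fintype ι] [DecidableEq ι]

/-- An open child with at most one parent already gives d families. This forces log(2/δ') to grow
with d, so that it can absorb constants. -/
theorem card_le_card_active {k : ℕ} (hk : 1 ≤ k) {U : Finset ι} (hU : U ≠ Finset.univ) :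
    Fintype.card ι ≤ (active k U).card := by
  obtain ⟨i, hi⟩ : ∃ i, i ∉ U := by
    by_contra! h
    exact hU (Finset.eq_univ_iff_forall.2 h)
  rw [← Finset.card_univ]
  refine Finset.card_le_card_of_injOn (fun j => (i, ({j} : Finset ι).erase i)) ?_ ?_
  · intro j _
    have h1 : (({j} : Finset ι).erase i).card ≤ k :=
      (Finset.card_le_card (Finset.erase_subset _ _)).trans (by simpa using hk)
    simp [active, allFamilies, hi, h1]
  · intro j _ l _ h
    have h1 : ({j} : Finset ι).erase i = ({l} : Finset ι).erase i := (Prod.ext_iff.1 h).2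
    rcases eq_or_ne j i with rfl | hj
    · by_contra hl
      have : l ∈ ({j} : Finset ι).erase j := by
        rw [h1]
        simp [Ne.symm hl]
      simp at this
    · have : j ∈ ({l} : Finset ι).erase i := by
        rw [← h1]
        simp [hj]
      simpa [hj] using this

theorem card_allFamilies_le [Nonempty ι] (k : ℕ) :
    (allFamilies ι k).card ≤ (k + 1) * Fintype.card ι ^ (k + 1) := by
  have hsub : allFamilies ι k ⊆ Finset.univ ×ˢ
      (Finset.range (k + 1)).biUnion fun j => Finset.powersetCard j (Finset.univ : Finset ι) := by
    intro f hf
    have := (Finset.mem_filter.1 hf).2.2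
    simp only [Finset.mem_product, Finset.mem_univ, Finset.mem_biUnion, Finset.mem_range, true_and,
      Finset.mem_powersetCard, Finset.subset_univ]
    exact ⟨f.2.card, by omega, rfl⟩
  calc (allFamilies ι k).card
      ≤ Fintype.card ι * ((Finset.range (k + 1)).biUnion fun j =>
          Finset.powersetCard j (Finset.univ : Finset ι)).card := by
        refine (Finset.card_le_card hsub).trans ?_
        rw [Finset.card_product, Finset.card_univ]
    _ ≤ Fintype.card ι * ((k + 1) * Fintype.card ι ^ k) := by
        refine Nat.mul_le_mul_left _ ((Finset.card_biUnion_le).trans ?_)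
        refine (Finset.sum_le_card_nsmul _ _ (Fintype.card ι ^ k) fun j hj => ?_).trans ?_
        · rw [Finset.card_powersetCard, Finset.card_univ]
          exact (Nat.choose_le_pow _ _).trans (Nat.pow_le_pow_right Fintype.card_pos
            (by have := Finset.mem_range.1 hj; omega))
        · simp
    _ = _ := by ring

/-- A set not inside V contains one of at most q outside nodes, each of which lies in C(d-1, k)
observable sets, and d·C(d-1, k) = (k+1)·C(d, k+1). -/
theorem card_mul_card_filter_not_subset_le {k q : ℕ} {V : Finset ι}
    (hV : Fintype.card ι ≤ V.card + q) :
    Fintype.card ι * ((obsSets ι k).filter fun S => ¬ S ⊆ V).card ≤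
      q * (k + 1) * (obsSets ι k).card := by
  rcases Nat.eq_zero_or_pos (Fintype.card ι) with h0 | h0
  · rw [h0, zero_mul]
    exact Nat.zero_le _
  have hsub : ((obsSets ι k).filter fun S => ¬ S ⊆ V) ⊆
      Vᶜ.biUnion fun i => (obsSets ι k).filter fun S => i ∈ S := by
    intro S hS
    rw [Finset.mem_filter] at hS
    obtain ⟨i, hi, hiV⟩ := Finset.not_subset.1 hS.2
    exact Finset.mem_biUnion.2 ⟨i, Finset.mem_compl.2 hiV, Finset.mem_filter.2 ⟨hS.1, hi⟩⟩
  have hstar : ∀ i : ι, ((obsSets ι k).filter fun S => i ∈ S).card ≤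
      (Fintype.card ι - 1).choose k := by
    intro i
    have hc : (Fintype.card ι - 1).choose k =
        (Finset.powersetCard k ((Finset.univ : Finset ι).erase i)).card := by
      rw [Finset.card_powersetCard, Finset.card_erase_of_mem (Finset.mem_univ i), Finset.card_univ]
    rw [hc]
    refine Finset.card_le_card_of_injOn (fun S => S.erase i) ?_ ?_
    · intro S hS
      have hS' := Finset.mem_filter.1 hS
      have h1 := (Finset.mem_powersetCard.1 hS'.1).2
      refine Finset.mem_powersetCard.2 ⟨Finset.erase_subset_erase _ (Finset.subset_univ S), ?_⟩
      rw [Finset.card_erase_of_mem hS'.2, h1]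
      rfl
    · intro S hS S' hS' h
      have h1 := (Finset.mem_filter.1 hS).2
      have h2 := (Finset.mem_filter.1 hS').2
      rw [← Finset.insert_erase h1, ← Finset.insert_erase h2]
      exact congrArg (insert i) h
  have h1 : ((obsSets ι k).filter fun S => ¬ S ⊆ V).card ≤ q * (Fintype.card ι - 1).choose k := by
    refine (Finset.card_le_card hsub).trans (Finset.card_biUnion_le.trans ?_)
    refine (Finset.sum_le_card_nsmul _ _ _ fun i _ => hstar i).trans ?_
    rw [smul_eq_mul, Finset.card_compl]
    exact Nat.mul_le_mul_right _ (by omega)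
  have h2 : Fintype.card ι * (Fintype.card ι - 1).choose k = (obsSets ι k).card * (k + 1) := by
    obtain ⟨m, hm⟩ := Nat.exists_eq_succ_of_ne_zero h0.ne'
    rw [obsSets, Finset.card_powersetCard, Finset.card_univ, hm]
    exact Nat.add_one_mul_choose_eq m k
  calc _ ≤ Fintype.card ι * (q * (Fintype.card ι - 1).choose k) := Nat.mul_le_mul_left _ h1
    _ = q * (Fintype.card ι * (Fintype.card ι - 1).choose k) := by ring
    _ = _ := by rw [h2]; ring

end Cardinalities

/-! ### The prescribed numbers of samples suffice for large d. -/

section Accuracy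

variable {ι : Type*} [Fintype ι] [DecidableEq ι] [Nonempty ι] {α : ι → Type*} [∀ i, Fintype (α i)]
  {p : (∀ i, α i) → ℝ} {k K : ℕ} {ε ε₁ δ : ℝ} {ω : Table α}

/-- For large d the union bound factor M·|families|/δ is at most (2d/δ)^(k+2), whose logarithm is at
most (k+2)L. Since L ≥ log(2d), the logarithm in N also exceeds M²(k+2). -/
theorem deviation_le (hk : 1 ≤ k) (hK : 1 ≤ K) (hδ : 0 < δ) (hδ1 : δ < 1)
    (hd1 : 1 ≤ Real.log (2 * Fintype.card ι))
    (hdM : 8 * (K : ℝ) ^ (k + 1) * (k + 1) ≤ 2 * Fintype.card ι) {e F : ℝ} (he : 0 < e)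
    (hF : (Fintype.card ι : ℝ) ≤ F)
    (hdx : Real.exp ((8 * (K : ℝ) ^ (k + 1)) ^ 2 * (k + 2)) * e ^ 2 ≤
      8 * Real.log (2 * Fintype.card ι)) {n : ℕ} (hn : sampleBound k K e (δ / F) ≤ n) :
    8 * K ^ (k + 1) * deviation ι k K δ n ≤ e := by
  set d : ℝ := (Fintype.card ι : ℝ) with hd_def
  set M : ℝ := 8 * (K : ℝ) ^ (k + 1) with hM_def
  have hd : 1 ≤ d := by
    rw [hd_def]
    exact_mod_cast Fintype.card_pos (α := ι)
  have hM : 1 ≤ M := by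
    have : (1 : ℝ) ≤ (K : ℝ) ^ (k + 1) := one_le_pow₀ (by exact_mod_cast hK)
    linarith
  set L := Real.log (2 / (δ / F)) with hL_def
  have hdd : 2 * d ≤ 2 * d / δ := le_div_self (by linarith) hδ hδ1.le
  have hLd : Real.log (2 * d / δ) ≤ L := by
    refine Real.log_le_log (by positivity) ?_
    rw [div_div_eq_mul_div]
    gcongr
  have hL1 : Real.log (2 * d) ≤ L := (Real.log_le_log (by positivity) hdd).trans hLd
  have hx : M ^ 2 * (k + 2) ≤ Real.log (8 * L / e ^ 2) := by
    have hL0 : 0 < L := by linarith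
    rw [Real.le_log_iff_exp_le (by positivity), le_div_iff₀ (by positivity)]
    linarith
  have hn' : realBound k K e (δ / F) ≤ n := Nat.ceil_le.1 hn
  have hn1 : (1 : ℝ) ≤ n := by
    have h1 : Real.exp 2 ≤ realBound k K e (δ / F) := le_max_of_le_right (le_max_left _ _)
    linarith [four_le_exp_two]
  have hmain := log_le_of_sampleBound_le hk hM (hd1.trans hL1) he hx (n := n) (by
    rw [← firstTerm_eq]
    exact (le_max_left _ _).trans hn')
  have hFam : (1 : ℝ) ≤ (allFamilies ι k).card := by
    exact_mod_cast one_le_card_allFamilies ι k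
  have hFam' : ((allFamilies ι k).card : ℝ) ≤ (k + 1) * d ^ (k + 1) := by
    rw [hd_def]
    exact_mod_cast card_allFamilies_le (ι := ι) k
  have hlogR : Real.log (8 * (allFamilies ι k).card * K ^ (k + 1) * n ^ 2 / δ) ≤
      (k + 2) * L + 2 * Real.log n := by
    have h1 : 8 * (allFamilies ι k).card * (K : ℝ) ^ (k + 1) * n ^ 2 / δ =
        M * (allFamilies ι k).card / δ * n ^ 2 := by
      rw [hM_def]
      ring
    rw [h1, Real.log_mul (by positivity) (by positivity), Real.log_pow]
    refine add_le_add ?_ (by norm_num)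
    have h2 : M * (allFamilies ι k).card / δ ≤ (2 * d / δ) ^ (k + 2) := by
      calc M * (allFamilies ι k).card / δ ≤ M * ((k + 1) * d ^ (k + 1)) / δ := by gcongr
        _ = M * (k + 1) * d ^ (k + 1) / δ := by ring
        _ ≤ 2 * d * d ^ (k + 1) / δ := by gcongr
        _ = (2 * d / δ) * d ^ (k + 1) := by ring
        _ ≤ (2 * d / δ) * (2 * d / δ) ^ (k + 1) := by
            gcongr
            linarith
        _ = _ := by ring
    calc Real.log (M * (allFamilies ι k).card / δ) ≤ Real.log ((2 * d / δ) ^ (k + 2)) :=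
          Real.log_le_log (by positivity) h2
      _ = (k + 2) * Real.log (2 * d / δ) := by
          rw [Real.log_pow]
          push_cast
          ring
      _ ≤ (k + 2) * L := by gcongr
  have hdev : deviation ι k K δ n ≤ e / M := by
    refine Real.sqrt_le_iff.2 ⟨by positivity, ?_⟩
    rw [div_le_iff₀ (by linarith)]
    refine (hlogR.trans hmain).trans (le_of_eq ?_)
    field_simp
  calc M * deviation ι k K δ n ≤ M * (e / M) := by gcongr
    _ = e := by field_simp

theorem accurateRounds_of_uniform (hK : 1 ≤ K) (hε₁ : 0 < ε₁) (hδ : 0 < δ) (hδ1 : δ < 1)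
    (hd1 : 1 ≤ Real.log (2 * Fintype.card ι))
    (hdM : 8 * (K : ℝ) ^ (k + 1) * (k + 1) ≤ 2 * Fintype.card ι)
    (hdx : Real.exp ((8 * (K : ℝ) ^ (k + 1)) ^ 2 * (k + 2)) * ε₁ ^ 2 ≤
      Real.log (2 * Fintype.card ι)) (hT : 1 ≤ maxRounds ι ε ε₁)
    (hU : ∀ f ∈ allFamilies ι k, ∀ n : ℕ, 1 ≤ n →
      |empEntropy k ω (fun _ => n) f.1 f.2 - condEntropy p f.1 f.2| ≤
        8 * K ^ (k + 1) * deviation ι k K δ n) :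
    AccurateRounds k K p ε ε₁ δ ω := by
  intro t A hA n hn i _ Q Q' hiQ hiQ' hQ hQ'
  have hacc := accuracy_pos hε₁ t
  -- For k = 0 the only parent set is empty, so all differences vanish.
  rcases Nat.eq_zero_or_pos k with rfl | hk
  · rw [Finset.card_eq_zero.1 (Nat.le_zero.1 hQ), Finset.card_eq_zero.1 (Nat.le_zero.1 hQ')]
    simpa using hacc.le
  have hacc1 : accuracy ε₁ t ≤ ε₁ := by
    refine (accuracy_anti hε₁ (Nat.zero_le t)).trans (le_of_eq ?_)
    rw [accuracy, pow_zero, div_one]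
  have hd0 : 0 ≤ Real.log (2 * Fintype.card ι) := by linarith
  have hn1 : 1 ≤ n := by
    refine le_trans (Nat.one_le_ceil_iff.2 ?_) hn
    exact lt_of_lt_of_le (Real.exp_pos 2) (le_max_of_le_right (le_max_left _ _))
  have hF : (Fintype.card ι : ℝ) ≤ maxRounds ι ε ε₁ * (active k (accVars A)).card := by
    exact_mod_cast (card_le_card_active hk hA).trans (Nat.le_mul_of_pos_left _ hT)
  have hdev := deviation_le hk hK hδ hδ1 hd1 hdM (half_pos hacc) hF (by
    have h1 : (accuracy ε₁ t / 2) ^ 2 ≤ ε₁ ^ 2 := by gcongr; linarith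
    have h2 := mul_le_mul_of_nonneg_left h1
      (Real.exp_pos ((8 * (K : ℝ) ^ (k + 1)) ^ 2 * (k + 2))).le
    linarith) hn
  have hmem : ∀ Q : Finset ι, i ∉ Q → Q.card ≤ k → (i, Q) ∈ allFamilies ι k := fun Q h1 h2 => by
    simp [allFamilies, h1, h2]
  have h1 := (abs_le.1 ((hU _ (hmem Q hiQ hQ) n hn1).trans hdev)).2
  have h2 := (abs_le.1 ((hU _ (hmem Q' hiQ' hQ') n hn1).trans hdev)).1
  dsimp only at h1 h2
  linarith

end Accuracy

/-! ### Total numbers of draws. -/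

section Totals

variable {ι : Type*} [Fintype ι] [DecidableEq ι] [Nonempty ι] {α : ι → Type*} [∀ i, Fintype (α i)]
  {p : (∀ i, α i) → ℝ} {k K : ℕ} {ε ε₁ δ : ℝ} {ω : Table α} {τ : TieBreak ι}

/-- The constant in the comparison of numbers of samples for accuracies bounded by `B`. -/
noncomputable def ratioConst (k K : ℕ) (B : ℝ) : ℝ :=
  1 + B ^ 2 / 4 * (5 + Real.exp 2 + K) + K ^ (k + 1) * B / 4

theorem ratioConst_pos {B : ℝ} (hB : 0 ≤ B) : 0 < ratioConst k K B := by
  unfold ratioConst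
  positivity

/-- T is at most a constant times d + 2 + |log ε|, so the factor (1 + 2 log T)³ of the sample
comparison is polylogarithmic. -/
theorem log_max_maxRounds_le (hε : 0 < ε) (hε₁ : 0 < ε₁) :
    1 + 2 * Real.log (max (maxRounds ι ε ε₁) 1) ≤
      (7 + 4 * |Real.log ε₁|) * Real.log (Fintype.card ι + 2 + |Real.log ε|) := by
  set d : ℝ := (Fintype.card ι : ℝ) with hd_def
  have hd : 1 ≤ d := by
    rw [hd_def]
    exact_mod_cast Fintype.card_pos (α := ι)
  set Z := d + 2 + |Real.log ε| with hZ
  have hε0 := abs_nonneg (Real.log ε)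
  have hε10 := abs_nonneg (Real.log ε₁)
  have hZ3 : 3 ≤ Z := by linarith
  have hlogZ : 1 ≤ Real.log Z :=
    (Real.le_log_iff_exp_le (by linarith)).2 (by linarith [Real.exp_one_lt_d9])
  have hT : (max (maxRounds ι ε ε₁) 1 : ℝ) ≤ (2 + 2 * |Real.log ε₁|) * Z := by
    have h0 : 2 * Z ≤ (2 + 2 * |Real.log ε₁|) * Z := by nlinarith
    refine max_le ?_ (by linarith)
    rcases le_total (Real.logb 2 (2 * d * ε₁ / ε)) 0 with h | h
    · rw [maxRounds, Nat.ceil_eq_zero.2 h, Nat.cast_zero]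
      linarith
    · refine (Nat.ceil_lt_add_one h).le.trans ?_
      have h2 : 0 < Real.log 2 := Real.log_pos one_lt_two
      have h3 : Real.log (2 * d * ε₁ / ε) ≤ 1 + d + |Real.log ε₁| + |Real.log ε| := by
        rw [Real.log_div (by positivity) hε.ne', Real.log_mul (by positivity) hε₁.ne',
          Real.log_mul two_ne_zero (by positivity)]
        have := Real.log_two_lt_d9
        have := Real.log_le_sub_one_of_pos (show 0 < d by linarith)
        have := le_abs_self (Real.log ε₁)
        have := neg_abs_le (Real.log ε)
        linarith
      have h4 : Real.logb 2 (2 * d * ε₁ / ε) ≤ 2 * (1 + d + |Real.log ε₁| + |Real.log ε|) := by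
        rw [Real.logb, div_le_iff₀ h2]
        have := Real.log_two_gt_d9
        nlinarith
      nlinarith
  have h1 : Real.log (max (maxRounds ι ε ε₁) 1) ≤ (2 + 2 * |Real.log ε₁|) + Real.log Z := by
    refine (Real.log_le_log (lt_of_lt_of_le one_pos (le_max_right _ _)) hT).trans ?_
    rw [Real.log_mul (by positivity) (by positivity)]
    have := Real.log_le_sub_one_of_pos (show 0 < 2 + 2 * |Real.log ε₁| by positivity)
    linarith
  nlinarith

theorem capBound_le_mul (hK : 1 ≤ K) {B a : ℝ} (hε : 0 < ε) (hε₁ : 0 < ε₁) (hδ : 0 < δ)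
    (hδ1 : δ < 1) (ha : ε / Fintype.card ι ≤ a) (haB : a / 2 ≤ B) :
    (capBound ι k K ε ε₁ δ a : ℝ) ≤ ratioConst k K B *
      ((7 + 4 * |Real.log ε₁|) * Real.log (Fintype.card ι + 2 + |Real.log ε|)) ^ 3 *
        (ε / (Fintype.card ι * a)) ^ 2 *
        sampleBound k K (ε / (2 * Fintype.card ι)) (δ / (allFamilies ι k).card) := by
  have hd : (0 : ℝ) < Fintype.card ι := by exact_mod_cast Fintype.card_pos (α := ι)
  have ha0 : 0 < a := lt_of_lt_of_le (by positivity) ha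
  have hF : (1 : ℝ) ≤ (allFamilies ι k).card := by
    exact_mod_cast one_le_card_allFamilies ι k
  have hle : ε / (2 * Fintype.card ι) ≤ a / 2 := by
    rw [mul_comm, ← div_div]
    linarith
  have h := sampleBound_le_mul k hK (by positivity) hle haB hδ hδ1
    (le_max_right (maxRounds ι ε ε₁ : ℝ) 1) hF
  have hr : ε / (2 * Fintype.card ι) / (a / 2) = ε / (Fintype.card ι * a) := by field_simp
  rw [hr] at h
  refine h.trans ?_
  have hκ := log_max_maxRounds_le (ι := ι) hε hε₁
  have hκ0 : 0 ≤ 1 + 2 * Real.log (max (maxRounds ι ε ε₁) 1) := by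
    have := Real.log_nonneg (le_max_right (maxRounds ι ε ε₁ : ℝ) 1)
    linarith
  have hB : 0 ≤ B := by linarith
  have hC := (ratioConst_pos (k := k) (K := K) hB).le
  change ratioConst k K B * _ * _ * _ ≤ _
  gcongr

/-- Valid for every outcome; it settles the dimensions below a fixed bound. -/
theorem activeDraws_le_mul (hK : 1 ≤ K) {B : ℝ} (hε : 0 < ε) (hε₁ : 0 < ε₁) (hδ : 0 < δ)
    (hδ1 : δ < 1) (hB : ε ≤ B) :
    (activeDraws k K ε ε₁ δ τ ω : ℝ) ≤ ratioConst k K B *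
      ((7 + 4 * |Real.log ε₁|) * Real.log (Fintype.card ι + 2 + |Real.log ε|)) ^ 3 *
        naiveDraws ι k K ε δ := by
  have hd : (1 : ℝ) ≤ Fintype.card ι := by exact_mod_cast Fintype.card_pos (α := ι)
  have h1 : activeDraws k K ε ε₁ δ τ ω ≤
      (obsSets ι k).card * capBound ι k K ε ε₁ δ (ε / Fintype.card ι) :=
    Finset.sum_le_card_nsmul _ _ _ fun S _ => finalCounts_le_capBound hK hε hδ hδ1 S
  have h2 := capBound_le_mul (ι := ι) (k := k) (B := B) hK hε hε₁ hδ hδ1 le_rfl (by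
    have := div_le_self hε.le hd
    linarith)
  have hr : ε / ((Fintype.card ι : ℝ) * (ε / Fintype.card ι)) = 1 := by
    have : (Fintype.card ι : ℝ) ≠ 0 := by positivity
    field_simp
  rw [hr, one_pow, mul_one] at h2
  calc (activeDraws k K ε ε₁ δ τ ω : ℝ)
      ≤ (obsSets ι k).card * capBound ι k K ε ε₁ δ (ε / Fintype.card ι) := by exact_mod_cast h1
    _ ≤ (obsSets ι k).card * _ := mul_le_mul_of_nonneg_left h2 (Nat.cast_nonneg _)
    _ = _ := by
        unfold naiveDraws
        push_cast
        ring

theorem activeDraws_le_of_accurateRounds (hp : ∀ x, 0 ≤ p x) (hp1 : ∑ x, p x = 1) (hK : 1 ≤ K)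
    (hε : 0 < ε) (hε₁ : 0 < ε₁) (hδ : 0 < δ) (hδ1 : δ < 1)
    (hacc : AccurateRounds k K p ε ε₁ δ ω) {γ B C : ℝ} (hγ : 0 < γ) (hγB : γ ≤ B) {V : Finset ι}
    (hs : Stable k γ V p) {q : ℕ} (hq : 0 < q) (hqd : q ≤ Fintype.card ι)
    (hV : Fintype.card ι ≤ V.card + q) (hεC : ε ^ 2 * Fintype.card ι ^ 3 ≤ C ^ 2)
    (hεγ : 4 * ε ≤ γ) (hγd : γ ≤ 4 * (Fintype.card ι * ε₁)) :
    (Fintype.card ι : ℝ) ^ 3 * activeDraws k K ε ε₁ δ τ ω ≤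
      (16 * C ^ 2 / γ ^ 2 + q * (k + 1) * (16 * C ^ 2 / γ ^ 2 + q ^ 2)) * (ratioConst k K B *
      ((7 + 4 * |Real.log ε₁|) * Real.log (Fintype.card ι + 2 + |Real.log ε|)) ^ 3 *
        naiveDraws ι k K ε δ) := by
  set d : ℝ := (Fintype.card ι : ℝ) with hd_def
  have hd : 1 ≤ d := by
    rw [hd_def]
    exact_mod_cast Fintype.card_pos (α := ι)
  have hd0 : 0 < d := by linarith
  -- The first round with accuracy below γ/(2d). Halving keeps it at least γ/(4d), and if it is
  -- round 0 then `hγd` does.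
  obtain ⟨t, ht, ht'⟩ : ∃ t, 2 * (d * accuracy ε₁ t) ≤ γ ∧ γ / (4 * d) ≤ accuracy ε₁ t := by
    have hlim : Filter.Tendsto (accuracy ε₁) Filter.atTop (nhds 0) :=
      tendsto_const_nhds.div_atTop (tendsto_pow_atTop_atTop_of_one_lt one_lt_two)
    have hex : ∃ t, accuracy ε₁ t < γ / (2 * d) :=
      (hlim.eventually (gt_mem_nhds (by positivity))).exists
    classical
    refine ⟨Nat.find hex, ?_, ?_⟩
    · have := Nat.find_spec hex
      rw [lt_div_iff₀ (by positivity)] at this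
      linarith
    · rcases Nat.eq_zero_or_pos (Nat.find hex) with h | h
      · rw [h, accuracy, pow_zero, div_one, div_le_iff₀ (by positivity)]
        linarith
      · have h1 := not_lt.1 (Nat.find_min hex (Nat.sub_lt h one_pos))
        have h2 : accuracy ε₁ (Nat.find hex - 1) = 2 * accuracy ε₁ (Nat.find hex) := by
          obtain ⟨m, hm⟩ := Nat.exists_eq_succ_of_ne_zero h.ne'
          rw [hm, Nat.succ_sub_one, accuracy, accuracy, pow_succ]
          field_simp
        rw [h2, div_le_iff₀ (by positivity)] at h1
        rw [div_le_iff₀ (by positivity)]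
        linarith
  have hne : Nonempty ι := inferInstance
  have ha1 : 0 < γ / (4 * d) := by positivity
  have hq0 : (0 : ℝ) < q := Nat.cast_pos.2 hq
  have ha2 : 0 < min (γ / (4 * d)) (ε / q) := lt_min ha1 (by positivity)
  have hin : ∀ S ∈ (obsSets ι k).filter (· ⊆ V),
      finalCounts k K ε ε₁ δ τ ω S ≤ capBound ι k K ε ε₁ δ (γ / (4 * d)) := fun S hS =>
    (finalCounts_le_of_subset hp hp1 hacc hK hε hε₁ hδ hδ1 hs ht (Finset.mem_filter.1 hS).2).trans
      (capBound_anti hK hδ hδ1 hne ha1 ht')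
  have hout : ∀ S ∈ (obsSets ι k).filter (¬ · ⊆ V),
      finalCounts k K ε ε₁ δ τ ω S ≤ capBound ι k K ε ε₁ δ (min (γ / (4 * d)) (ε / q)) :=
    fun S _ => (finalCounts_le_of_card hp hp1 hacc hK hε hε₁ hδ hδ1 hs ht hq hV S).trans
      (capBound_anti hK hδ hδ1 hne ha2 (min_le_min_right _ ht'))
  have hsum : activeDraws k K ε ε₁ δ τ ω ≤
      (obsSets ι k).card * capBound ι k K ε ε₁ δ (γ / (4 * d)) +
        ((obsSets ι k).filter (¬ · ⊆ V)).card *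
          capBound ι k K ε ε₁ δ (min (γ / (4 * d)) (ε / q)) := by
    unfold activeDraws
    rw [← Finset.sum_filter_add_sum_filter_not _ (· ⊆ V)]
    refine add_le_add ((Finset.sum_le_card_nsmul _ _ _ hin).trans ?_)
      (Finset.sum_le_card_nsmul _ _ _ hout)
    exact Nat.mul_le_mul_right _ (Finset.card_le_card (Finset.filter_subset _ _))
  have hcard : d * ((obsSets ι k).filter (¬ · ⊆ V)).card ≤ q * (k + 1) * (obsSets ι k).card := by
    rw [hd_def]
    exact_mod_cast card_mul_card_filter_not_subset_le hV
  have hεd : ε / d ≤ γ / (4 * d) := by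
    rw [div_le_div_iff₀ hd0 (by positivity)]
    nlinarith
  have hqd' : (q : ℝ) ≤ d := by
    rw [hd_def]
    exact_mod_cast hqd
  have hεq : ε / d ≤ ε / q := div_le_div_of_nonneg_left hε.le hq0 hqd'
  have haB : γ / (4 * d) / 2 ≤ B := by
    have := div_le_self hγ.le (show (1 : ℝ) ≤ 4 * d by linarith)
    linarith
  have h1 := capBound_le_mul (ι := ι) (k := k) (B := B) hK hε hε₁ hδ hδ1 hεd haB
  have h2 := capBound_le_mul (ι := ι) (k := k) (B := B) hK hε hε₁ hδ hδ1 (le_min hεd hεq)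
    ((div_le_div_of_nonneg_right (min_le_left _ _) zero_le_two).trans haB)
  rw [← hd_def] at h1 h2
  set W := ratioConst k K B *
    ((7 + 4 * |Real.log ε₁|) * Real.log (d + 2 + |Real.log ε|)) ^ 3 with hW
  set N : ℝ := (sampleBound k K (ε / (2 * d)) (δ / (allFamilies ι k).card) : ℝ) with hN
  have hW0 : 0 ≤ W := by
    have h3 := ratioConst_pos (k := k) (K := K) (hγ.le.trans hγB)
    have h4 : 0 ≤ Real.log (d + 2 + |Real.log ε|) :=
      Real.log_nonneg (by linarith [abs_nonneg (Real.log ε)])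
    positivity
  have hN0 : 0 ≤ N := Nat.cast_nonneg _
  have hWN : 0 ≤ W * N := mul_nonneg hW0 hN0
  set a := 16 * C ^ 2 / γ ^ 2 with ha
  have ha0 : 0 ≤ a := by positivity
  have hγterm : d ^ 3 * (ε / (d * (γ / (4 * d)))) ^ 2 ≤ a := by
    have : d ^ 3 * (ε / (d * (γ / (4 * d)))) ^ 2 = 16 * (ε ^ 2 * d ^ 3) / γ ^ 2 := by
      field_simp
      ring
    rw [this, ha]
    gcongr
  have hd23 : d ^ 2 ≤ d ^ 3 := pow_le_pow_right₀ hd (by norm_num)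
  -- Only d² is needed here; the third factor d is supplied by `hcard`, the scarcity of sets not
  -- inside V.
  have hminterm : d ^ 2 * (ε / (d * min (γ / (4 * d)) (ε / q))) ^ 2 ≤ a + q ^ 2 := by
    rcases min_choice (γ / (4 * d)) (ε / q) with h | h <;> rw [h]
    · have := mul_le_mul_of_nonneg_right hd23 (sq_nonneg (ε / (d * (γ / (4 * d)))))
      have := sq_nonneg (q : ℝ)
      linarith
    · have : d ^ 2 * (ε / (d * (ε / q))) ^ 2 = q ^ 2 := by field_simp
      linarith
  have hc1 : d ^ 3 * capBound ι k K ε ε₁ δ (γ / (4 * d)) ≤ a * (W * N) := by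
    calc d ^ 3 * (capBound ι k K ε ε₁ δ (γ / (4 * d)) : ℝ)
        ≤ d ^ 3 * (W * (ε / (d * (γ / (4 * d)))) ^ 2 * N) := by gcongr
      _ = d ^ 3 * (ε / (d * (γ / (4 * d)))) ^ 2 * (W * N) := by ring
      _ ≤ a * (W * N) := by gcongr
  have hc2 : d ^ 2 * capBound ι k K ε ε₁ δ (min (γ / (4 * d)) (ε / q)) ≤
      (a + q ^ 2) * (W * N) := by
    calc d ^ 2 * (capBound ι k K ε ε₁ δ (min (γ / (4 * d)) (ε / q)) : ℝ)
        ≤ d ^ 2 * (W * (ε / (d * min (γ / (4 * d)) (ε / q))) ^ 2 * N) := by gcongr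
      _ = d ^ 2 * (ε / (d * min (γ / (4 * d)) (ε / q))) ^ 2 * (W * N) := by ring
      _ ≤ (a + q ^ 2) * (W * N) := by gcongr
  have hnaive : (naiveDraws ι k K ε δ : ℝ) = (obsSets ι k).card * N := by
    rw [naiveDraws, hN]
    push_cast
    rfl
  rw [hnaive]
  have hsum' : (activeDraws k K ε ε₁ δ τ ω : ℝ) ≤
      (obsSets ι k).card * capBound ι k K ε ε₁ δ (γ / (4 * d)) +
        ((obsSets ι k).filter (¬ · ⊆ V)).card *
          capBound ι k K ε ε₁ δ (min (γ / (4 * d)) (ε / q)) := by exact_mod_cast hsum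
  set o : ℝ := ((obsSets ι k).card : ℝ)
  set b : ℝ := (((obsSets ι k).filter (¬ · ⊆ V)).card : ℝ) with hb
  set c₁ : ℝ := (capBound ι k K ε ε₁ δ (γ / (4 * d)) : ℝ)
  set c₂ : ℝ := (capBound ι k K ε ε₁ δ (min (γ / (4 * d)) (ε / q)) : ℝ)
  have ho0 : 0 ≤ o := Nat.cast_nonneg _
  have hb0 : 0 ≤ b := Nat.cast_nonneg _
  have hc20 : 0 ≤ c₂ := Nat.cast_nonneg _
  calc d ^ 3 * (activeDraws k K ε ε₁ δ τ ω : ℝ) ≤ d ^ 3 * (o * c₁ + b * c₂) := by gcongr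
    _ = o * (d ^ 3 * c₁) + (d * b) * (d ^ 2 * c₂) := by ring
    _ ≤ o * (a * (W * N)) + (q * (k + 1) * o) * ((a + q ^ 2) * (W * N)) := by gcongr
    _ = _ := by ring

end Totals

/-! ### The final assembly. -/

theorem sq_mul_cube_le {ε C d : ℝ} (hε : 0 < ε) (hd : 0 < d)
    (h : ε ≤ C * d ^ (-(3 / 2) : ℝ)) : ε ^ 2 * d ^ 3 ≤ C ^ 2 := by
  have h1 : (d ^ (-(3 / 2) : ℝ)) ^ 2 * d ^ 3 = 1 := by
    rw [← Real.rpow_natCast, ← Real.rpow_mul hd.le, ← Real.rpow_natCast, ← Real.rpow_add hd]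
    norm_num
  calc ε ^ 2 * d ^ 3 ≤ (C * d ^ (-(3 / 2) : ℝ)) ^ 2 * d ^ 3 := by gcongr
    _ = C ^ 2 * ((d ^ (-(3 / 2) : ℝ)) ^ 2 * d ^ 3) := by ring
    _ = C ^ 2 := by rw [h1, mul_one]

theorem le_of_le_mul_rpow {ε C d : ℝ} (hC : 0 < C) (hd : 1 ≤ d)
    (h : ε ≤ C * d ^ (-(3 / 2) : ℝ)) : ε ≤ C :=
  h.trans (mul_le_of_le_one_right hC.le (Real.rpow_le_one_of_one_le_of_nonpos hd (by norm_num)))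

theorem one_le_maxRounds {ι : Type*} [Fintype ι] {ε ε₁ : ℝ} (hε : 0 < ε)
    (h : ε < 2 * Fintype.card ι * ε₁) : 1 ≤ maxRounds ι ε ε₁ :=
  Nat.one_le_ceil_iff.2 (Real.logb_pos one_lt_two ((one_lt_div hε).2 h))

end BNSL

theorem theorem2 (k K q : ℕ) (γ ε₁ C : ℝ) (hγ : 0 < γ) (hε₁ : 0 < ε₁) (hC : 0 < C) :
    ∃ (c : ℝ) (a : ℕ), 0 < c ∧
      ∀ (d : ℕ), q < d →
      ∀ (α : Fin d → Type*) [∀ i, Fintype (α i)] [∀ i, MeasurableSpace (α i)]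
        [∀ i, MeasurableSingletonClass (α i)], (∀ i, Fintype.card (α i) ≤ K) →
      ∀ (P : MeasureTheory.Measure (∀ i, α i)) [MeasureTheory.IsProbabilityMeasure P]
        (V : Finset (Fin d)), V.card = d - q →
        BNSL.Stable k γ V (fun x => P.real {x}) →
      ∀ (ε δ : ℝ), 0 < ε → ε ≤ C * (d : ℝ) ^ (-(3 / 2) : ℝ) → 0 < δ → δ < 1 →
        MeasureTheory.Measure.infinitePi (fun _ : Finset (Fin d) × ℕ => P)
          {ω : BNSL.Table α | ∃ τ : BNSL.TieBreak (Fin d),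
            ¬ (c * (d : ℝ) ^ 3 * BNSL.activeDraws k K ε ε₁ δ τ ω ≤
              Real.log (d + 2 + |Real.log ε|) ^ a * BNSL.naiveDraws (Fin d) k K ε δ)}
          ≤ ENNReal.ofReal δ := by
  set M : ℝ := 8 * (K : ℝ) ^ (k + 1) with hM
  set X : ℝ := Real.exp (Real.exp (M ^ 2 * (k + 2)) * ε₁ ^ 2) with hX
  -- For d ≥ d₀, the summands ensure in turn log(2d) ≥ 1 and k + 1 ≤ d, the two largeness conditions
  -- of `deviation_le`, T ≥ 1, 4ε ≤ γ, and that the first accuracy is at least γ/(4d).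
  obtain ⟨d₀, hd₀⟩ := exists_nat_ge (2 + k + M * (k + 1) + X + C / ε₁ + 4 * C / γ + γ / ε₁)
  set D : ℝ := 7 + 4 * |Real.log ε₁| with hD
  set R : ℝ := BNSL.ratioConst k K (C + γ) with hR
  set E : ℝ := 16 * C ^ 2 / γ ^ 2 + (q + 1) * (k + 1) * (16 * C ^ 2 / γ ^ 2 + (q + 1) ^ 2) with hE
  have hD0 : 0 < D := by positivity
  have hR0 : 0 < R := BNSL.ratioConst_pos (by positivity)
  have hE0 : 0 < E := by positivity
  have hH0 : 0 < R * D ^ 3 * (d₀ ^ 3 + E) := by positivity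
  -- The exponent 3 is that of 1 + 2 log T; d₀³ serves small dimensions and E large ones.
  refine ⟨(R * D ^ 3 * (d₀ ^ 3 + E))⁻¹, 3, inv_pos.2 hH0, ?_⟩
  intro d hqd α _ _ _ hα P _ V hV hs ε δ hε hεC hδ hδ1
  have hdpos : 0 < d := by omega
  have : Nonempty (Fin d) := ⟨⟨0, hdpos⟩⟩
  have hd1 : (1 : ℝ) ≤ d := by exact_mod_cast hdpos
  have hεC' := BNSL.le_of_le_mul_rpow hC hd1 hεC
  obtain ⟨x₀⟩ : Nonempty (∀ i, α i) := MeasureTheory.nonempty_of_isProbabilityMeasure P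
  have hK : 1 ≤ K := (Fintype.card_pos_iff.2 ⟨x₀ ⟨0, hdpos⟩⟩).trans_le (hα _)
  set l : ℝ := Real.log (d + 2 + |Real.log ε|) with hl
  have hl0 : 0 ≤ l := Real.log_nonneg (by linarith [abs_nonneg (Real.log ε)])
  have reduce : ∀ (m N : ℝ), 0 ≤ N → (d : ℝ) ^ 3 * m ≤ (d₀ ^ 3 + E) * (R * (D * l) ^ 3 * N) →
      (R * D ^ 3 * (d₀ ^ 3 + E))⁻¹ * (d : ℝ) ^ 3 * m ≤ l ^ 3 * N := by
    intro m N _ h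
    rw [mul_assoc, inv_mul_le_iff₀ hH0]
    linarith
  have hRD : ∀ N : ℝ, 0 ≤ N → 0 ≤ R * (D * l) ^ 3 * N := fun N hN => by positivity
  by_cases hsmall : d < d₀
  · rw [show {ω : BNSL.Table α | ∃ τ : BNSL.TieBreak (Fin d),
        ¬ ((R * D ^ 3 * (d₀ ^ 3 + E))⁻¹ * (d : ℝ) ^ 3 * BNSL.activeDraws k K ε ε₁ δ τ ω ≤
          l ^ 3 * BNSL.naiveDraws (Fin d) k K ε δ)} = ∅ from ?_]
    · simp
    · refine Set.eq_empty_of_forall_notMem ?_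
      rintro ω ⟨τ, hτ⟩
      refine hτ (reduce _ _ (Nat.cast_nonneg _) ?_)
      have h1 := BNSL.activeDraws_le_mul (k := k) (ω := ω) (τ := τ) hK hε hε₁ hδ hδ1
        (show ε ≤ C + γ by linarith)
      rw [Fintype.card_fin] at h1
      have h2 : (d : ℝ) ^ 3 ≤ d₀ ^ 3 := by
        have : (d : ℝ) ≤ d₀ := by exact_mod_cast hsmall.le
        gcongr
      have h3 := hRD _ (Nat.cast_nonneg (BNSL.naiveDraws (Fin d) k K ε δ))
      calc (d : ℝ) ^ 3 * (BNSL.activeDraws k K ε ε₁ δ τ ω : ℝ)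
          ≤ d ^ 3 * (R * (D * l) ^ 3 * BNSL.naiveDraws (Fin d) k K ε δ) := by gcongr
        _ ≤ (d₀ ^ 3 + E) * (R * (D * l) ^ 3 * BNSL.naiveDraws (Fin d) k K ε δ) := by
            refine mul_le_mul_of_nonneg_right ?_ h3
            linarith
  · have hdd : 2 + k + M * (k + 1) + X + C / ε₁ + 4 * C / γ + γ / ε₁ ≤ d :=
      hd₀.trans (by exact_mod_cast not_lt.1 hsmall)
    have hM0 : 0 ≤ M * (k + 1) := by positivity
    have hX0 : 0 < X := Real.exp_pos _
    have hk0 : (0 : ℝ) ≤ k := Nat.cast_nonneg k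
    have hc1 : 0 < C / ε₁ := by positivity
    have hc2 : 0 < 4 * C / γ := by positivity
    have hc3 : 0 < γ / ε₁ := by positivity
    have hCd : C ≤ d * ε₁ := (div_le_iff₀ hε₁).1 (by linarith)
    have hγd : γ ≤ d * ε₁ := (div_le_iff₀ hε₁).1 (by linarith)
    have hCγ : 4 * C ≤ d * γ := (div_le_iff₀ hγ).1 (by linarith)
    have hkd : k + 1 ≤ d := by
      have : (k : ℝ) + 1 ≤ d := by linarith
      exact_mod_cast this
    have hlog1 : 1 ≤ Real.log (2 * d) :=
      (Real.le_log_iff_exp_le (by positivity)).2 (by linarith [Real.exp_one_lt_d9])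
    have hlogX : Real.exp (M ^ 2 * (k + 2)) * ε₁ ^ 2 ≤ Real.log (2 * d) :=
      (Real.le_log_iff_exp_le (by positivity)).2 (by linarith)
    have hcube := BNSL.sq_mul_cube_le hε (by linarith) hεC
    have hεγ : 4 * ε ≤ γ := by
      have h1 : ε * d ≤ C := by
        refine le_of_sq_le_sq ?_ hC.le
        refine le_trans ?_ hcube
        have : (d : ℝ) ^ 2 ≤ d ^ 3 := pow_le_pow_right₀ hd1 (by norm_num)
        rw [mul_pow]
        gcongr
      have h2 : d * (4 * ε) ≤ d * γ := by linarith
      exact le_of_mul_le_mul_left h2 (by linarith)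
    have hT : 1 ≤ BNSL.maxRounds (Fin d) ε ε₁ := BNSL.one_le_maxRounds hε (by
      rw [Fintype.card_fin]
      have : 0 < (d : ℝ) * ε₁ := by positivity
      linarith)
    -- One exceptional event, independent of the tie-breaking, covers all choices of τ.
    refine (MeasureTheory.measure_mono ?_).trans
      (BNSL.measure_empEntropy_le P (k := k) (by rwa [Fintype.card_fin]) hK hα hδ hδ1)
    rintro ω ⟨τ, hτ⟩ hU
    refine hτ (reduce _ _ (Nat.cast_nonneg _) ?_)
    have hacc := BNSL.accurateRounds_of_uniform (ε := ε) hK hε₁ hδ hδ1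
      (by rwa [Fintype.card_fin]) (by rw [Fintype.card_fin]; linarith)
      (by rwa [Fintype.card_fin]) hT hU
    -- q + 1 replaces q so that ε/q makes sense when q = 0.
    have hfin := BNSL.activeDraws_le_of_accurateRounds (τ := τ) (B := C + γ) (C := C) (q := q + 1)
      (fun x => MeasureTheory.measureReal_nonneg) (BNSL.sum_real_singleton P) hK hε hε₁ hδ hδ1 hacc
      hγ (by linarith) hs (Nat.succ_pos q) (by rw [Fintype.card_fin]; omega)
      (by rw [Fintype.card_fin]; omega) (by rwa [Fintype.card_fin]) hεγ
      (by rw [Fintype.card_fin]; linarith)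
    rw [Fintype.card_fin] at hfin
    push_cast at hfin
    refine hfin.trans (mul_le_mul_of_nonneg_right ?_ (hRD _ (Nat.cast_nonneg _)))
    have : (0 : ℝ) ≤ (d₀ : ℝ) ^ 3 := by positivity
    linarith
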